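/- Let $d\ge 1$. A $(d,d)$-datum $D=(V,H,R)$ consists of finite sets $V,H$ with $|V|=|H|=2d$, fixed-point-free involutions $x\mapsto x^{-1}$ on $V$ and on $H$, and a subset $R\subset V\times H\times H\times V$ such that: (1) if $(a,b,c,e)\in R$, then $(a^{-1},c,b,e^{-1})$, $(e^{-1},c^{-1},b^{-1},a^{-1})$, $(e,b^{-1},c^{-1},a)\in R$; (2) $(a,b,b^{-1},a^{-1})\notin R$ for all $a\in V$, $b\in H$; (3) each of the four projections of $R$ to a subproduct of the form $V\times H$ or $H\times V$ is bijective. *The subshift.* $X_D$ is the set of all $x:\mathbb Z^2\to R$ such that, for every position, (i) if $t=(a,b,c,e)$ and $t'=(a',b',c',e')$ are the symbols at $(i,j)$ and $(i+1,j)$, then $e=a'$ and $c'\ne c^{-1}$; (ii) if $t,t'$ are the symbols at $(i,j)$ and $(i,j+1)$, then $b=c'$ and $a'\neq a^{-1}$. A $\mathbb Z^2$-subshift of finite type $X$ is *$q$-regular* if every rectangular pattern that occurs in $X$ has exactly $q$ extensions, in each of the four directions, by one column or row to a rectangular pattern that occurs in $X$. Its natural measure $\mu$ is the Borel probability measure giving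 every cylinder set of an occurring $m\times n$ rectangular pattern the mass $1/(s\,q^{m-1}q^{n-1})$, where $s$ is the number of symbols that occur in $X$. Write $(\sigma^n x)(b)=x(n+b)$. A $q$-regular $X$ is *Ramanujan* if $(X,\mathbb Z^2,\mu)$ is strongly mixing, i.e. $\int (f\circ\sigma^n)g\,d\mu\to\int f\,d\mu\int g\,d\mu$ as $\|n\|_\infty\to\infty$ for all $f,g\in L^2(X,\mu)$, and there is $r\ge 0$ such that for all locally constant $f,g:X\to\mathbb C$ there is $C>0$ with $$\Big|\int_X (f\circ\sigma^n)g\,d\mu-\int_X f\,d\mu\int_X g\,d\mu\Big|\le C\,\|n\|_\infty^{\,r}\,\big(1/\sqrt q\big)^{\|n\|_\infty}\qquad\text{for all } n\in\mathbb Z^2\setminus\{0\}.$$ *The graphs.* Let $\Gamma_D=\langle V\sqcup H\mid xx^{-1}=e\ (x\in V\sqcup H),\ ab=ce\ ((a,b,c,e)\in R)\rangle$, where in $xx^{-1}$ the symbol $x^{-1}$ is the generator given by the involution. For $k\ge 0$, the vertices of $A_k(\Gamma_D)$ are the reduced words of length $k$ over $H$; for each $a\in V$ there is a directed edge $w\xrightarrow{a}w'$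 whenever $a\,w=w'\,a'$ in $\Gamma_D$ for some $a'\in V$, and $w\xrightarrow{a}w'$ and $w'\xrightarrow{a^{-1}}w$ are identified to one undirected edge. Thus loops (each contributing two to the degree) and multiple edges are allowed. The graph $B_k(\Gamma_D)$ is defined in the same way with $V$ and $H$ interchanged: its vertices are the reduced words of length $k$ over $V$, and $w\xrightarrow{b}w'$ for $b\in H$ whenever $b\,w=w'\,b'$ in $\Gamma_D$ for some $b'\in H$. A finite connected $2d$-regular graph is *Ramanujan* if every eigenvalue $\lambda$ of its adjacency matrix satisfies $\lambda=\pm 2d$ or $|\lambda|\le 2\sqrt{2d-1}$. **Proposition.** For every $(d,d)$-datum $D$ with $d\ge1$, the subshift $X_D$ is $(2d-1)$-regular, and $X_D$ is Ramanujan if and only if, for every $k\ge 0$, the graphs $A_k(\Gamma_D)$ and $B_k(\Gamma_D)$ are (connected, $2d$-regular) non-bipartite Ramanujan graphs. -/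

import Mathlib

open Filter MeasureTheory
open scoped ENNReal

/-! ### Two-dimensional subshifts -/

/-- The shift on `W^(ℤ²)`: `(σ^a x)(b) = x(a + b)`. -/
def planeShift {W : Type*} (a : ℤ × ℤ) (x : ℤ × ℤ → W) : ℤ × ℤ → W := fun b => x (a + b)

/-- A `ℤ²`-subshift over the alphabet `W`: a closed shift-invariant set of configurations. -/
structure PlaneSubshift (W : Type*) [TopologicalSpace W] where
  carrier : Set (ℤ × ℤ → W)
  isClosed : IsClosed carrier
  shift_mem : ∀ (a : ℤ × ℤ) (x : ℤ × ℤ → W), x ∈ carrier → planeShift a x ∈ carrier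

namespace PlaneSubshift

variable {W : Type*} [TopologicalSpace W]

/-- The action `σ^a : X → X`. -/
def shift (X : PlaneSubshift W) (a : ℤ × ℤ) (x : X.carrier) : X.carrier :=
  ⟨planeShift a x.1, X.shift_mem a x.1 x.2⟩

/-- Patterns of shape `F` that occur in `X`. -/
def patterns (X : PlaneSubshift W) (F : Finset (ℤ × ℤ)) : Set (F → W) :=
  {p | ∃ x ∈ X.carrier, ∀ b : F, x b = p b}

/-- `X` is of finite type: it is given by a set `P` of allowed patterns of one finite shape `F`. -/
def IsOfFiniteType (X : PlaneSubshift W) : Prop :=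
  ∃ (F : Finset (ℤ × ℤ)) (P : Set (F → W)), P.Finite ∧
    X.carrier = {x | ∀ a : ℤ × ℤ, (fun b : F => planeShift a x b) ∈ P}

/-- Every pattern of shape `F` that occurs in `X` has exactly `d` extensions to a pattern of
shape `F'` that occurs in `X`. -/
def HasExtensions (X : PlaneSubshift W) (d : ℕ) (F F' : Finset (ℤ × ℤ)) (h : F ⊆ F') : Prop :=
  ∀ p ∈ X.patterns F,
    {p' : F' → W | p' ∈ X.patterns F' ∧ ∀ b : F, p' ⟨b, h b.2⟩ = p b}.encard = d

/-- `d`-regular `ℤ²`-subshifts of finite type: each rectangular pattern occurring in `X` (the shape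
being `[1,m] × [1,n]`, `m, n ≥ 1`) has exactly `d` extensions by one column to the right and to the
left and by one row upward and downward. -/
def IsRegular (X : PlaneSubshift W) (d : ℕ) : Prop :=
  X.IsOfFiniteType ∧ ∀ m n : ℤ, 1 ≤ m → 1 ≤ n →
    X.HasExtensions d (Finset.Icc (1, 1) (m, n)) (Finset.Icc (1, 1) (m + 1, n))
      (Finset.Icc_subset_Icc le_rfl (by simp)) ∧
    X.HasExtensions d (Finset.Icc (1, 1) (m, n)) (Finset.Icc (0, 1) (m, n))
      (Finset.Icc_subset_Icc (by simp) le_rfl) ∧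
    X.HasExtensions d (Finset.Icc (1, 1) (m, n)) (Finset.Icc (1, 1) (m, n + 1))
      (Finset.Icc_subset_Icc le_rfl (by simp)) ∧
    X.HasExtensions d (Finset.Icc (1, 1) (m, n)) (Finset.Icc (1, 0) (m, n))
      (Finset.Icc_subset_Icc (by simp) le_rfl)

/-- The number of symbols of `W` that occur in `X`. -/
noncomputable def symbolCount (X : PlaneSubshift W) : ℕ :=
  {w : W | ∃ x ∈ X.carrier, x 0 = w}.ncard

/-- `μ` is the natural measure of the `d`-regular subshift `X`: the Borel probability measure that
gives each cylinder, fixed by an occurring pattern on an `(m+1) × (n+1)` rectangle with lower left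
corner `a`, the mass `1 / (s d^m d^n)`, where `s` is the number of symbols that occur in `X`. -/
def IsNaturalMeasure [MeasurableSpace W] (X : PlaneSubshift W) (d : ℕ)
    (μ : Measure X.carrier) : Prop :=
  IsProbabilityMeasure μ ∧
    ∀ (a : ℤ × ℤ) (m n : ℕ) (x : X.carrier),
      μ {y | ∀ b ∈ Set.Icc a (a + ((m : ℤ), (n : ℤ))), y.1 b = x.1 b} =
        ((X.symbolCount * d ^ m * d ^ n : ℕ) : ℝ≥0∞)⁻¹

/-- `∫ (f ∘ σ^n) g dμ - ∫ f dμ ∫ g dμ`. -/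
noncomputable def correlation [MeasurableSpace W] (X : PlaneSubshift W) (μ : Measure X.carrier)
    (f g : X.carrier → ℂ) (n : ℤ × ℤ) : ℂ :=
  (∫ x, f (X.shift n x) * g x ∂μ) - (∫ x, f x ∂μ) * (∫ x, g x ∂μ)

/-- Strong mixing of `(X, ℤ², μ)`: correlations of square integrable functions tend to `0` as
`n → ∞` in `ℤ²`, that is, along the complements of the finite subsets of `ℤ²`. -/
def IsStronglyMixing [MeasurableSpace W] (X : PlaneSubshift W) (μ : Measure X.carrier) : Prop :=
  ∀ f g : X.carrier → ℂ, MemLp f 2 μ → MemLp g 2 μ →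
    Tendsto (X.correlation μ f g) cofinite (nhds 0)

/-- `‖n‖_∞` on `ℤ²`. -/
def supNorm (n : ℤ × ℤ) : ℕ := max n.1.natAbs n.2.natAbs

/-- A `d`-regular `ℤ²`-subshift is Ramanujan if it is strongly mixing with respect to its natural
measure and, for one exponent `r ≥ 0`, the correlations of any two locally constant functions are
`O(‖n‖_∞^r d^(-‖n‖_∞ / 2))`. The exponent `r` does not depend on the functions. -/
def IsRamanujan [MeasurableSpace W] (X : PlaneSubshift W) (d : ℕ) : Prop :=
  X.IsRegular d ∧ ∃ μ : Measure X.carrier, X.IsNaturalMeasure d μ ∧ X.IsStronglyMixing μ ∧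
    ∃ r : ℝ, 0 ≤ r ∧ ∀ f g : X.carrier → ℂ, IsLocallyConstant f → IsLocallyConstant g →
      ∃ C : ℝ, 0 < C ∧ ∀ n : ℤ × ℤ, n ≠ 0 →
        ‖X.correlation μ f g n‖ ≤ C * (supNorm n : ℝ) ^ r * (1 / √(d : ℝ)) ^ supNorm n

/-- The matrix subshift `X(A, B)`; the `{0,1}`-matrices `A` (horizontal transitions) and `B`
(vertical transitions) are given as relations. -/
def ofTransitions [DiscreteTopology W] (A B : W → W → Prop) : PlaneSubshift W where
  carrier := {x | ∀ n m : ℤ, A (x (n, m)) (x (n + 1, m)) ∧ B (x (n, m)) (x (n, m + 1))}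
  isClosed := by
    have key : ∀ (P : W → W → Prop) (b c : ℤ × ℤ),
        IsClosed {x : ℤ × ℤ → W | P (x b) (x c)} := fun P b c =>
      IsClosed.preimage (f := fun x : ℤ × ℤ → W => (x b, x c))
        ((continuous_apply b).prodMk (continuous_apply c))
        (isClosed_discrete {p : W × W | P p.1 p.2})
    simp only [Set.ofPred_forall, Set.ofPred_and]
    exact isClosed_iInter fun n => isClosed_iInter fun m => (key _ _ _).inter (key _ _ _)
  shift_mem := by
    rintro ⟨a, b⟩ x hx n m
    have h := hx (a + n) (b + m)
    simpa [planeShift, add_assoc] using h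

end PlaneSubshift

/-! ### Graphs with loops and multiple edges -/

/-- An undirected graph, possibly with loops and multiple edges, with vertex set `V`. The set `E`
consists of the directed edges; each geometric edge (also each loop) is a pair `{e, rev e}`. -/
structure LoopMultigraph (V E : Type*) where
  org : E → V
  tgt : E → V
  rev : E → E
  rev_rev : ∀ e, rev (rev e) = e
  rev_ne : ∀ e, rev e ≠ e
  org_rev : ∀ e, org (rev e) = tgt e

namespace LoopMultigraph

variable {V E : Type*} (G : LoopMultigraph V E)

/-- `k`-regularity; a loop contributes two to the degree of its vertex. -/
def IsRegularOfDegree (k : ℕ) : Prop := ∀ v, Nat.card {e // G.org e = v} = k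

def IsConnected : Prop :=
  Nonempty V ∧ ∀ u v, Relation.ReflTransGen (fun x y => ∃ e, G.org e = x ∧ G.tgt e = y) u v

def IsBipartite : Prop := ∃ c : V → Bool, ∀ e, c (G.org e) ≠ c (G.tgt e)

/-- The adjacency matrix: the `(u, v)` entry counts the directed edges from `u` to `v`. -/
noncomputable def adjMatrix : Matrix V V ℝ :=
  Matrix.of fun u v => (Nat.card {e // G.org e = u ∧ G.tgt e = v} : ℝ)

/-- A finite connected `k`-regular graph is Ramanujan if each eigenvalue `ev` of its adjacency
matrix satisfies `ev = ± k` or `|ev| ≤ 2 √(k - 1)`. -/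
def IsRamanujan [Fintype V] [Finite E] (k : ℕ) : Prop :=
  G.IsConnected ∧ G.IsRegularOfDegree k ∧
    ∀ ev : ℝ, Module.End.HasEigenvalue G.adjMatrix.mulVecLin ev →
      ev = k ∨ ev = -k ∨ |ev| ≤ 2 * √((k : ℝ) - 1)

end LoopMultigraph

/-! ### Schreier graphs on reduced words -/

/-- Reduced words of length `k` over `T`, where `i` is the involution `x ↦ x⁻¹` of `T`. -/
def ReducedWord {T : Type*} (i : T → T) (k : ℕ) : Type _ :=
  {w : List T // w.length = k ∧ w.IsChain (fun x y => y ≠ i x)}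

instance ReducedWord.instFinite {T : Type*} [Finite T] (i : T → T) (k : ℕ) :
    Finite (ReducedWord i k) :=
  ((List.finite_length_eq T k).subset fun _ h => h.1).to_subtype

noncomputable instance ReducedWord.instFintype {T : Type*} [Finite T] (i : T → T) (k : ℕ) :
    Fintype (ReducedWord i k) := Fintype.ofFinite _

/-- The element of the group `Γ` represented by a reduced word. -/
def ReducedWord.eval {T Γ : Type*} [Group Γ] {i : T → T} {k : ℕ} (t : T → Γ)
    (w : ReducedWord i k) : Γ := (w.1.map t).prod

/-- The directed edges `w --a--> w'`, with `a` in `S`, and `w`, `w'` reduced words of length `k`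
over `T`, such that `a w = w' d` in `Γ` for some `d` in `S`: the word `w'` is the image of `w` under
the action of `a`. -/
def SchreierEdge {S T Γ : Type*} [Group Γ] (s : S → Γ) (t : T → Γ) (i : T → T) (k : ℕ) : Type _ :=
  {e : S × ReducedWord i k × ReducedWord i k //
    ∃ d : S, s e.1 * e.2.1.eval t = e.2.2.eval t * s d}

instance SchreierEdge.instFinite {S T Γ : Type*} [Group Γ] [Finite S] [Finite T] (s : S → Γ)
    (t : T → Γ) (i : T → T) (k : ℕ) : Finite (SchreierEdge s t i k) :=
  inferInstanceAs (Finite {e : S × ReducedWord i k × ReducedWord i k //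
    ∃ d : S, s e.1 * e.2.1.eval t = e.2.2.eval t * s d})

/-- The undirected Schreier graph of the action of the generators `S` on the reduced words of
length `k` over `T`; the reverse of `w --a--> w'` is `w' --a⁻¹--> w`. -/
def schreierGraph {S T Γ : Type*} [Group Γ] (s : S → Γ) (t : T → Γ) (j : S → S) (i : T → T)
    (hj : ∀ x, j (j x) = x) (hj_ne : ∀ x, j x ≠ x) (hs : ∀ x, s (j x) = (s x)⁻¹) (k : ℕ) :
    LoopMultigraph (ReducedWord i k) (SchreierEdge s t i k) where
  org e := e.1.2.1
  tgt e := e.1.2.2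
  rev e := ⟨(j e.1.1, e.1.2.2, e.1.2.1), by
    obtain ⟨d, hd⟩ := e.2
    exact ⟨j d, by rw [hs, hs, inv_mul_eq_iff_eq_mul, ← mul_assoc, hd, mul_inv_cancel_right]⟩⟩
  rev_rev e := Subtype.ext (by simp [hj])
  rev_ne e h := hj_ne e.1.1 (congrArg (fun e' => e'.1.1) h)
  org_rev _ := rfl

/-! ### VH-data -/

/-- An `(m, n)`-datum `(V, H, R)`. -/
structure VHDatum (V H : Type*) (m n : ℕ) where
  card_V : Nat.card V = 2 * m
  card_H : Nat.card H = 2 * n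
  invV : V → V
  invH : H → H
  invV_invV : ∀ a, invV (invV a) = a
  invH_invH : ∀ b, invH (invH b) = b
  invV_ne : ∀ a, invV a ≠ a
  invH_ne : ∀ b, invH b ≠ b
  R : Set (V × H × H × V)
  symm₁ : ∀ a b c d, (a, b, c, d) ∈ R → (invV a, c, b, invV d) ∈ R
  symm₂ : ∀ a b c d, (a, b, c, d) ∈ R → (invV d, invH c, invH b, invV a) ∈ R
  symm₃ : ∀ a b c d, (a, b, c, d) ∈ R → (d, invH b, invH c, a) ∈ R
  not_mem : ∀ a b, (a, b, invH b, invV a) ∉ R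
  bij_left_top : Function.Bijective fun t : R => (t.1.1, t.1.2.1)
  bij_left_bottom : Function.Bijective fun t : R => (t.1.1, t.1.2.2.1)
  bij_top_right : Function.Bijective fun t : R => (t.1.2.1, t.1.2.2.2)
  bij_bottom_right : Function.Bijective fun t : R => (t.1.2.2.1, t.1.2.2.2)

namespace VHDatum

variable {V H : Type*} {m n : ℕ} (D : VHDatum V H m n)

/-- The alphabet `R`, viewed as a set of unit square tiles. -/
def Tile : Type _ := D.R

variable {D} in
def Tile.left (t : D.Tile) : V := t.1.1

variable {D} in
def Tile.top (t : D.Tile) : H := t.1.2.1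

variable {D} in
def Tile.bottom (t : D.Tile) : H := t.1.2.2.1

variable {D} in
def Tile.right (t : D.Tile) : V := t.1.2.2.2

instance : TopologicalSpace D.Tile := ⊥

instance : DiscreteTopology D.Tile := ⟨rfl⟩

instance : MeasurableSpace D.Tile := ⊤

/-- The transition matrix `A`: `t'` may be placed to the right of `t`. -/
def horizontal (t t' : D.Tile) : Prop := t.right = t'.left ∧ t'.bottom ≠ D.invH t.bottom

/-- The transition matrix `B`: `t'` may be placed above `t`. -/
def vertical (t t' : D.Tile) : Prop := t.top = t'.bottom ∧ t'.left ≠ D.invV t.left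

/-- The subshift `X_D`. -/
def subshift : PlaneSubshift D.Tile := PlaneSubshift.ofTransitions D.horizontal D.vertical

/-- The relators `a a⁻¹` (`a` in `V` or `H`) and `a b (c d)⁻¹` (`(a, b, c, d)` in `R`). -/
def relators : Set (FreeGroup (V ⊕ H)) :=
  {g | (∃ a : V, g = FreeGroup.of (Sum.inl a) * FreeGroup.of (Sum.inl (D.invV a))) ∨
    (∃ b : H, g = FreeGroup.of (Sum.inr b) * FreeGroup.of (Sum.inr (D.invH b))) ∨
    ∃ (a : V) (b : H) (c : H) (d : V), (a, b, c, d) ∈ D.R ∧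
      g = FreeGroup.of (Sum.inl a) * FreeGroup.of (Sum.inr b) *
        (FreeGroup.of (Sum.inr c) * FreeGroup.of (Sum.inl d))⁻¹}

/-- The group `Γ_D = ⟨V, H | a a⁻¹ = e for a ∈ V ∪ H, ab = cd for (a, b, c, d) ∈ R⟩`. -/
abbrev Gamma : Type _ := PresentedGroup D.relators

def genV (a : V) : D.Gamma := PresentedGroup.of (Sum.inl a)

def genH (b : H) : D.Gamma := PresentedGroup.of (Sum.inr b)

theorem genV_inv (a : V) : D.genV (D.invV a) = (D.genV a)⁻¹ :=
  (inv_eq_of_mul_eq_one_right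
    (PresentedGroup.one_of_mem (rels := D.relators) (Or.inl ⟨a, rfl⟩))).symm

theorem genH_inv (b : H) : D.genH (D.invH b) = (D.genH b)⁻¹ :=
  (inv_eq_of_mul_eq_one_right
    (PresentedGroup.one_of_mem (rels := D.relators) (Or.inr (Or.inl ⟨b, rfl⟩)))).symm

/-- The Schreier graph `A_k(Γ_D)` of the action of `⟨V⟩` on the reduced words of length `k`
over `H`. -/
def graphA (k : ℕ) :
    LoopMultigraph (ReducedWord D.invH k) (SchreierEdge D.genV D.genH D.invH k) :=
  schreierGraph D.genV D.genH D.invV D.invH D.invV_invV D.invV_ne D.genV_inv k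

/-- The Schreier graph `B_k(Γ_D)` of the action of `⟨H⟩` on the reduced words of length `k`
over `V`. -/
def graphB (k : ℕ) :
    LoopMultigraph (ReducedWord D.invV k) (SchreierEdge D.genH D.genV D.invV k) :=
  schreierGraph D.genH D.genV D.invH D.invV D.invH_invH D.invH_ne D.genH_inv k

end VHDatum

/-! A tile with left, top, bottom and right edges a, b, c, e records the relation c e = a b. Pushing
a horizontal letter through a vertical word, tile by tile, therefore permutes the reduced vertical
words of each length. These permutations, together with left multiplication by vertical letters,
make Γ_D act on all reduced vertical words. A reduced word applied to the empty word returns itself,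
so the edges of B_k are exactly the arrows of the permutations U_h (`exists_edge_graphB_iff`), and
A_k is the same graph for the transposed datum. By the maximum principle, being connected,
non-bipartite and Ramanujan then amounts to `HasSpectralGap`: with q = 2d - 1, every eigenvalue of ∑
U_h on functions of mean zero has absolute value at most 2√q and different from 2d. The second
condition adds something only for d = 1.

On the side of the subshift, a rectangular pattern is the same thing as a pair of reduced words, its
left and its bottom edge, and all pairs occur. This gives regularity, and it makes the natural
measure uniform on such pairs. Moving n columns to the right replaces the left word by its slide
along the first n bottom letters. Horizontal correlations are thus averages over reduced horizontal
words, that is, coefficients of powers of the non-backtracking operator T attached to the U_h,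
divided by a multiple of q^n.

If there is a spectral gap, the sums of U over the words of given length satisfy a second order
recurrence whose characteristic roots have modulus √q. Hence T^n is at most a constant times n^3
√q^n on functions of mean zero (`norm_nonBacktracking_pow_le`), and division by q^n leaves n^3
q^(-n/2). For a shift (n₁, n₂) with |n₂| ≤ |n₁|, the vertical part is absorbed into a taller
rectangle of unchanged width; the estimate is uniform in the height (`exists_norm_correlation_le`).
The remaining directions follow by transposition. Strong mixing extends from locally constant
functions to L² by density.

Conversely, an eigenvector of mean zero, read along the left edge, is a locally constant test
function whose autocorrelations are explicit in the eigenvalue (`correlation_comp_colWord`). An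
eigenvalue beyond 2√q would make them decay too slowly, and eigenvalues ±2d would prevent mixing. -/

/-! ### Transducers acting on reduced words. -/

/-- A finite-state transducer `(s, t) ↦ (out s t, next s t)` whose transitions are compatible with
involutions of the states `S` and of the letters `T`. -/
structure Transducer (S T : Type*) where
  j : S → S
  i : T → T
  out : S → T → T
  next : S → T → S
  j_j : ∀ s, j (j s) = s
  i_i : ∀ t, i (i t) = t
  out_inv : ∀ s t, out (j s) (out s t) = t
  next_inv : ∀ s t, next (j s) (out s t) = j (next s t)
  out_next : ∀ s t, out (next s t) (i t) = i (out s t)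
  next_next : ∀ s t, next (next s t) (i t) = s

namespace Transducer

variable {S T : Type*} (M : Transducer S T)

theorem out_injective (s : S) : Function.Injective (M.out s) :=
  Function.LeftInverse.injective (g := M.out (M.j s)) (M.out_inv s)

/-- The action of a state on words. -/
def act : S → List T → List T
  | _, [] => []
  | s, t :: l => M.out s t :: act (M.next s t) l

/-- The state reached after reading a word. -/
def final : S → List T → S
  | s, [] => s
  | s, t :: l => final (M.next s t) l

@[simp] theorem act_nil (s : S) : M.act s [] = [] := rfl

@[simp] theorem act_cons (s : S) (t : T) (l : List T) :
    M.act s (t :: l) = M.out s t :: M.act (M.next s t) l := rfl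

@[simp] theorem length_act (s : S) (l : List T) : (M.act s l).length = l.length := by
  induction l generalizing s with
  | nil => rfl
  | cons t l ih => simp [ih]

theorem act_j_act (s : S) (l : List T) : M.act (M.j s) (M.act s l) = l := by
  induction l generalizing s with
  | nil => rfl
  | cons t l ih => simp [M.out_inv, M.next_inv, ih]

/-- A word is reduced if no letter is followed by its inverse. -/
abbrev IsReduced (l : List T) : Prop := l.IsChain (fun x y => y ≠ M.i x)

theorem isReduced_act {l : List T} (hl : M.IsReduced l) (s : S) : M.IsReduced (M.act s l) := by
  induction l generalizing s with
  | nil => exact List.isChain_nil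
  | cons t l ih =>
    cases l with
    | nil => exact List.isChain_singleton _
    | cons u l =>
      rw [IsReduced, List.isChain_cons_cons] at hl
      have := ih hl.2 (M.next s t)
      simp only [act_cons] at this ⊢
      rw [IsReduced, List.isChain_cons_cons]
      refine ⟨fun h => hl.1 (M.out_injective (M.next s t) ?_), this⟩
      rw [h, M.out_next]

/-- The permutation of the reduced words of length `k` given by a state. -/
def actWord (k : ℕ) (s : S) : Equiv.Perm (ReducedWord M.i k) where
  toFun w := ⟨M.act s w.1, by simp [w.2.1], M.isReduced_act w.2.2 s⟩
  invFun w := ⟨M.act (M.j s) w.1, by simp [w.2.1], M.isReduced_act w.2.2 _⟩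
  left_inv w := Subtype.ext (M.act_j_act s w.1)
  right_inv w := Subtype.ext (by simpa [M.j_j] using M.act_j_act (M.j s) w.1)

theorem actWord_j (k : ℕ) (s : S) : M.actWord k (M.j s) = (M.actWord k s)⁻¹ :=
  Equiv.ext fun _ => rfl

/-! ### Permutations of the reduced words and uniqueness of the reduced form. -/

section GroupAction

open Classical in
/-- Left multiplication by a letter, followed by cancellation. -/
noncomputable def mulLetter (t : T) : List T → List T
  | [] => [t]
  | u :: l => if u = M.i t then l else t :: u :: l

theorem mulLetter_cons_self (t : T) (l : List T) : M.mulLetter t (M.i t :: l) = l := by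
  simp [mulLetter]

theorem mulLetter_cons_of_ne {t u : T} (h : u ≠ M.i t) (l : List T) :
    M.mulLetter t (u :: l) = t :: u :: l := by
  simp [mulLetter, h]

theorem mulLetter_of_isReduced {t : T} {l : List T} (h : M.IsReduced (t :: l)) :
    M.mulLetter t l = t :: l := by
  cases l with
  | nil => rfl
  | cons u l => exact M.mulLetter_cons_of_ne (List.isChain_cons_cons.1 h).1 l

theorem isReduced_mulLetter (t : T) {l : List T} (hl : M.IsReduced l) :
    M.IsReduced (M.mulLetter t l) := by
  cases l with
  | nil => exact List.isChain_singleton _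
  | cons u l =>
    by_cases h : u = M.i t
    · subst h
      rw [mulLetter_cons_self]
      exact hl.tail
    · rw [M.mulLetter_cons_of_ne h]
      exact List.isChain_cons_cons.2 ⟨h, hl⟩

theorem mulLetter_mulLetter {l : List T} (hl : M.IsReduced l) (t : T) :
    M.mulLetter (M.i t) (M.mulLetter t l) = l := by
  have key : ∀ m : List T, M.mulLetter (M.i t) (t :: m) = m := fun m => by
    simpa [M.i_i] using M.mulLetter_cons_self (M.i t) m
  cases l with
  | nil => exact key []
  | cons u l =>
    by_cases h : u = M.i t
    · subst h
      rw [mulLetter_cons_self]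
      exact M.mulLetter_of_isReduced hl
    · rw [M.mulLetter_cons_of_ne h, key]

/-- Cancellation survives the action: after reading t and then t⁻¹ the transducer is back in its
original state and has written a letter followed by its inverse. This is the relation s t = t' s' at
the level of permutations. -/
theorem act_mulLetter {l : List T} (hl : M.IsReduced l) (s : S) (t : T) :
    M.act s (M.mulLetter t l) = M.mulLetter (M.out s t) (M.act (M.next s t) l) := by
  cases l with
  | nil => rfl
  | cons u l =>
    by_cases h : u = M.i t
    · subst h
      rw [mulLetter_cons_self, act_cons, M.out_next, M.next_next, mulLetter_cons_self]
    · rw [M.mulLetter_cons_of_ne h, act_cons, M.mulLetter_of_isReduced]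
      have : M.IsReduced (t :: u :: l) := List.isChain_cons_cons.2 ⟨h, hl⟩
      exact M.isReduced_act this s

/-- The permutation of all reduced words given by left multiplication by a letter. -/
noncomputable def letterPerm (t : T) : Equiv.Perm {l : List T // M.IsReduced l} where
  toFun l := ⟨M.mulLetter t l.1, M.isReduced_mulLetter t l.2⟩
  invFun l := ⟨M.mulLetter (M.i t) l.1, M.isReduced_mulLetter _ l.2⟩
  left_inv l := Subtype.ext (M.mulLetter_mulLetter l.2 t)
  right_inv l := Subtype.ext (by simpa [M.i_i] using M.mulLetter_mulLetter l.2 (M.i t))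

/-- The permutation of all reduced words given by a state. -/
def statePerm (s : S) : Equiv.Perm {l : List T // M.IsReduced l} where
  toFun l := ⟨M.act s l.1, M.isReduced_act l.2 s⟩
  invFun l := ⟨M.act (M.j s) l.1, M.isReduced_act l.2 _⟩
  left_inv l := Subtype.ext (M.act_j_act s l.1)
  right_inv l := Subtype.ext (by simpa [M.j_j] using M.act_j_act (M.j s) l.1)

theorem letterPerm_mul_i (t : T) : M.letterPerm t * M.letterPerm (M.i t) = 1 := by
  refine Equiv.ext fun l => Subtype.ext ?_
  have := M.mulLetter_mulLetter l.2 (M.i t)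
  rwa [M.i_i] at this

theorem statePerm_mul_j (s : S) : M.statePerm s * M.statePerm (M.j s) = 1 := by
  refine Equiv.ext fun l => Subtype.ext ?_
  have := M.act_j_act (M.j s) l.1
  rwa [M.j_j] at this

theorem statePerm_mul_letterPerm (s : S) (t : T) :
    M.statePerm s * M.letterPerm t = M.letterPerm (M.out s t) * M.statePerm (M.next s t) := by
  ext l : 2
  exact M.act_mulLetter l.2 s t

variable {Γ : Type*} [Group Γ] {s : S → Γ} {t : T → Γ}

theorem mul_prod_map (h : ∀ a b, s a * t b = t (M.out a b) * s (M.next a b)) (a : S) (l : List T) :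
    s a * (l.map t).prod = ((M.act a l).map t).prod * s (M.final a l) := by
  induction l generalizing a with
  | nil => simp [final]
  | cons u l ih =>
    rw [List.map_cons, List.prod_cons, ← mul_assoc, h, mul_assoc, ih, act_cons, List.map_cons,
      List.prod_cons, mul_assoc, final]

/-- In a group acting on the reduced words, `a w = w' d` means that `w'` is the image of `w`. -/
theorem exists_mul_eval_eq_iff (h : ∀ a b, s a * t b = t (M.out a b) * s (M.next a b))
    (φ : Γ →* Equiv.Perm {l : List T // M.IsReduced l}) (hs : ∀ a, φ (s a) = M.statePerm a)
    (ht : ∀ b, φ (t b) = M.letterPerm b) {k : ℕ} (a : S) (w w' : ReducedWord M.i k) :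
    (∃ e, s a * w.eval t = w'.eval t * s e) ↔ w' = M.actWord k a w := by
  -- Evaluating at the empty word recovers a reduced word from its group element.
  have key : ∀ l (hl : M.IsReduced l),
      φ (l.map t).prod ⟨[], List.isChain_nil⟩ = ⟨l, hl⟩ := by
    intro l hl
    induction l with
    | nil => simp
    | cons u l ih =>
      rw [List.map_cons, List.prod_cons, map_mul, Equiv.Perm.mul_apply, ih hl.tail, ht]
      exact Subtype.ext (M.mulLetter_of_isReduced hl)
  constructor
  · rintro ⟨e, he⟩
    have := congrArg (fun g => φ g ⟨[], List.isChain_nil⟩) he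
    simp only [map_mul, Equiv.Perm.mul_apply, hs, ReducedWord.eval] at this
    rw [key _ w.2.2] at this
    -- States fix the empty word, so the unknown factor on the right disappears.
    have h0 : M.statePerm e ⟨[], List.isChain_nil⟩ = ⟨[], List.isChain_nil⟩ := rfl
    rw [h0, key _ w'.2.2] at this
    exact Subtype.ext (congrArg Subtype.val this).symm
  · rintro rfl
    exact ⟨_, M.mul_prod_map h a w.1⟩

end GroupAction

end Transducer

/-! ### The transducer of a datum and the edges of the Schreier graphs. -/

namespace VHDatum

variable {V H : Type*} {m n : ℕ} (D : VHDatum V H m n)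

/-- The datum with the two directions interchanged. -/
def transpose : VHDatum H V n m where
  card_V := D.card_H
  card_H := D.card_V
  invV := D.invH
  invH := D.invV
  invV_invV := D.invH_invH
  invH_invH := D.invV_invV
  invV_ne := D.invH_ne
  invH_ne := D.invV_ne
  R := {t | (t.2.2.1, t.2.2.2, t.1, t.2.1) ∈ D.R}
  symm₁ _ _ _ _ h := D.symm₃ _ _ _ _ h
  symm₂ _ _ _ _ h := D.symm₂ _ _ _ _ h
  symm₃ _ _ _ _ h := D.symm₁ _ _ _ _ h
  not_mem a b h := D.not_mem (D.invV b) (D.invH a) (by simpa [D.invV_invV, D.invH_invH] using h)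
  bij_left_top := by
    refine ⟨fun x y h => ?_, fun p => ?_⟩
    · have := @D.bij_bottom_right.1 ⟨_, x.2⟩ ⟨_, y.2⟩ (by simpa using h)
      simp only [Subtype.mk.injEq, Prod.mk.injEq] at this
      exact Subtype.ext (by ext <;> simp_all)
    · obtain ⟨t, ht⟩ := D.bij_bottom_right.2 p
      exact ⟨⟨(t.1.2.2.1, t.1.2.2.2, t.1.1, t.1.2.1), t.2⟩, ht⟩
  bij_left_bottom := by
    refine ⟨fun x y h => ?_, fun p => ?_⟩
    · have := @D.bij_left_bottom.1 ⟨_, x.2⟩ ⟨_, y.2⟩ (by simp at h ⊢; tauto)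
      simp only [Subtype.mk.injEq, Prod.mk.injEq] at this
      exact Subtype.ext (by ext <;> simp_all)
    · obtain ⟨t, ht⟩ := D.bij_left_bottom.2 p.swap
      exact ⟨⟨(t.1.2.2.1, t.1.2.2.2, t.1.1, t.1.2.1), t.2⟩, congrArg Prod.swap ht⟩
  bij_top_right := by
    refine ⟨fun x y h => ?_, fun p => ?_⟩
    · have := @D.bij_top_right.1 ⟨_, x.2⟩ ⟨_, y.2⟩ (by simp at h ⊢; tauto)
      simp only [Subtype.mk.injEq, Prod.mk.injEq] at this
      exact Subtype.ext (by ext <;> simp_all)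
    · obtain ⟨t, ht⟩ := D.bij_top_right.2 p.swap
      exact ⟨⟨(t.1.2.2.1, t.1.2.2.2, t.1.1, t.1.2.1), t.2⟩, congrArg Prod.swap ht⟩
  bij_bottom_right := by
    refine ⟨fun x y h => ?_, fun p => ?_⟩
    · have := @D.bij_left_top.1 ⟨_, x.2⟩ ⟨_, y.2⟩ (by simpa using h)
      simp only [Subtype.mk.injEq, Prod.mk.injEq] at this
      exact Subtype.ext (by ext <;> simp_all)
    · obtain ⟨t, ht⟩ := D.bij_left_top.2 p
      exact ⟨⟨(t.1.2.2.1, t.1.2.2.2, t.1.1, t.1.2.1), t.2⟩, ht⟩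

/-- The tile with given bottom and right edges. -/
noncomputable def tileBR (b : H) (a : V) : D.Tile := (D.bij_bottom_right.2 (b, a)).choose

theorem tileBR_bottom (b : H) (a : V) : (D.tileBR b a).bottom = b :=
  congrArg Prod.fst (D.bij_bottom_right.2 (b, a)).choose_spec

theorem tileBR_right (b : H) (a : V) : (D.tileBR b a).right = a :=
  congrArg Prod.snd (D.bij_bottom_right.2 (b, a)).choose_spec

theorem eq_tileBR (t : D.Tile) : D.tileBR t.bottom t.right = t :=
  D.bij_bottom_right.1 (D.bij_bottom_right.2 (t.bottom, t.right)).choose_spec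

/-- The reflection of a tile in a horizontal axis. -/
def flipV (t : D.Tile) : D.Tile :=
  ⟨(D.invV t.left, t.bottom, t.top, D.invV t.right), D.symm₁ _ _ _ _ t.2⟩

/-- The reflection of a tile in a vertical axis. -/
def flipH (t : D.Tile) : D.Tile :=
  ⟨(t.right, D.invH t.top, D.invH t.bottom, t.left), D.symm₃ _ _ _ _ t.2⟩

/-- The action of the horizontal letters on vertical words by sliding along tiles. -/
noncomputable def colTransducer : Transducer H V where
  j := D.invH
  i := D.invV
  out b a := (D.tileBR b a).left
  next b a := (D.tileBR b a).top
  j_j := D.invH_invH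
  i_i := D.invV_invV
  -- The tile reflected in a vertical axis has bottom b⁻¹ and, as right edge, the old left edge; it
  -- is therefore the tile read by the inverse state.
  out_inv b a := by
    have := D.eq_tileBR (D.flipH (D.tileBR b a))
    have h1 : (D.flipH (D.tileBR b a)).bottom = D.invH b := congrArg D.invH (D.tileBR_bottom b a)
    have h2 : (D.flipH (D.tileBR b a)).right = (D.tileBR b a).left := rfl
    rw [h1, h2] at this
    rw [this]
    exact D.tileBR_right b a
  next_inv b a := by
    have := D.eq_tileBR (D.flipH (D.tileBR b a))
    have h1 : (D.flipH (D.tileBR b a)).bottom = D.invH b := congrArg D.invH (D.tileBR_bottom b a)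
    have h2 : (D.flipH (D.tileBR b a)).right = (D.tileBR b a).left := rfl
    rw [h1, h2] at this
    rw [this]
    rfl
  -- The tile reflected in a horizontal axis has right edge a⁻¹ and, as bottom, the old top.
  out_next b a := by
    have := D.eq_tileBR (D.flipV (D.tileBR b a))
    have h1 : (D.flipV (D.tileBR b a)).right = D.invV a := congrArg D.invV (D.tileBR_right b a)
    have h2 : (D.flipV (D.tileBR b a)).bottom = (D.tileBR b a).top := rfl
    rw [h1, h2] at this
    rw [this]
    rfl
  next_next b a := by
    have := D.eq_tileBR (D.flipV (D.tileBR b a))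
    have h1 : (D.flipV (D.tileBR b a)).right = D.invV a := congrArg D.invV (D.tileBR_right b a)
    have h2 : (D.flipV (D.tileBR b a)).bottom = (D.tileBR b a).top := rfl
    rw [h1, h2] at this
    rw [this]
    exact D.tileBR_bottom b a

theorem genV_mul_genH {t : V × H × H × V} (ht : t ∈ D.R) :
    D.genV t.1 * D.genH t.2.1 = D.genH t.2.2.1 * D.genV t.2.2.2 := by
  have := PresentedGroup.one_of_mem (rels := D.relators)
    (Or.inr (Or.inr ⟨t.1, t.2.1, t.2.2.1, t.2.2.2, ht, rfl⟩))
  rw [map_mul, map_inv, mul_inv_eq_one] at this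
  exact this

/-- All relators act trivially on reduced vertical words when vertical letters act by left
multiplication and horizontal letters through the transducer. The resulting action of Γ_D separates
reduced words. -/
theorem exists_edge_graphB_iff {k : ℕ} (b : H) (w w' : ReducedWord D.invV k) :
    (∃ e, D.genH b * w.eval D.genV = w'.eval D.genV * D.genH e) ↔
      w' = D.colTransducer.actWord k b w := by
  refine D.colTransducer.exists_mul_eval_eq_iff (s := D.genH) (t := D.genV) (fun b a => ?_)
    (PresentedGroup.toGroup (rels := D.relators)
      (f := Sum.elim D.colTransducer.letterPerm D.colTransducer.statePerm) ?_)
    (fun a => PresentedGroup.toGroup.of _) (fun a => PresentedGroup.toGroup.of _) b w w'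
  · have := D.genV_mul_genH (D.tileBR b a).2
    have h1 : (D.tileBR b a).1.2.2.1 = b := D.tileBR_bottom b a
    have h2 : (D.tileBR b a).1.2.2.2 = a := D.tileBR_right b a
    rw [h1, h2] at this
    exact this.symm
  · rintro g (⟨a, rfl⟩ | ⟨b, rfl⟩ | ⟨a, b, c, e, h, rfl⟩)
    · simp only [map_mul, FreeGroup.lift_apply_of, Sum.elim_inl]
      exact D.colTransducer.letterPerm_mul_i a
    · simp only [map_mul, FreeGroup.lift_apply_of, Sum.elim_inr]
      exact D.colTransducer.statePerm_mul_j b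
    · rw [map_mul, map_inv, mul_inv_eq_one]
      have := D.colTransducer.statePerm_mul_letterPerm c e
      have h1 : D.tileBR c e = (⟨(a, b, c, e), h⟩ : D.Tile) := D.eq_tileBR ⟨(a, b, c, e), h⟩
      have h2 : D.colTransducer.out c e = a := congrArg Tile.left h1
      have h3 : D.colTransducer.next c e = b := congrArg Tile.top h1
      rw [h2, h3] at this
      simp only [map_mul, FreeGroup.lift_apply_of, Sum.elim_inl, Sum.elim_inr]
      exact this.symm

/-- The same argument for the transposed transducer. The relation of a square is now read from the
other side, so the action is again one of the original group and no isomorphism of groups is needed.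
-/
theorem exists_edge_graphA_iff {k : ℕ} (a : V) (w w' : ReducedWord D.invH k) :
    (∃ e, D.genV a * w.eval D.genH = w'.eval D.genH * D.genV e) ↔
      w' = D.transpose.colTransducer.actWord k a w := by
  refine D.transpose.colTransducer.exists_mul_eval_eq_iff (s := D.genV) (t := D.genH)
    (fun a b => ?_)
    (PresentedGroup.toGroup (rels := D.relators) (f := Sum.elim D.transpose.colTransducer.statePerm
      D.transpose.colTransducer.letterPerm) ?_)
    (fun a => PresentedGroup.toGroup.of _) (fun a => PresentedGroup.toGroup.of _) a w w'
  · have := D.genV_mul_genH (t := ((D.transpose.tileBR a b).1.2.2.1, (D.transpose.tileBR a b).1.2.2.2,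
      (D.transpose.tileBR a b).1.1, (D.transpose.tileBR a b).1.2.1)) (D.transpose.tileBR a b).2
    have h1 : (D.transpose.tileBR a b).1.2.2.1 = a := D.transpose.tileBR_bottom a b
    have h2 : (D.transpose.tileBR a b).1.2.2.2 = b := D.transpose.tileBR_right a b
    simp only [h1, h2] at this
    exact this
  · rintro g (⟨a, rfl⟩ | ⟨b, rfl⟩ | ⟨a, b, c, e, h, rfl⟩)
    · simp only [map_mul, FreeGroup.lift_apply_of, Sum.elim_inl]
      exact D.transpose.colTransducer.statePerm_mul_j a
    · simp only [map_mul, FreeGroup.lift_apply_of, Sum.elim_inr]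
      exact D.transpose.colTransducer.letterPerm_mul_i b
    · rw [map_mul, map_inv, mul_inv_eq_one]
      have := D.transpose.colTransducer.statePerm_mul_letterPerm a b
      have h1 : D.transpose.tileBR a b = (⟨(c, e, a, b), h⟩ : D.transpose.Tile) :=
        D.transpose.eq_tileBR ⟨(c, e, a, b), h⟩
      have h2 : D.transpose.colTransducer.out a b = c := congrArg Tile.left h1
      have h3 : D.transpose.colTransducer.next a b = e := congrArg Tile.top h1
      rw [h2, h3] at this
      simp only [map_mul, FreeGroup.lift_apply_of, Sum.elim_inl, Sum.elim_inr]
      exact this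

end VHDatum

/-! ### Ramanujan graphs and permutations -/

namespace LoopMultigraph

variable {Ω E S : Type*} [Fintype S]

theorem card_org_eq (G : LoopMultigraph Ω E) (ε : E ≃ S × Ω)
    (horg : ∀ e, G.org e = (ε e).2) (v : Ω) :
    Nat.card {e // G.org e = v} = Fintype.card S := by
  rw [← Nat.card_eq_fintype_card]
  refine Nat.card_congr ⟨fun e => (ε e.1).1, fun s => ⟨ε.symm (s, v), by simp [horg]⟩, ?_, ?_⟩
  · rintro ⟨e, rfl⟩
    simp [horg]
  · intro s
    simp

theorem adjMatrix_mulVec [Fintype Ω] (G : LoopMultigraph Ω E) (U : S → Equiv.Perm Ω)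
    (ε : E ≃ S × Ω) (horg : ∀ e, G.org e = (ε e).2) (htgt : ∀ e, G.tgt e = U (ε e).1 (ε e).2)
    (F : Ω → ℝ) (u : Ω) : G.adjMatrix.mulVec F u = ∑ s, F (U s u) := by
  classical
  have h : ∀ v, (G.adjMatrix u v : ℝ) = ∑ s, if U s u = v then 1 else 0 := by
    intro v
    rw [Finset.sum_boole, ← Fintype.card_subtype, ← Nat.card_eq_fintype_card]
    simp only [adjMatrix, Matrix.of_apply, Nat.cast_inj]
    refine Nat.card_congr ⟨fun e => ⟨(ε e.1).1, ?_⟩, fun s => ⟨ε.symm (s.1, u), ?_⟩, ?_, ?_⟩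
    · have h1 := e.2.1
      have h2 := e.2.2
      rw [horg] at h1
      rw [htgt, h1] at h2
      exact h2
    · simp [horg, htgt, s.2]
    · rintro ⟨e, he, he'⟩
      simp [← he, horg]
    · rintro ⟨s, hs⟩
      simp
  simp only [Matrix.mulVec, dotProduct, h, Finset.sum_mul, ite_mul, one_mul, zero_mul]
  rw [Finset.sum_comm]
  simp

/-- All the eigenvalues on functions of mean zero are bounded by `2 √(2 d - 1)` and different
from `± 2 d`. -/
def HasSpectralGap [Fintype Ω] (U : S → Equiv.Perm Ω) (d : ℕ) : Prop :=
  ∀ (v : Ω → ℝ) (ev : ℝ), v ≠ 0 → ∑ w, v w = 0 → (∀ w, ∑ s, v (U s w) = ev * v w) →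
    |ev| ≤ 2 * √(2 * d - 1) ∧ |ev| ≠ 2 * d

theorem sum_sum_perm [Fintype Ω] {R : Type*} [CommSemiring R] (U : S → Equiv.Perm Ω) (v : Ω → R) :
    ∑ w, ∑ s, v (U s w) = Fintype.card S * ∑ w, v w := by
  rw [Finset.sum_comm]
  simp [fun s => Equiv.sum_comp (U s) v]

/-- Maximum principle: where v is maximal, its average over the neighbours is the maximum, so all
neighbours attain it; connectedness spreads this. -/
theorem eq_const_of_isConnected [Fintype Ω] (G : LoopMultigraph Ω E) (U : S → Equiv.Perm Ω)
    (ε : E ≃ S × Ω) (horg : ∀ e, G.org e = (ε e).2) (htgt : ∀ e, G.tgt e = U (ε e).1 (ε e).2)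
    (hG : G.IsConnected) (v : Ω → ℝ) (hv : ∀ w, ∑ s, v (U s w) = Fintype.card S * v w) :
    ∃ c, ∀ w, v w = c := by
  obtain ⟨hne, hconn⟩ := hG
  obtain ⟨w₀, hw₀⟩ := Finite.exists_max v
  refine ⟨v w₀, fun w => ?_⟩
  induction hconn w₀ w with
  | refl => rfl
  | tail _ hxy ih =>
    rename_i x y _
    obtain ⟨e, rfl, rfl⟩ := hxy
    have h0 : ∑ s, (v w₀ - v (U s (G.org e))) = 0 := by
      rw [Finset.sum_sub_distrib, hv, ih]
      simp
    rw [Finset.sum_eq_zero_iff_of_nonneg fun s _ => sub_nonneg.2 (hw₀ _)] at h0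
    have := h0 (ε e).1 (Finset.mem_univ _)
    rw [horg, ← htgt] at this
    linarith

/-- Where |v| is maximal, each product of v with a neighbouring value is at least minus the square
of the maximum, and the eigenvalue equation forces equality for every neighbour. So |v| is constant,
v changes sign along each edge, and the sign is a 2-colouring. -/
theorem isBipartite_of_isConnected [Fintype Ω] (G : LoopMultigraph Ω E) (U : S → Equiv.Perm Ω)
    (ε : E ≃ S × Ω) (horg : ∀ e, G.org e = (ε e).2) (htgt : ∀ e, G.tgt e = U (ε e).1 (ε e).2)
    (hG : G.IsConnected) (v : Ω → ℝ) (hv0 : v ≠ 0)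
    (hv : ∀ w, ∑ s, v (U s w) = -Fintype.card S * v w) : G.IsBipartite := by
  obtain ⟨hne, hconn⟩ := hG
  obtain ⟨w₀, hw₀⟩ := Finite.exists_max fun w => |v w|
  have step : ∀ e, |v (G.org e)| = |v w₀| → v (G.org e) * v (G.tgt e) = -|v w₀| ^ 2 := by
    intro e he
    have hnn : ∀ s, 0 ≤ v (G.org e) * v (U s (G.org e)) + |v w₀| ^ 2 := by
      intro s
      have h1 := neg_abs_le (v (G.org e) * v (U s (G.org e)))
      rw [abs_mul, he] at h1
      nlinarith [mul_le_mul_of_nonneg_left (hw₀ (U s (G.org e))) (abs_nonneg (v w₀))]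
    have h0 : ∑ s, (v (G.org e) * v (U s (G.org e)) + |v w₀| ^ 2) = 0 := by
      rw [Finset.sum_add_distrib, ← Finset.mul_sum, hv, ← he, sq_abs]
      simp
      ring
    rw [Finset.sum_eq_zero_iff_of_nonneg fun s _ => hnn s] at h0
    have := h0 (ε e).1 (Finset.mem_univ _)
    rw [horg, ← htgt, ← horg] at this
    linarith
  have hpos : 0 < |v w₀| := by
    obtain ⟨w, hw⟩ := Function.ne_iff.1 hv0
    exact (abs_pos.2 hw).trans_le (hw₀ w)
  have habs : ∀ w, |v w| = |v w₀| := by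
    intro w
    induction hconn w₀ w with
    | refl => rfl
    | tail _ hxy ih =>
      obtain ⟨e, rfl, rfl⟩ := hxy
      have h1 := congrArg abs (step e ih)
      rw [abs_mul, ih, abs_neg, abs_pow, abs_abs, sq] at h1
      exact mul_left_cancel₀ hpos.ne' h1
  refine ⟨fun w => decide (0 < v w), fun e he => ?_⟩
  have h1 := step e (habs _)
  have h2 : v (G.org e) * v (G.tgt e) < 0 := by rw [h1]; nlinarith
  rw [decide_eq_decide] at he
  rcases mul_neg_iff.1 h2 with ⟨h, h'⟩ | ⟨h, h'⟩
  · exact absurd (he.1 h) h'.not_gt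
  · exact absurd (he.2 h') h.not_gt

/-- The two trivial eigenvalues have combinatorial meaning: on functions of mean zero, 2d would
contradict connectedness and -2d would give a 2-colouring. Conversely, a proper component and a
2-colouring both supply forbidden eigenvectors. -/
theorem isRamanujan_and_not_isBipartite_iff [Fintype Ω] [Nonempty Ω] [Finite E] {d : ℕ}
    (hd : 1 ≤ d) (G : LoopMultigraph Ω E) (U : S → Equiv.Perm Ω) (j : S → S)
    (hU : ∀ s, U (j s) = (U s)⁻¹) (ε : E ≃ S × Ω) (horg : ∀ e, G.org e = (ε e).2)
    (htgt : ∀ e, G.tgt e = U (ε e).1 (ε e).2) (hS : Fintype.card S = 2 * d) :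
    (G.IsRamanujan (2 * d) ∧ ¬ G.IsBipartite) ↔ HasSpectralGap U d := by
  have hd' : (1 : ℝ) ≤ d := by exact_mod_cast hd
  have hS' : (Fintype.card S : ℝ) = 2 * d := by rw [hS]; push_cast; ring
  have hadj := G.adjMatrix_mulVec U ε horg htgt
  constructor
  · rintro ⟨⟨hc, -, hR⟩, hB⟩ v ev hv0 hv hev
    have h1 : ev ≠ 2 * d := by
      rintro rfl
      obtain ⟨c, hc⟩ := G.eq_const_of_isConnected U ε horg htgt hc v (by rwa [hS'])
      refine hv0 (funext fun w => ?_)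
      simp only [hc, Finset.sum_const, nsmul_eq_mul, mul_eq_zero] at hv
      rcases hv with hv | hv
      · simp at hv
      · rw [hc, hv]; rfl
    have h2 : ev ≠ -(2 * d) := by
      rintro rfl
      exact hB (G.isBipartite_of_isConnected U ε horg htgt hc v hv0 (by rwa [hS']))
    refine ⟨?_, fun h => ?_⟩
    · have := hR ev (Module.End.hasEigenvalue_of_hasEigenvector (x := v)
        ⟨Module.End.mem_eigenspace_iff.2 (funext fun w => ?_), hv0⟩)
      · push_cast at this
        tauto
      · rw [Matrix.mulVecLin_apply, hadj, hev]
        rfl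
    · rcases abs_eq (by positivity) |>.1 h with h | h
      · exact h1 h
      · exact h2 h
  · intro h
    have hconn : G.IsConnected := by
      refine ⟨inferInstance, fun u u' => ?_⟩
      classical
      by_contra hu'
      set P : Ω → Prop := Relation.ReflTransGen (fun x y => ∃ e, G.org e = x ∧ G.tgt e = y) u
      have hstep : ∀ s x, P x → P (U s x) := fun s x hx =>
        hx.tail ⟨ε.symm (s, x), by simp [horg], by simp [htgt]⟩
      have hiff : ∀ s x, P (U s x) ↔ P x := fun s x =>
        ⟨fun hx => by simpa [hU] using hstep (j s) _ hx, hstep s x⟩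
      set f : Ω → ℝ := fun x => if P x then 1 else 0
      have hf : ∀ s x, f (U s x) = f x := fun s x => by simp [f, hiff]
      -- The centred indicator of the set reachable from u is invariant under all the permutations,
      -- hence has eigenvalue 2d; it is nonzero because it takes different values at u and u'.
      refine (h (fun x => f x - (∑ y, f y) / Fintype.card Ω) (2 * d) ?_ ?_ ?_).2
        (abs_of_nonneg (by positivity))
      · intro h0
        have h1 := congrFun h0 u
        have h2 := congrFun h0 u'
        have h3 : f u = 1 := if_pos Relation.ReflTransGen.refl
        have h4 : f u' = 0 := if_neg hu'
        simp only [h3, h4, Pi.zero_apply] at h1 h2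
        linarith
      · rw [Finset.sum_sub_distrib]
        simp
        field_simp
        simp
      · intro w
        simp [hf, hS']
        ring
    refine ⟨⟨hconn, fun v => (G.card_org_eq ε horg v).trans hS, fun ev hev => ?_⟩, ?_⟩
    · obtain ⟨v, hv⟩ := hev.exists_hasEigenvector
      have hv' : ∀ w, ∑ s, v (U s w) = ev * v w := fun w => by
        rw [← hadj]
        exact congrFun (Module.End.mem_eigenspace_iff.1 hv.1) w
      by_cases h1 : ev = 2 * d
      · left; rw [h1]; push_cast; ring
      -- Summing the eigenvalue equation over all vertices gives ev ∑ v = 2d ∑ v.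
      · have hsum : ∑ w, v w = 0 := by
          have h2 := sum_sum_perm U v
          simp only [hv', ← Finset.mul_sum, hS'] at h2
          have h3 : (ev - 2 * d) * ∑ w, v w = 0 := by linarith
          exact (mul_eq_zero.1 h3).resolve_left (sub_ne_zero.2 h1)
        right; right
        have := (h v ev hv.2 hsum hv').1
        push_cast
        exact this
    · rintro ⟨c, hc⟩
      set f : Ω → ℝ := fun x => if c x then 1 else -1
      have hf : ∀ s x, f (U s x) = -f x := by
        intro s x
        have := hc (ε.symm (s, x))
        simp only [horg, htgt, Equiv.apply_symm_apply] at this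
        simp only [f]
        cases h1 : c x <;> cases h2 : c (U s x) <;> simp_all
      have hf' : ∀ w, ∑ s, f (U s w) = -(2 * d) * f w := fun w => by simp [hf, hS']
      refine (h f (-(2 * d)) ?_ ?_ hf').2 ?_
      · obtain ⟨w⟩ := ‹Nonempty Ω›
        refine Function.ne_iff.2 ⟨w, ?_⟩
        simp only [f]
        split_ifs <;> norm_num
      · have h2 := sum_sum_perm U f
        simp only [hf', ← Finset.mul_sum, hS'] at h2
        have h3 : (4 * d : ℝ) * ∑ w, f w = 0 := by linarith
        exact (mul_eq_zero.1 h3).resolve_left (by positivity)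
      · rw [abs_neg, abs_of_nonneg (by positivity)]

end LoopMultigraph

/-! ### Spectral gaps of the graphs of a datum. -/

/-- A Schreier graph whose edges `w --a--> w'` are given by permutations. -/
def schreierEdgeEquiv {S T Γ : Type*} [Group Γ] {s : S → Γ} {t : T → Γ} {i : T → T} {k : ℕ}
    (U : S → Equiv.Perm (ReducedWord i k))
    (h : ∀ a w w', (∃ e, s a * w.eval t = w'.eval t * s e) ↔ w' = U a w) :
    SchreierEdge s t i k ≃ S × ReducedWord i k where
  toFun e := (e.1.1, e.1.2.1)
  invFun p := ⟨(p.1, p.2, U p.1 p.2), (h _ _ _).2 rfl⟩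
  left_inv e := Subtype.ext (Prod.ext rfl (Prod.ext rfl ((h _ _ _).1 e.2).symm))
  right_inv _ := rfl

theorem ReducedWord.nonempty_of_fixedPointFree {T : Type*} [Nonempty T] {i : T → T}
    (hi : ∀ t, i t ≠ t) (k : ℕ) : Nonempty (ReducedWord i k) := by
  obtain ⟨t⟩ := ‹Nonempty T›
  exact ⟨⟨List.replicate k t, by simp, List.isChain_replicate_of_rel _ (hi t).symm⟩⟩

namespace VHDatum

variable {V H : Type*} [Fintype V] [Fintype H] {d : ℕ} (D : VHDatum V H d d)

/-- The spectral gap of the action of the horizontal letters on the vertical words of length `k`. -/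
def SpectralGap (k : ℕ) : Prop := LoopMultigraph.HasSpectralGap (D.colTransducer.actWord k) d

theorem nonempty_V {V H : Type*} {m n : ℕ} (hd : 1 ≤ m) (D : VHDatum V H m n) : Nonempty V :=
  (Nat.card_pos_iff.1 (D.card_V ▸ by omega)).1

theorem graphB_isRamanujan_iff (hd : 1 ≤ d) (k : ℕ) :
    ((D.graphB k).IsRamanujan (2 * d) ∧ ¬ (D.graphB k).IsBipartite) ↔ D.SpectralGap k := by
  have := D.nonempty_V hd
  have : Nonempty (ReducedWord D.invV k) := ReducedWord.nonempty_of_fixedPointFree D.invV_ne k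
  refine LoopMultigraph.isRamanujan_and_not_isBipartite_iff hd (D.graphB k)
    (D.colTransducer.actWord k) D.invH (D.colTransducer.actWord_j k)
    (schreierEdgeEquiv _ D.exists_edge_graphB_iff) (fun _ => rfl)
    (fun e => (D.exists_edge_graphB_iff _ _ _).1 e.2) ?_
  rw [← Nat.card_eq_fintype_card, D.card_H]

theorem graphA_isRamanujan_iff (hd : 1 ≤ d) (k : ℕ) :
    ((D.graphA k).IsRamanujan (2 * d) ∧ ¬ (D.graphA k).IsBipartite) ↔
      D.transpose.SpectralGap k := by
  have := D.transpose.nonempty_V hd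
  have : Nonempty (ReducedWord D.invH k) := ReducedWord.nonempty_of_fixedPointFree D.invH_ne k
  refine LoopMultigraph.isRamanujan_and_not_isBipartite_iff hd (D.graphA k)
    (D.transpose.colTransducer.actWord k) D.invV (D.transpose.colTransducer.actWord_j k)
    (schreierEdgeEquiv _ D.exists_edge_graphA_iff) (fun _ => rfl)
    (fun e => (D.exists_edge_graphA_iff _ _ _).1 e.2) ?_
  rw [← Nat.card_eq_fintype_card, D.card_V]

end VHDatum

/-! ### Non-backtracking operators -/

/-- The characteristic roots z and z' are complex conjugate of modulus √q. Splitting off z leaves a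
geometric sequence of ratio z'; adding it up costs the factor n + 1, which also covers the double
root. -/
theorem abs_le_of_linear_recurrence {p : ℕ → ℝ} {ev q D : ℝ} (hq : 1 ≤ q) (hev : |ev| ≤ 2 * √q)
    (hp : ∀ n, p (n + 2) = ev * p (n + 1) - q * p n) (h0 : |p 0| ≤ D)
    (h1 : |p 1| + √q * |p 0| ≤ D) (n : ℕ) : |p n| ≤ D * (n + 1) * √q ^ n := by
  have hq0 : 0 ≤ q := by linarith
  have hs : 1 ≤ √q := Real.one_le_sqrt.2 hq
  have hD : 0 ≤ D := (abs_nonneg _).trans h0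
  have hev2 : ev ^ 2 ≤ 4 * q := by
    have := sq_le_sq' (by linarith [neg_abs_le ev, abs_nonneg ev, Real.sqrt_nonneg q])
      ((le_abs_self ev).trans hev)
    rw [mul_pow, Real.sq_sqrt hq0] at this
    linarith
  set y : ℝ := √(4 * q - ev ^ 2) / 2 with hy
  have hy2 : y ^ 2 = q - ev ^ 2 / 4 := by
    rw [hy, div_pow, Real.sq_sqrt (by linarith)]
    ring
  set z : ℂ := ⟨ev / 2, y⟩ with hz
  have hzn : ‖z‖ = √q := by
    rw [Complex.norm_def, Complex.normSq_apply]
    congr 1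
    simp only [hz]
    nlinarith
  set z' : ℂ := ⟨ev / 2, -y⟩ with hz'
  have hzn' : ‖z'‖ = √q := by
    rw [Complex.norm_def, Complex.normSq_apply]
    congr 1
    simp only [hz']
    nlinarith
  have hsum : z + z' = ev := by
    apply Complex.ext <;> simp [hz, hz']
  have hprod : z * z' = q := by
    apply Complex.ext <;> simp [hz, hz']
    · nlinarith
    · ring
  -- The first order difference p (n + 1) - z p n is multiplied by z' at each step.
  have hdiff : ∀ n, ‖(p (n + 1) : ℂ) - z * p n‖ ≤ D * √q ^ n := by
    intro n
    induction n with
    | zero =>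
      refine (norm_sub_le _ _).trans ?_
      simpa [hzn] using h1
    | succ n ih =>
      have : (p (n + 1 + 1) : ℂ) - z * p (n + 1) = z' * (p (n + 1) - z * p n) := by
        rw [hp]
        push_cast
        rw [← hsum, ← hprod]
        ring
      rw [this, norm_mul, hzn', pow_succ]
      nlinarith
  induction n with
  | zero => simpa using h0
  | succ n ih =>
    have h2 : ‖(p (n + 1) : ℂ)‖ ≤ ‖(p (n + 1) : ℂ) - z * p n‖ + ‖z * p n‖ := by
      simpa using norm_add_le ((p (n + 1) : ℂ) - z * p n) (z * p n)
    rw [norm_mul, hzn, Complex.norm_real, Complex.norm_real, Real.norm_eq_abs,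
      Real.norm_eq_abs] at h2
    have h3 : D * √q ^ n ≤ D * √q ^ (n + 1) :=
      mul_le_mul_of_nonneg_left (pow_le_pow_right₀ hs (by simp)) hD
    push_cast
    calc |p (n + 1)| ≤ D * √q ^ (n + 1) + √q * (D * (n + 1) * √q ^ n) := by
          refine h2.trans (add_le_add ((hdiff n).trans h3) ?_)
          gcongr
      _ = D * (n + 1 + 1) * √q ^ (n + 1) := by ring

section NonBacktracking

variable {S R E : Type*} [Fintype S] [CommRing R] [AddCommGroup E] [Module R E]

/-- The sum `∑ U_h F_h`. -/
def letterSum (U : S → E →ₗ[R] E) : (S → E) →ₗ[R] E :=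
  ∑ h, U h ∘ₗ LinearMap.proj h

theorem letterSum_apply (U : S → E →ₗ[R] E) (F : S → E) : letterSum U F = ∑ h, U h (F h) := by
  simp [letterSum]

/-- The operator `(J F)(h) = U_{i h} F_{i h}`. -/
def backtrack {S : Type*} (i : S → S) (U : S → E →ₗ[R] E) : (S → E) →ₗ[R] (S → E) :=
  LinearMap.pi fun h => U (i h) ∘ₗ LinearMap.proj (i h)

theorem backtrack_apply {S : Type*} (i : S → S) (U : S → E →ₗ[R] E) (F : S → E) (h : S) :
    backtrack i U F h = U (i h) (F (i h)) := rfl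

/-- The non-backtracking operator `(T F)(h) = ∑ U_k F_k`, the sum being over `k ≠ i h`. -/
def nonBacktracking (i : S → S) (U : S → E →ₗ[R] E) : (S → E) →ₗ[R] (S → E) :=
  LinearMap.pi (fun _ => letterSum U) - backtrack i U

theorem nonBacktracking_apply (i : S → S) (U : S → E →ₗ[R] E) (F : S → E) (h : S) :
    nonBacktracking i U F h = letterSum U F - backtrack i U F h := rfl

theorem nonBacktracking_apply_eq_sum [DecidableEq S] (i : S → S) (U : S → E →ₗ[R] E) (F : S → E)
    (h : S) : nonBacktracking i U F h = ∑ k with k ≠ i h, U k (F k) := by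
  rw [nonBacktracking_apply, letterSum_apply, backtrack_apply, Finset.filter_ne',
    Finset.sum_erase_eq_sub (Finset.mem_univ _)]

/-- The sum of `U_u v` over the reduced words `u` of length `n + 1`. -/
def wordSum (i : S → S) (U : S → E →ₗ[R] E) (n : ℕ) : E →ₗ[R] E :=
  letterSum U ∘ₗ (nonBacktracking i U ^ n : (S → E) →ₗ[R] (S → E)) ∘ₗ LinearMap.pi fun _ => LinearMap.id

theorem wordSum_apply (i : S → S) (U : S → E →ₗ[R] E) (n : ℕ) (v : E) :
    wordSum i U n v = letterSum U ((nonBacktracking i U ^ n) fun _ => v) := rfl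

theorem wordSum_zero (i : S → S) (U : S → E →ₗ[R] E) (v : E) :
    wordSum i U 0 v = ∑ h, U h v := by
  simp [wordSum_apply, letterSum_apply]

variable {i : S → S} {U : S → E →ₗ[R] E}

theorem letterSum_backtrack (hi : ∀ s, i (i s) = s)
    (hU : ∀ s v, U s (U (i s) v) = v) (F : S → E) :
    letterSum U (backtrack i U F) = ∑ h, F h := by
  simp only [letterSum_apply, backtrack_apply, hU]
  exact Equiv.sum_comp (Function.Involutive.toPerm i hi) F

/-- Among all pairs of letters, the backtracking ones contribute v once for each letter. -/
theorem wordSum_one (hi : ∀ s, i (i s) = s)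
    (hU : ∀ s v, U s (U (i s) v) = v) (v : E) :
    wordSum i U 1 v = ∑ h, U h (wordSum i U 0 v) - (Fintype.card S : R) • v := by
  rw [wordSum_apply, pow_one]
  have : nonBacktracking i U (fun _ => v) =
      (fun _ => letterSum U fun _ => v) - backtrack i U fun _ => v := rfl
  rw [this, map_sub, letterSum_backtrack hi hU, letterSum_apply, wordSum_apply]
  simp [Nat.cast_smul_eq_nsmul]

theorem sum_nonBacktracking (hi : ∀ s, i (i s) = s) (F : S → E) :
    ∑ h, nonBacktracking i U F h = ((Fintype.card S : R) - 1) • letterSum U F := by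
  simp only [nonBacktracking_apply, Finset.sum_sub_distrib, backtrack_apply]
  have : ∑ h, U (i h) (F (i h)) = ∑ h, U h (F h) :=
    Equiv.sum_comp (Function.Involutive.toPerm i hi) fun h => U h (F h)
  rw [this, ← letterSum_apply]
  simp [sub_smul, Nat.cast_smul_eq_nsmul]

/-- Prepending a letter to a reduced word either keeps it reduced or cancels its first letter. Each
word two letters shorter than the target arises by cancellation in |S| - 1 ways, one fewer than in
`wordSum_one` because it is nonempty. -/
theorem wordSum_add_two (hi : ∀ s, i (i s) = s)
    (hU : ∀ s v, U s (U (i s) v) = v) (n : ℕ) (v : E) :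
    wordSum i U (n + 2) v =
      ∑ h, U h (wordSum i U (n + 1) v) - ((Fintype.card S : R) - 1) • wordSum i U n v := by
  rw [wordSum_apply, pow_succ', Module.End.mul_apply]
  set F := (nonBacktracking i U ^ (n + 1)) fun _ => v with hF
  have : nonBacktracking i U F = (fun _ => letterSum U F) - backtrack i U F := rfl
  rw [this, map_sub, letterSum_backtrack hi hU, letterSum_apply, wordSum_apply, ← hF, hF,
    pow_succ', Module.End.mul_apply, sum_nonBacktracking hi, ← wordSum_apply]

end NonBacktracking

/-- The eigenvalues of the sums over the words of length `n + 1`. -/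
def wordSeq (ev q : ℝ) (n : ℕ) : ℝ :=
  (Nat.rec (ev, ev ^ 2 - (q + 1)) (fun _ x => (x.2, ev * x.2 - q * x.1)) n : ℝ × ℝ).1

theorem wordSeq_add_two (ev q : ℝ) (n : ℕ) :
    wordSeq ev q (n + 2) = ev * wordSeq ev q (n + 1) - q * wordSeq ev q n := rfl

theorem wordSum_eq_wordSeq_smul {S E : Type*} [Fintype S] [AddCommGroup E] [Module ℂ E] {i : S → S}
    {U : S → E →ₗ[ℂ] E} (hi : ∀ s, i (i s) = s) (hU : ∀ s v, U s (U (i s) v) = v) {q : ℝ}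
    (hS : (Fintype.card S : ℝ) = q + 1) {ev : ℝ} {v : E} (hv : ∑ h, U h v = (ev : ℂ) • v) (n : ℕ) :
    wordSum i U n v = (wordSeq ev q n : ℂ) • v := by
  have hS' : (Fintype.card S : ℂ) = q + 1 := by exact_mod_cast congrArg ((↑) : ℝ → ℂ) hS
  have h0 : wordSum i U 0 v = (wordSeq ev q 0 : ℂ) • v := by rw [wordSum_zero, hv]; rfl
  suffices wordSum i U n v = (wordSeq ev q n : ℂ) • v ∧
      wordSum i U (n + 1) v = (wordSeq ev q (n + 1) : ℂ) • v from this.1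
  induction n with
  | zero =>
    refine ⟨h0, ?_⟩
    rw [wordSum_one hi hU, h0]
    simp only [map_smul]
    rw [← Finset.smul_sum, hv, hS', smul_smul, ← sub_smul]
    congr 1
    change (ev : ℂ) * ev - (q + 1) = ((ev ^ 2 - (q + 1) : ℝ) : ℂ)
    push_cast
    ring
  | succ n ih =>
    refine ⟨ih.2, ?_⟩
    rw [wordSum_add_two hi hU, ih.1, ih.2]
    simp only [map_smul]
    rw [← Finset.smul_sum, hv, hS', smul_smul, smul_smul, ← sub_smul, wordSeq_add_two]
    congr 1
    push_cast
    ring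

/-! ### Norm bounds for non-backtracking powers. -/

section NormBound

variable {S E : Type*} [Fintype S] [NormedAddCommGroup E] [InnerProductSpace ℂ E]
  {i : S → S} {U : S → E →ₗ[ℂ] E}

theorem norm_letterSum_le (hnorm : ∀ s v, ‖U s v‖ = ‖v‖) (F : S → E) :
    ‖letterSum U F‖ ≤ Fintype.card S * ‖F‖ := by
  rw [letterSum_apply]
  refine (norm_sum_le _ _).trans ?_
  simp only [hnorm]
  refine (Finset.sum_le_card_nsmul _ _ ‖F‖ fun h _ => norm_le_pi_norm F h).trans ?_
  simp

theorem norm_backtrack_le (hnorm : ∀ s v, ‖U s v‖ = ‖v‖) (F : S → E) :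
    ‖backtrack i U F‖ ≤ ‖F‖ := by
  refine (pi_norm_le_iff_of_nonneg (norm_nonneg _)).2 fun h => ?_
  rw [backtrack_apply, hnorm]
  exact norm_le_pi_norm F _

/-- The operator T need not be normal, so its eigenvalues alone do not bound its powers. Instead the
rightmost factor is written as T F = const(∑ U F) - J F: the first part is a word sum, and J does
not increase the norm. Induction costs one more power of n + 1. -/
theorem norm_letterSum_pow_le (hnorm : ∀ s v, ‖U s v‖ = ‖v‖) {q D : ℝ} (hq : 1 ≤ q) (hD : 1 ≤ D)
    (hw : ∀ n v, ‖wordSum i U n v‖ ≤ D * (n + 1) * √q ^ n * ‖v‖) (n : ℕ) (F : S → E) :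
    ‖letterSum U ((nonBacktracking i U ^ n) F)‖ ≤
      Fintype.card S * D * (n + 1) ^ 2 * √q ^ n * ‖F‖ := by
  have hs : 1 ≤ √q := Real.one_le_sqrt.2 hq
  induction n generalizing F with
  | zero =>
    refine (norm_letterSum_le hnorm F).trans ?_
    simp only [Nat.cast_zero, zero_add, one_pow, pow_zero, mul_one]
    gcongr
    exact le_mul_of_one_le_right (by positivity) hD
  | succ n ih =>
    have h1 : (nonBacktracking i U ^ (n + 1)) F =
        (nonBacktracking i U ^ n) (fun _ => letterSum U F) -
          (nonBacktracking i U ^ n) (backtrack i U F) := by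
      rw [pow_succ, Module.End.mul_apply, ← map_sub]
      rfl
    rw [h1, map_sub, ← wordSum_apply]
    have h2 : √q ^ n ≤ √q ^ (n + 1) := pow_le_pow_right₀ hs (by simp)
    calc _ ≤ _ := norm_sub_le _ _
      _ ≤ D * (n + 1) * √q ^ n * (Fintype.card S * ‖F‖) +
          Fintype.card S * D * (n + 1) ^ 2 * √q ^ n * ‖F‖ := by
        refine add_le_add ((hw _ _).trans ?_) ((ih _).trans ?_)
        · gcongr
          exact norm_letterSum_le hnorm F
        · gcongr
          exact norm_backtrack_le hnorm F
      _ = Fintype.card S * D * ((n + 1) + (n + 1) ^ 2) * √q ^ n * ‖F‖ := by ring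
      _ ≤ _ := by
        push_cast
        gcongr
        nlinarith

/-- The same splitting, now of the leftmost factor, turns the bound on the letter sums into a bound
on T^n itself and accounts for the third power of n + 1. -/
theorem norm_nonBacktracking_pow_le_of_wordSum (hnorm : ∀ s v, ‖U s v‖ = ‖v‖) {q D : ℝ}
    (hq : 1 ≤ q) (hD : 1 ≤ D) (hS : 1 ≤ Fintype.card S)
    (hw : ∀ n v, ‖wordSum i U n v‖ ≤ D * (n + 1) * √q ^ n * ‖v‖) (n : ℕ) (F : S → E) :
    ‖(nonBacktracking i U ^ n) F‖ ≤ Fintype.card S * D * (n + 1) ^ 3 * √q ^ n * ‖F‖ := by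
  have hs : 1 ≤ √q := Real.one_le_sqrt.2 hq
  have hS' : (1 : ℝ) ≤ Fintype.card S := by exact_mod_cast hS
  induction n with
  | zero =>
    simp only [pow_zero, Module.End.one_apply, Nat.cast_zero, zero_add, one_pow, mul_one]
    exact le_mul_of_one_le_left (norm_nonneg _) (one_le_mul_of_one_le_of_one_le hS' hD)
  | succ n ih =>
    have h1 : (nonBacktracking i U ^ (n + 1)) F =
        (fun _ => letterSum U ((nonBacktracking i U ^ n) F)) -
          backtrack i U ((nonBacktracking i U ^ n) F) := by
      rw [pow_succ', Module.End.mul_apply]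
      rfl
    rw [h1]
    have h2 : √q ^ n ≤ √q ^ (n + 1) := pow_le_pow_right₀ hs (by simp)
    calc _ ≤ _ := norm_sub_le _ _
      _ ≤ Fintype.card S * D * (n + 1) ^ 2 * √q ^ n * ‖F‖ +
          Fintype.card S * D * (n + 1) ^ 3 * √q ^ n * ‖F‖ := by
        refine add_le_add ?_ ((norm_backtrack_le hnorm _).trans ih)
        refine (pi_norm_le_iff_of_nonneg (by positivity)).2 fun _ => ?_
        exact norm_letterSum_pow_le hnorm hq hD hw n F
      _ = Fintype.card S * D * ((n + 1) ^ 2 + (n + 1) ^ 3) * √q ^ n * ‖F‖ := by ring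
      _ ≤ _ := by
        push_cast
        gcongr
        have : (0 : ℝ) ≤ n := n.cast_nonneg
        nlinarith [sq_nonneg ((n : ℝ) + 1)]

/-- The adjoint of U_h is U at the inverse letter, so A = ∑ U_h is symmetric and has an orthonormal
eigenbasis. By the recurrence, word sums are diagonal in this basis with entries `wordSeq`. -/
theorem norm_wordSum_le [FiniteDimensional ℂ E] (hi : ∀ s, i (i s) = s)
    (hU : ∀ s v, U s (U (i s) v) = v) (hnorm : ∀ s v, ‖U s v‖ = ‖v‖) {q : ℝ} (hq : 1 ≤ q)
    (hS : (Fintype.card S : ℝ) = q + 1)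
    (hev : ∀ (ev : ℝ) (v : E), v ≠ 0 → ∑ h, U h v = (ev : ℂ) • v → |ev| ≤ 2 * √q) (n : ℕ) (v : E) :
    ‖wordSum i U n v‖ ≤ (7 * q + 1) * (n + 1) * √q ^ n * ‖v‖ := by
  have hsq : √q * √q = q := Real.mul_self_sqrt (by linarith)
  have hs : 1 ≤ √q := Real.one_le_sqrt.2 hq
  set A : E →ₗ[ℂ] E := ∑ h, U h with hA
  have hA' : ∀ v, A v = ∑ h, U h v := fun v => by simp [hA]
  have hinner : ∀ s v w, inner ℂ (U s v) (U s w) = inner ℂ v w := fun s v w =>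
    LinearIsometry.inner_map_map (⟨U s, hnorm s⟩ : E →ₗᵢ[ℂ] E) v w
  have hsymm : A.IsSymmetric := by
    intro v w
    rw [hA', hA', sum_inner, inner_sum,
      ← Equiv.sum_comp (Function.Involutive.toPerm i hi)]
    refine Finset.sum_congr rfl fun s _ => ?_
    have := hinner s (U (i s) v) w
    rw [hU] at this
    exact this.symm
  set b := hsymm.eigenvectorBasis rfl
  set ev : Fin (Module.finrank ℂ E) → ℝ := hsymm.eigenvalues rfl
  have hb : ∀ m, A (b m) = (ev m : ℂ) • b m := fun m => hsymm.apply_eigenvectorBasis rfl m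
  have hev' : ∀ m, |ev m| ≤ 2 * √q := fun m => hev _ _ (b.orthonormal.ne_zero m) (by rw [← hA', hb])
  have hpw : ∀ m, wordSum i U n (b m) = (wordSeq (ev m) q n : ℂ) • b m := fun m =>
    wordSum_eq_wordSeq_smul hi hU hS (by rw [← hA', hb]) n
  have hpb : ∀ m, |wordSeq (ev m) q n| ≤ (7 * q + 1) * (n + 1) * √q ^ n := by
    intro m
    have h0 : |wordSeq (ev m) q 0| ≤ 2 * √q := hev' m
    have h1 : |wordSeq (ev m) q 1| ≤ 5 * q + 1 := by
      change |ev m ^ 2 - (q + 1)| ≤ _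
      have h3 : ev m ^ 2 ≤ 4 * q := by
        rw [← sq_abs]
        nlinarith [hev' m, abs_nonneg (ev m)]
      rw [abs_le]
      constructor <;> nlinarith [sq_nonneg (ev m)]
    -- The constant 7q + 1 is (5q + 1) + √q · 2√q, from the bounds for the first two terms.
    refine abs_le_of_linear_recurrence hq (hev' m) (wordSeq_add_two _ _) ?_ ?_ n
    · nlinarith
    · nlinarith
  set B := (7 * q + 1) * (n + 1) * √q ^ n with hB
  have hB0 : 0 ≤ B := by positivity
  have hexp : ∀ m, b.repr (wordSum i U n v) m = wordSeq (ev m) q n * b.repr v m := by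
    intro m
    conv_lhs => rw [← b.sum_repr v]
    simp only [map_sum, map_smul, hpw]
    simp
    rw [Finset.sum_eq_single m]
    · simp
      ring
    · intro m' _ hm
      simp [hm.symm]
    · simp
  rw [← b.repr.norm_map, ← b.repr.norm_map v]
  refine le_of_sq_le_sq ?_ (by positivity)
  rw [mul_pow, EuclideanSpace.norm_sq_eq, EuclideanSpace.norm_sq_eq, Finset.mul_sum]
  refine Finset.sum_le_sum fun m _ => ?_
  rw [hexp, norm_mul, mul_pow, Complex.norm_real, Real.norm_eq_abs]
  gcongr
  exact hpb m

/-- Powers of the non-backtracking operator of a family of unitary operators whose sum has all its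
eigenvalues in `[-2 √q, 2 √q]`. -/
theorem norm_nonBacktracking_pow_le [FiniteDimensional ℂ E] (hi : ∀ s, i (i s) = s)
    (hU : ∀ s v, U s (U (i s) v) = v) (hnorm : ∀ s v, ‖U s v‖ = ‖v‖) {q : ℝ} (hq : 1 ≤ q)
    (hS : (Fintype.card S : ℝ) = q + 1)
    (hev : ∀ (ev : ℝ) (v : E), v ≠ 0 → ∑ h, U h v = (ev : ℂ) • v → |ev| ≤ 2 * √q) (n : ℕ)
    (F : S → E) :
    ‖(nonBacktracking i U ^ n) F‖ ≤ (q + 1) * (7 * q + 1) * (n + 1) ^ 3 * √q ^ n * ‖F‖ := by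
  rw [← hS]
  refine norm_nonBacktracking_pow_le_of_wordSum hnorm hq (by linarith) ?_
    (norm_wordSum_le hi hU hnorm hq hS hev) n F
  have : (1 : ℝ) ≤ Fintype.card S := by linarith
  exact_mod_cast this

end NormBound

/-! ### Configurations of tiles -/

/-- Recursion in both directions: forwards by the permutations, backwards by their inverses. -/
theorem exists_int_orbit {Y : Type*} (φ : ℤ → Equiv.Perm Y) (y : Y) :
    ∃ e : ℤ → Y, e 0 = y ∧ ∀ i, e (i + 1) = φ i (e i) := by
  let f : ℕ → Y := fun n => Nat.rec y (fun n z => φ n z) n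
  let g : ℕ → Y := fun n => Nat.rec y (fun n z => (φ (-(n + 1 : ℕ))).symm z) n
  refine ⟨fun i => if 0 ≤ i then f i.toNat else g (-i).toNat, rfl, fun i => ?_⟩
  rcases lt_trichotomy i (-1) with h | rfl | h
  · obtain ⟨n, rfl⟩ : ∃ n : ℕ, i = -(n + 1 + 1 : ℕ) := ⟨(-i - 2).toNat, by omega⟩
    have h1 : ¬ (0 : ℤ) ≤ -(n + 1 + 1 : ℕ) + 1 := by omega
    have h2 : ¬ (0 : ℤ) ≤ -(n + 1 + 1 : ℕ) := by omega
    have h3 : (-(-((n + 1 + 1 : ℕ) : ℤ) + 1)).toNat = n + 1 := by omega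
    have h4 : (- -((n + 1 + 1 : ℕ) : ℤ)).toNat = n + 1 + 1 := by omega
    simp only [if_neg h1, if_neg h2, h3, h4]
    exact ((φ _).apply_symm_apply _).symm
  · exact ((φ (-1)).apply_symm_apply y).symm
  · obtain ⟨n, rfl⟩ : ∃ n : ℕ, i = n := ⟨i.toNat, by omega⟩
    have h1 : (0 : ℤ) ≤ (n : ℤ) + 1 := by omega
    have h3 : ((n : ℤ) + 1).toNat = n + 1 := by omega
    simp only [if_pos h1, h3, Nat.cast_nonneg, if_true, Int.toNat_natCast]
    rfl

namespace VHDatum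

variable {V H : Type*} {m n : ℕ} (D : VHDatum V H m n)

variable {D} in
theorem tile_ext_left_top {t t' : D.Tile} (h₁ : t.left = t'.left) (h₂ : t.top = t'.top) :
    t = t' := D.bij_left_top.1 (Prod.ext h₁ h₂)

variable {D} in
theorem tile_ext_left_bottom {t t' : D.Tile} (h₁ : t.left = t'.left) (h₂ : t.bottom = t'.bottom) :
    t = t' := D.bij_left_bottom.1 (Prod.ext h₁ h₂)

variable {D} in
theorem tile_ext_top_right {t t' : D.Tile} (h₁ : t.top = t'.top) (h₂ : t.right = t'.right) :
    t = t' := D.bij_top_right.1 (Prod.ext h₁ h₂)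

variable {D} in
theorem tile_ext_bottom_right {t t' : D.Tile} (h₁ : t.bottom = t'.bottom)
    (h₂ : t.right = t'.right) : t = t' := D.bij_bottom_right.1 (Prod.ext h₁ h₂)

theorem exists_tile_left_bottom (a : V) (b : H) : ∃ t : D.Tile, t.left = a ∧ t.bottom = b := by
  obtain ⟨t, ht⟩ := D.bij_left_bottom.2 (a, b)
  exact ⟨t, congrArg Prod.fst ht, congrArg Prod.snd ht⟩

variable {D} in
/-- Backtracking at the bottom of two neighbouring tiles is equivalent to backtracking at the
top. -/
theorem bottom_eq_inv_iff {t t' : D.Tile} (h : t.right = t'.left) :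
    t'.bottom = D.invH t.bottom ↔ t'.top = D.invH t.top := by
  constructor
  · intro hb
    have : D.flipH t = t' := tile_ext_left_bottom h hb.symm
    rw [← this]; rfl
  · intro hb
    have : D.flipH t = t' := tile_ext_left_top h hb.symm
    rw [← this]; rfl

variable {D} in
theorem left_eq_inv_iff {t t' : D.Tile} (h : t.top = t'.bottom) :
    t'.left = D.invV t.left ↔ t'.right = D.invV t.right := by
  constructor
  · intro hb
    have : D.flipV t = t' := tile_ext_left_bottom hb.symm h
    rw [← this]; rfl
  · intro hb
    have : D.flipV t = t' := tile_ext_bottom_right h hb.symm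
    rw [← this]; rfl

/-- A bi-infinite row of tiles. -/
def IsRow (t : ℤ → D.Tile) : Prop := ∀ i, (t i).right = (t (i + 1)).left

variable {D} in
/-- The tiles of a row are determined by a left edge and the edges on one side. -/
theorem IsRow.eq_of_left_eq {t t' : ℤ → D.Tile} (ht : D.IsRow t) (ht' : D.IsRow t') {s : D.Tile → H}
    (hls : ∀ u v : D.Tile, u.left = v.left → s u = s v → u = v)
    (hsr : ∀ u v : D.Tile, s u = s v → u.right = v.right → u = v) {i₀ i₁ i₂ : ℤ}
    (h₁ : i₁ ≤ i₀) (h₂ : i₀ ≤ i₂) (h₀ : (t i₀).left = (t' i₀).left)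
    (h : ∀ i, i₁ ≤ i → i ≤ i₂ → s (t i) = s (t' i)) {i : ℤ} (hi₁ : i₁ ≤ i) (hi₂ : i ≤ i₂) :
    t i = t' i := by
  have base : t i₀ = t' i₀ := hls _ _ h₀ (h _ h₁ h₂)
  have up : ∀ i, i₀ ≤ i → i ≤ i₂ → t i = t' i := by
    intro i hi
    induction i, hi using Int.leInduction with
    | base => exact fun _ => base
    | succ i hi ih =>
      intro hi'
      have := ih (by omega)
      exact hls _ _ (by rw [← ht, ← ht', this]) (h _ (by omega) hi')
  have down : ∀ i, i ≤ i₀ → i₁ ≤ i → t i = t' i := by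
    intro i hi
    induction i, hi using Int.leInductionDown with
    | base => exact fun _ => base
    | pred i hi ih =>
      intro hi'
      have := ih (by omega)
      refine hsr _ _ (h _ hi' (by omega)) ?_
      rw [ht, ht', sub_add_cancel, this]
  rcases le_total i₀ i with h' | h'
  · exact up i h' hi₂
  · exact down i h' hi₁

variable {D} in
theorem IsRow.eq_of_bottom_eq {t t' : ℤ → D.Tile} (ht : D.IsRow t) (ht' : D.IsRow t')
    {i₀ i₁ i₂ : ℤ} (h₁ : i₁ ≤ i₀) (h₂ : i₀ ≤ i₂) (h₀ : (t i₀).left = (t' i₀).left)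
    (h : ∀ i, i₁ ≤ i → i ≤ i₂ → (t i).bottom = (t' i).bottom) {i : ℤ} (hi₁ : i₁ ≤ i)
    (hi₂ : i ≤ i₂) : t i = t' i :=
  ht.eq_of_left_eq ht' (s := Tile.bottom) (fun _ _ => tile_ext_left_bottom)
    (fun _ _ => tile_ext_bottom_right) h₁ h₂ h₀ h hi₁ hi₂

variable {D} in
theorem IsRow.eq_of_top_eq {t t' : ℤ → D.Tile} (ht : D.IsRow t) (ht' : D.IsRow t')
    {i₀ i₁ i₂ : ℤ} (h₁ : i₁ ≤ i₀) (h₂ : i₀ ≤ i₂) (h₀ : (t i₀).left = (t' i₀).left)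
    (h : ∀ i, i₁ ≤ i → i ≤ i₂ → (t i).top = (t' i).top) {i : ℤ} (hi₁ : i₁ ≤ i)
    (hi₂ : i ≤ i₂) : t i = t' i :=
  ht.eq_of_left_eq ht' (s := Tile.top) (fun _ _ => tile_ext_left_top)
    (fun _ _ => tile_ext_top_right) h₁ h₂ h₀ h hi₁ hi₂

/-- With the bottom edge fixed, the left and the right edge of a tile determine each other. Passing
from left to right is thus a permutation of V, which can be followed along the whole bottom word in
both directions. -/
theorem exists_row (a : V) (β : ℤ → H) :
    ∃ t : ℤ → D.Tile, D.IsRow t ∧ (t 0).left = a ∧ ∀ i, (t i).bottom = β i := by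
  choose T hT₁ hT₂ using D.exists_tile_left_bottom
  have hbij : ∀ b, Function.Bijective fun a => (T a b).right := by
    refine fun b => ⟨fun a a' h => ?_, fun a => ⟨(D.tileBR b a).left, ?_⟩⟩
    · have := tile_ext_bottom_right (t := T a b) (t' := T a' b) (by rw [hT₂, hT₂]) h
      rw [← hT₁ a b, this, hT₁]
    · have : T (D.tileBR b a).left b = D.tileBR b a :=
        tile_ext_left_bottom (hT₁ _ _) (by rw [hT₂, tileBR_bottom])
      simp only [this, tileBR_right]
  obtain ⟨e, he0, he⟩ := exists_int_orbit (fun i => Equiv.ofBijective _ (hbij (β i))) a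
  exact ⟨fun i => T (e i) (β i), fun i => by rw [hT₁, he]; rfl, by rw [hT₁, he0],
    fun i => hT₂ _ _⟩

/-- Bi-infinite reduced words. -/
abbrev BiWord {T : Type*} (i : T → T) : Type _ := {β : ℤ → T // ∀ n, β (n + 1) ≠ i (β n)}

/-- The bi-infinite row with a given left edge at the origin and given bottom edges. -/
noncomputable def row (a : V) (β : ℤ → H) : ℤ → D.Tile := (D.exists_row a β).choose

theorem isRow_row (a : V) (β : ℤ → H) : D.IsRow (D.row a β) := (D.exists_row a β).choose_spec.1

theorem row_left (a : V) (β : ℤ → H) : (D.row a β 0).left = a :=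
  (D.exists_row a β).choose_spec.2.1

theorem row_bottom (a : V) (β : ℤ → H) (i : ℤ) : (D.row a β i).bottom = β i :=
  (D.exists_row a β).choose_spec.2.2 i

variable {D} in
theorem IsRow.eq_row {t : ℤ → D.Tile} (ht : D.IsRow t) :
    D.row (t 0).left (fun i => (t i).bottom) = t := by
  funext i
  exact (D.isRow_row _ _).eq_of_bottom_eq ht (i₀ := 0) (i₁ := min 0 i) (i₂ := max 0 i) (by simp)
    (by simp) (D.row_left _ _) (fun j _ _ => D.row_bottom _ _ j) (by simp) (by simp)

theorem row_top_reduced (a : V) (β : BiWord D.invH) (i : ℤ) :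
    (D.row a β.1 (i + 1)).top ≠ D.invH (D.row a β.1 i).top := by
  rw [ne_eq, ← bottom_eq_inv_iff (D.isRow_row a β.1 i), row_bottom, row_bottom]
  exact β.2 i

/-- Passing from the bottom edges of a row to its top edges. -/
noncomputable def rowUp (a : V) (β : BiWord D.invH) : BiWord D.invH :=
  ⟨fun i => (D.row a β.1 i).top, D.row_top_reduced a β⟩

/-- A row turned upside down is again a row; its left edge at the origin is a⁻¹ and its bottom is
the old top, which determines it. -/
theorem rowUp_inv_rowUp (a : V) (β : BiWord D.invH) :
    D.rowUp (D.invV a) (D.rowUp a β) = β := by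
  have hr : D.IsRow fun i => D.flipV (D.row a β.1 i) := fun i =>
    congrArg D.invV (D.isRow_row a β.1 i)
  have := hr.eq_row
  have h0 : (D.flipV (D.row a β.1 0)).left = D.invV a := congrArg D.invV (D.row_left a β.1)
  rw [h0] at this
  refine Subtype.ext (funext fun i => ?_)
  have h1 := congrArg Tile.top (congrFun this i)
  exact h1.trans (D.row_bottom a β.1 i)

noncomputable def rowPerm (a : V) : Equiv.Perm (BiWord D.invH) where
  toFun := D.rowUp a
  invFun := D.rowUp (D.invV a)
  left_inv := D.rowUp_inv_rowUp a
  right_inv β := by simpa [D.invV_invV] using D.rowUp_inv_rowUp (D.invV a) β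

/-- The symbols at the positions of the first axis and of the second axis can be prescribed. -/
theorem exists_mem_subshift (α : BiWord D.invV) (β : BiWord D.invH) :
    ∃ x ∈ D.subshift.carrier, (∀ j, (x (0, j)).left = α.1 j) ∧ ∀ i, (x (i, 0)).bottom = β.1 i := by
  -- The word e j is the bottom of row j; the left letters at the second axis say how to pass from
  -- one row to the next.
  obtain ⟨e, he0, he⟩ := exists_int_orbit (fun j => D.rowPerm (α.1 j)) β
  set x : ℤ × ℤ → D.Tile := fun p => D.row (α.1 p.2) (e p.2).1 p.1 with hx
  have hrow : ∀ j, D.IsRow fun i => x (i, j) := fun j => D.isRow_row (α.1 j) (e j).1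
  have hleft : ∀ j, (x (0, j)).left = α.1 j := fun j => D.row_left _ _
  have hbottom : ∀ i j, (x (i, j)).bottom = (e j).1 i := fun i j => D.row_bottom _ _ i
  have htop : ∀ i j, (x (i, j)).top = (x (i, j + 1)).bottom := fun i j => by
    rw [hbottom, he]; rfl
  refine ⟨x, fun i j => ⟨⟨hrow j i, ?_⟩, ⟨htop i j, ?_⟩⟩, hleft, fun i => ?_⟩
  · rw [hbottom, hbottom]
    exact (e j).2 i
  -- Absence of vertical backtracking is given only in column 0; `left_eq_inv_iff` carries it across
  -- each column.
  · induction i using Int.induction_on with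
    | zero => rw [hleft, hleft]; exact α.2 j
    | succ i ih => rwa [← hrow j, ← hrow (j + 1), ne_eq, ← left_eq_inv_iff (htop _ _)]
    | pred i ih =>
      rw [ne_eq, left_eq_inv_iff (htop _ _)]
      have h1 := hrow j (-i - 1)
      have h2 := hrow (j + 1) (-i - 1)
      simp only [sub_add_cancel] at h1 h2
      rwa [h1, h2]
  · rw [hbottom, he0]

theorem exists_mem_subshift_base (a : ℤ × ℤ) (α : BiWord D.invV) (β : BiWord D.invH) :
    ∃ x ∈ D.subshift.carrier, (∀ j, (x (a.1, j)).left = α.1 j) ∧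
      ∀ i, (x (i, a.2)).bottom = β.1 i := by
  obtain ⟨x, hx, h₁, h₂⟩ := D.exists_mem_subshift
    ⟨fun j => α.1 (j + a.2), fun j => by
      simp only [add_right_comm j 1]; exact α.2 _⟩
    ⟨fun i => β.1 (i + a.1), fun i => by
      simp only [add_right_comm i 1]; exact β.2 _⟩
  refine ⟨planeShift (-a) x, D.subshift.shift_mem _ x hx, fun j => ?_, fun i => ?_⟩
  · have := h₁ (j - a.2)
    simp only [sub_add_cancel] at this
    rw [← this]
    change (x (-a + (a.1, j))).left = _
    rw [show -a + (a.1, j) = (0, j - a.2) by ext <;> simp [sub_eq_neg_add]]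
  · have := h₂ (i - a.1)
    simp only [sub_add_cancel] at this
    rw [← this]
    change (x (-a + (i, a.2))).bottom = _
    rw [show -a + (i, a.2) = (i - a.1, 0) by ext <;> simp [sub_eq_neg_add]]

variable {D}

theorem isRow_of_mem {x : ℤ × ℤ → D.Tile} (hx : x ∈ D.subshift.carrier) (j : ℤ) :
    D.IsRow fun i => x (i, j) := fun i => (hx i j).1.1

theorem bottom_ne_of_mem {x : ℤ × ℤ → D.Tile} (hx : x ∈ D.subshift.carrier) (i j : ℤ) :
    (x (i + 1, j)).bottom ≠ D.invH (x (i, j)).bottom := (hx i j).1.2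

theorem top_eq_of_mem {x : ℤ × ℤ → D.Tile} (hx : x ∈ D.subshift.carrier) (i j : ℤ) :
    (x (i, j)).top = (x (i, j + 1)).bottom := (hx i j).2.1

theorem left_ne_of_mem {x : ℤ × ℤ → D.Tile} (hx : x ∈ D.subshift.carrier) (i j : ℤ) :
    (x (i, j + 1)).left ≠ D.invV (x (i, j)).left := (hx i j).2.2

/-- A rectangular pattern is determined by the edges along a vertical and a horizontal line. -/
theorem eq_of_axes_eq {x y : ℤ × ℤ → D.Tile} (hx : x ∈ D.subshift.carrier)
    (hy : y ∈ D.subshift.carrier) {i₀ i₁ i₂ j₀ j₁ j₂ : ℤ} (hi₁ : i₁ ≤ i₀) (hi₂ : i₀ ≤ i₂)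
    (hj₁ : j₁ ≤ j₀) (hj₂ : j₀ ≤ j₂)
    (hl : ∀ j, j₁ ≤ j → j ≤ j₂ → (x (i₀, j)).left = (y (i₀, j)).left)
    (hb : ∀ i, i₁ ≤ i → i ≤ i₂ → (x (i, j₀)).bottom = (y (i, j₀)).bottom) {i j : ℤ}
    (h₁ : i₁ ≤ i) (h₂ : i ≤ i₂) (h₃ : j₁ ≤ j) (h₄ : j ≤ j₂) : x (i, j) = y (i, j) := by
  have base : ∀ i, i₁ ≤ i → i ≤ i₂ → x (i, j₀) = y (i, j₀) := fun i h h' =>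
    (isRow_of_mem hx j₀).eq_of_bottom_eq (isRow_of_mem hy j₀) hi₁ hi₂ (hl _ hj₁ hj₂) hb h h'
  have up : ∀ j, j₀ ≤ j → j ≤ j₂ → ∀ i, i₁ ≤ i → i ≤ i₂ → x (i, j) = y (i, j) := by
    intro j hj
    induction j, hj using Int.leInduction with
    | base => exact fun _ => base
    | succ j hj ih =>
      intro hj' i h h'
      refine (isRow_of_mem hx (j + 1)).eq_of_bottom_eq (isRow_of_mem hy (j + 1)) hi₁ hi₂
        (hl _ (by omega) hj') (fun i h h' => ?_) h h'
      rw [← top_eq_of_mem hx, ← top_eq_of_mem hy, ih (by omega) i h h']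
  have down : ∀ j, j ≤ j₀ → j₁ ≤ j → ∀ i, i₁ ≤ i → i ≤ i₂ → x (i, j) = y (i, j) := by
    intro j hj
    induction j, hj using Int.leInductionDown with
    | base => exact fun _ => base
    | pred j hj ih =>
      intro hj' i h h'
      refine (isRow_of_mem hx (j - 1)).eq_of_top_eq (isRow_of_mem hy (j - 1)) hi₁ hi₂
        (hl _ hj' (by omega)) (fun i h h' => ?_) h h'
      rw [top_eq_of_mem hx, top_eq_of_mem hy, sub_add_cancel, ih (by omega) i h h']
  rcases le_total j₀ j with h | h
  · exact up j h h₄ i h₁ h₂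
  · exact down j h h₃ i h₁ h₂

end VHDatum

/-! ### Regularity -/

/-- Counts extensions by one new edge letter: the letter lies in a set of q values depending on the
old pattern, each of them occurs, and the letter determines the whole extension. -/
theorem PlaneSubshift.hasExtensions_of_letters {W T : Type*} [TopologicalSpace W]
    (X : PlaneSubshift W) {q : ℕ} {F F' : Finset (ℤ × ℤ)} (h : F ⊆ F') (s : W → T) {b : ℤ × ℤ}
    (hb : b ∈ F') (A : (ℤ × ℤ → W) → Set T) (hA : ∀ x, (A x).encard = q)
    (h₁ : ∀ x ∈ X.carrier, ∀ y ∈ X.carrier, (∀ c ∈ F, y c = x c) → s (y b) ∈ A x)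
    (h₂ : ∀ x ∈ X.carrier, ∀ t ∈ A x, ∃ y ∈ X.carrier, (∀ c ∈ F, y c = x c) ∧ s (y b) = t)
    (h₃ : ∀ x ∈ X.carrier, ∀ y ∈ X.carrier, (∀ c ∈ F, y c = x c) → s (y b) = s (x b) →
      ∀ c ∈ F', y c = x c) : X.HasExtensions q F F' h := by
  rintro p ⟨x, hx, hxp⟩
  have h₂' : ∀ t : A x, ∃ y ∈ X.carrier, (∀ c ∈ F, y c = x c) ∧ s (y b) = t := fun t =>
    h₂ x hx t.1 t.2
  choose f hf hfx hfs using h₂'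
  rw [← hA x]
  have : {p' : F' → W | p' ∈ X.patterns F' ∧ ∀ b : F, p' ⟨b, h b.2⟩ = p b} =
      Set.range fun (t : A x) (c : F') => f t c := by
    ext p'
    constructor
    · rintro ⟨⟨y, hy, hyp⟩, hp⟩
      have hyx : ∀ c ∈ F, y c = x c := fun c hc => by
        rw [hyp ⟨c, h hc⟩, hp ⟨c, hc⟩, ← hxp]
      refine ⟨⟨s (y b), h₁ x hx y hy hyx⟩, funext fun c => ?_⟩
      rw [← hyp c]
      exact h₃ y hy _ (hf _) (fun c hc => by rw [hfx _ c hc, hyx c hc]) (hfs _) c c.2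
    · rintro ⟨t, rfl⟩
      exact ⟨⟨f t, hf t, fun _ => rfl⟩, fun c => (hfx t c c.2).trans (hxp c)⟩
  rw [this, ← Set.image_univ, Function.Injective.encard_image, Set.encard_univ, Set.encard]
  intro t t' htt'
  have := congrArg s (congrFun htt' ⟨b, hb⟩)
  simp only [hfs] at this
  exact Subtype.ext this

theorem encard_ne_eq {T : Type*} [Finite T] {d : ℕ} (hT : Nat.card T = 2 * d) (t : T) :
    {u | u ≠ t}.encard = (2 * d - 1 : ℕ) := by
  have h1 : {u | u ≠ t} = ({t} : Set T)ᶜ := rfl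
  rw [h1, ← (Set.toFinite _).cast_ncard_eq, Set.ncard_compl, Set.ncard_singleton, hT]

namespace VHDatum

variable {V H : Type*} {d : ℕ} {D : VHDatum V H d d}

theorem exists_mem_of_axes {x : ℤ × ℤ → D.Tile} (hx : x ∈ D.subshift.carrier) {i₁ i₂ j₁ j₂ : ℤ}
    (hi : i₁ ≤ i₂) (hj : j₁ ≤ j₂) (α : BiWord D.invV) (β : BiWord D.invH)
    (hα : ∀ j, j₁ ≤ j → j ≤ j₂ → α.1 j = (x (i₁, j)).left)
    (hβ : ∀ i, i₁ ≤ i → i ≤ i₂ → β.1 i = (x (i, j₁)).bottom) :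
    ∃ y ∈ D.subshift.carrier, (∀ c ∈ Finset.Icc (i₁, j₁) (i₂, j₂), y c = x c) ∧
      (∀ j, (y (i₁, j)).left = α.1 j) ∧ ∀ i, (y (i, j₁)).bottom = β.1 i := by
  obtain ⟨y, hy, hl, hb⟩ := D.exists_mem_subshift_base (i₁, j₁) α β
  refine ⟨y, hy, ?_, hl, hb⟩
  rintro ⟨i, j⟩ hc
  simp only [Finset.mem_Icc, Prod.mk_le_mk] at hc
  exact eq_of_axes_eq hy hx le_rfl hi le_rfl hj (fun j h h' => by rw [hl, hα j h h'])
    (fun i h h' => by rw [hb, hβ i h h']) hc.1.1 hc.2.1 hc.1.2 hc.2.2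

theorem eqOn_Icc_of_axes_eq {x y : ℤ × ℤ → D.Tile} (hx : x ∈ D.subshift.carrier)
    (hy : y ∈ D.subshift.carrier) {i₀ i₁ i₂ j₀ j₁ j₂ : ℤ} (hi₁ : i₁ ≤ i₀) (hi₂ : i₀ ≤ i₂)
    (hj₁ : j₁ ≤ j₀) (hj₂ : j₀ ≤ j₂)
    (hl : ∀ j, j₁ ≤ j → j ≤ j₂ → (x (i₀, j)).left = (y (i₀, j)).left)
    (hb : ∀ i, i₁ ≤ i → i ≤ i₂ → (x (i, j₀)).bottom = (y (i, j₀)).bottom) :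
    ∀ c ∈ Finset.Icc (i₁, j₁) (i₂, j₂), x c = y c := by
  rintro ⟨i, j⟩ hc
  simp only [Finset.mem_Icc, Prod.mk_le_mk] at hc
  exact eq_of_axes_eq hx hy hi₁ hi₂ hj₁ hj₂ hl hb hc.1.1 hc.2.1 hc.1.2 hc.2.2

/-- The left edges in a column. -/
def leftWord {x : ℤ × ℤ → D.Tile} (hx : x ∈ D.subshift.carrier) (i : ℤ) : BiWord D.invV :=
  ⟨fun j => (x (i, j)).left, left_ne_of_mem hx i⟩

/-- The bottom edges in a row. -/
def bottomWord {x : ℤ × ℤ → D.Tile} (hx : x ∈ D.subshift.carrier) (j : ℤ) : BiWord D.invH :=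
  ⟨fun i => (x (i, j)).bottom, fun i => bottom_ne_of_mem hx i j⟩

/-- The word is continued by t forever, which is reduced because t is not its own inverse. -/
theorem exists_biWord_eq_above {T : Type*} {i : T → T} (hi : ∀ t, i t ≠ t) (β : BiWord i) (n : ℤ)
    {t : T} (ht : t ≠ i (β.1 n)) : ∃ γ : BiWord i, (∀ k ≤ n, γ.1 k = β.1 k) ∧ γ.1 (n + 1) = t := by
  refine ⟨⟨fun k => if k ≤ n then β.1 k else t, fun k => ?_⟩, fun k hk => if_pos hk, by simp⟩
  rcases lt_trichotomy k n with h | rfl | h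
  · simp only [if_pos h.le, if_pos (show k + 1 ≤ n from h)]
    exact β.2 k
  · simpa using ht
  · simp only [if_neg h.not_ge, if_neg (show ¬ k + 1 ≤ n by omega)]
    exact (hi t).symm

theorem exists_biWord_eq_below {T : Type*} {i : T → T} (hi : ∀ t, i t ≠ t) (β : BiWord i) (n : ℤ)
    {t : T} (ht : β.1 n ≠ i t) : ∃ γ : BiWord i, (∀ k, n ≤ k → γ.1 k = β.1 k) ∧ γ.1 (n - 1) = t := by
  refine ⟨⟨fun k => if n ≤ k then β.1 k else t, fun k => ?_⟩, fun k hk => if_pos hk, by simp⟩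
  rcases lt_trichotomy (k + 1) n with h | rfl | h
  · simp only [if_neg h.not_ge, if_neg (show ¬ n ≤ k by omega)]
    exact (hi t).symm
  · simpa using ht
  · simp only [if_pos h.le, if_pos (show n ≤ k by omega)]
    exact β.2 k

/-- A new column is determined by the bottom edge of its lowest tile, since the left and bottom
words determine a rectangle. That edge may be anything except the inverse of the preceding bottom
letter. The other three directions follow the same pattern. -/
theorem hasExtensions_right [Finite H] {i₁ i₂ j₁ j₂ : ℤ} (hi : i₁ ≤ i₂) (hj : j₁ ≤ j₂)
    (h : Finset.Icc (i₁, j₁) (i₂, j₂) ⊆ Finset.Icc (i₁, j₁) (i₂ + 1, j₂)) :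
    D.subshift.HasExtensions (2 * d - 1) _ _ h := by
  have hc : (i₂, j₁) ∈ Finset.Icc (i₁, j₁) (i₂, j₂) := by simp [hi, hj]
  refine D.subshift.hasExtensions_of_letters h Tile.bottom (b := (i₂ + 1, j₁))
    (by simp; omega) (fun x => {u | u ≠ D.invH (x (i₂, j₁)).bottom})
    (fun x => encard_ne_eq D.card_H _) ?_ ?_ ?_
  · intro x hx y hy hxy
    rw [Set.mem_ofPred_eq, ← hxy _ hc]
    exact bottom_ne_of_mem hy _ _
  · intro x hx t ht
    obtain ⟨γ, hγ, hγt⟩ := exists_biWord_eq_above D.invH_ne (bottomWord hx j₁) i₂ ht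
    obtain ⟨y, hy, hyx, -, hyb⟩ := exists_mem_of_axes hx hi hj (leftWord hx i₁) γ
      (fun _ _ _ => rfl) (fun i _ h => hγ i h)
    exact ⟨y, hy, hyx, by rw [hyb, hγt]⟩
  · intro x hx y hy hxy hb
    refine eqOn_Icc_of_axes_eq hy hx (i₀ := i₁) (j₀ := j₁) le_rfl (by omega) le_rfl hj
      (fun j h h' => ?_) (fun i h h' => ?_)
    · rw [hxy]; simp; omega
    · rcases h'.eq_or_lt with rfl | h'
      · exact hb
      · rw [hxy]; simp; omega

theorem hasExtensions_left [Finite H] {i₁ i₂ j₁ j₂ : ℤ} (hi : i₁ ≤ i₂) (hj : j₁ ≤ j₂)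
    (h : Finset.Icc (i₁, j₁) (i₂, j₂) ⊆ Finset.Icc (i₁ - 1, j₁) (i₂, j₂)) :
    D.subshift.HasExtensions (2 * d - 1) _ _ h := by
  have hc : (i₁, j₁) ∈ Finset.Icc (i₁, j₁) (i₂, j₂) := by simp [hi, hj]
  refine D.subshift.hasExtensions_of_letters h Tile.bottom (b := (i₁ - 1, j₁))
    (by simp; omega) (fun x => {u | u ≠ D.invH (x (i₁, j₁)).bottom})
    (fun x => encard_ne_eq D.card_H _) ?_ ?_ ?_
  · intro x hx y hy hxy hb
    rw [← hxy _ hc] at hb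
    have := bottom_ne_of_mem hy (i₁ - 1) j₁
    rw [hb, sub_add_cancel, D.invH_invH] at this
    exact this rfl
  · intro x hx t ht
    obtain ⟨γ, hγ, hγt⟩ := exists_biWord_eq_below D.invH_ne (bottomWord hx j₁) i₁ (t := t)
      (fun h => ht (by rw [← D.invH_invH t]; exact congrArg D.invH h.symm))
    obtain ⟨y, hy, hyx, -, hyb⟩ := exists_mem_of_axes hx hi hj (leftWord hx i₁) γ
      (fun _ _ _ => rfl) (fun i h _ => hγ i h)
    exact ⟨y, hy, hyx, by rw [hyb, hγt]⟩
  · intro x hx y hy hxy hb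
    refine eqOn_Icc_of_axes_eq hy hx (i₀ := i₁) (j₀ := j₁) (by omega) hi le_rfl hj
      (fun j h h' => ?_) (fun i h h' => ?_)
    · rw [hxy]; simp; omega
    · rcases h.eq_or_lt with rfl | h
      · exact hb
      · rw [hxy]; simp; omega

theorem hasExtensions_up [Finite V] {i₁ i₂ j₁ j₂ : ℤ} (hi : i₁ ≤ i₂) (hj : j₁ ≤ j₂)
    (h : Finset.Icc (i₁, j₁) (i₂, j₂) ⊆ Finset.Icc (i₁, j₁) (i₂, j₂ + 1)) :
    D.subshift.HasExtensions (2 * d - 1) _ _ h := by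
  have hc : (i₁, j₂) ∈ Finset.Icc (i₁, j₁) (i₂, j₂) := by simp [hi, hj]
  refine D.subshift.hasExtensions_of_letters h Tile.left (b := (i₁, j₂ + 1))
    (by simp; omega) (fun x => {u | u ≠ D.invV (x (i₁, j₂)).left})
    (fun x => encard_ne_eq D.card_V _) ?_ ?_ ?_
  · intro x hx y hy hxy
    rw [Set.mem_ofPred_eq, ← hxy _ hc]
    exact left_ne_of_mem hy _ _
  · intro x hx t ht
    obtain ⟨γ, hγ, hγt⟩ := exists_biWord_eq_above D.invV_ne (leftWord hx i₁) j₂ ht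
    obtain ⟨y, hy, hyx, hyl, -⟩ := exists_mem_of_axes hx hi hj γ (bottomWord hx j₁)
      (fun j _ h => hγ j h) (fun _ _ _ => rfl)
    exact ⟨y, hy, hyx, by rw [hyl, hγt]⟩
  · intro x hx y hy hxy hb
    refine eqOn_Icc_of_axes_eq hy hx (i₀ := i₁) (j₀ := j₁) le_rfl hi le_rfl (by omega)
      (fun j h h' => ?_) (fun i h h' => ?_)
    · rcases h'.eq_or_lt with rfl | h'
      · exact hb
      · rw [hxy]; simp; omega
    · rw [hxy]; simp; omega

theorem hasExtensions_down [Finite V] {i₁ i₂ j₁ j₂ : ℤ} (hi : i₁ ≤ i₂) (hj : j₁ ≤ j₂)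
    (h : Finset.Icc (i₁, j₁) (i₂, j₂) ⊆ Finset.Icc (i₁, j₁ - 1) (i₂, j₂)) :
    D.subshift.HasExtensions (2 * d - 1) _ _ h := by
  have hc : (i₁, j₁) ∈ Finset.Icc (i₁, j₁) (i₂, j₂) := by simp [hi, hj]
  refine D.subshift.hasExtensions_of_letters h Tile.left (b := (i₁, j₁ - 1))
    (by simp; omega) (fun x => {u | u ≠ D.invV (x (i₁, j₁)).left})
    (fun x => encard_ne_eq D.card_V _) ?_ ?_ ?_
  · intro x hx y hy hxy hb
    rw [← hxy _ hc] at hb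
    have := left_ne_of_mem hy i₁ (j₁ - 1)
    rw [hb, sub_add_cancel, D.invV_invV] at this
    exact this rfl
  · intro x hx t ht
    obtain ⟨γ, hγ, hγt⟩ := exists_biWord_eq_below D.invV_ne (leftWord hx i₁) j₁ (t := t)
      (fun h => ht (by rw [← D.invV_invV t]; exact congrArg D.invV h.symm))
    obtain ⟨y, hy, hyx, hyl, -⟩ := exists_mem_of_axes hx hi hj γ (bottomWord hx j₁)
      (fun j h _ => hγ j h) (fun _ _ _ => rfl)
    exact ⟨y, hy, hyx, by rw [hyl, hγt]⟩
  · intro x hx y hy hxy hb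
    refine eqOn_Icc_of_axes_eq hy hx (i₀ := i₁) (j₀ := j₁) le_rfl hi (by omega) hj
      (fun j h h' => ?_) (fun i h h' => ?_)
    · rcases h.eq_or_lt with rfl | h
      · exact hb
      · rw [hxy]; simp; omega
    · rw [hxy]; simp; omega

variable [Finite V] [Finite H]

instance : Finite D.Tile := inferInstanceAs (Finite D.R)

theorem subshift_isOfFiniteType : D.subshift.IsOfFiniteType := by
  classical
  refine ⟨{(0, 0), (1, 0), (0, 1)},
    {p | D.horizontal (p ⟨(0, 0), by simp⟩) (p ⟨(1, 0), by simp⟩) ∧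
      D.vertical (p ⟨(0, 0), by simp⟩) (p ⟨(0, 1), by simp⟩)}, Set.toFinite _, ?_⟩
  ext x
  constructor
  · rintro hx ⟨i, j⟩
    simpa [planeShift] using hx i j
  · intro hx i j
    simpa [planeShift] using hx (i, j)

theorem subshift_isRegular : D.subshift.IsRegular (2 * d - 1) :=
  ⟨subshift_isOfFiniteType, fun _ _ hm hn => ⟨hasExtensions_right hm hn _,
    hasExtensions_left hm hn _, hasExtensions_up hm hn _, hasExtensions_down hm hn _⟩⟩

end VHDatum

/-! ### Measures on subshifts -/

/-- The first letter is repeated to the left and the last one to the right; the index is clamped to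
the range of the word. -/
theorem ReducedWord.exists_biWord {T : Type*} {i : T → T} (hi : ∀ t, i t ≠ t) {k : ℕ} (hk : 1 ≤ k)
    (w : ReducedWord i k) (a : ℤ) :
    ∃ β : VHDatum.BiWord i, ∀ (n : ℕ) (hn : n < w.1.length), β.1 (a + n) = w.1[n] := by
  have hl : w.1.length = k := w.2.1
  let c : ℤ → ℕ := fun n => min (n - a).toNat (k - 1)
  have hc : ∀ n, c n < w.1.length := fun n => by simp only [c]; omega
  refine ⟨⟨fun n => w.1[c n]'(hc n), fun n => ?_⟩, fun n hn => ?_⟩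
  · have hch := List.isChain_iff_getElem.1 w.2.2
    have : c (n + 1) = c n ∨ c (n + 1) = c n + 1 := by simp only [c]; omega
    rcases this with h | h
    · simp only [h]
      exact (hi _).symm
    · simp only [h]
      exact hch _ (by rw [← h]; exact hc _)
  · have : c (a + n) = n := by simp only [c]; omega
    simp only [this]

namespace PlaneSubshift

variable {W : Type*} [TopologicalSpace W] (X : PlaneSubshift W)

/-- The points of `X` that agree with `x` on `F`. -/
def cylinder (F : Set (ℤ × ℤ)) (x : X.carrier) : Set X.carrier := {y | ∀ b ∈ F, y.1 b = x.1 b}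

variable {X}

theorem shift_apply (a b : ℤ × ℤ) (x : X.carrier) : (X.shift a x).1 b = x.1 (a + b) := rfl

theorem mem_cylinder {F : Set (ℤ × ℤ)} {x y : X.carrier} :
    y ∈ X.cylinder F x ↔ ∀ b ∈ F, y.1 b = x.1 b := Iff.rfl

theorem continuous_eval (b : ℤ × ℤ) : Continuous fun y : X.carrier => y.1 b :=
  (continuous_apply b).comp continuous_subtype_val

theorem continuous_shift (a : ℤ × ℤ) : Continuous (X.shift a) :=
  Continuous.subtype_mk (continuous_pi fun b => continuous_eval (a + b)) _

theorem shift_add (a b : ℤ × ℤ) (x : X.carrier) : X.shift (a + b) x = X.shift b (X.shift a x) :=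
  Subtype.ext (funext fun c => by simp [shift_apply, add_assoc])

theorem shift_zero (x : X.carrier) : X.shift 0 x = x :=
  Subtype.ext (funext fun c => by simp [shift_apply])

instance [Finite W] : CompactSpace X.carrier :=
  isCompact_iff_compactSpace.1 (X.isClosed.isCompact)

theorem hasExtensions_singleton [Finite W] :
    X.HasExtensions X.symbolCount ∅ (Finset.Icc (0 : ℤ × ℤ) 0) (Finset.empty_subset _) := by
  rintro p -
  rw [symbolCount, Set.Finite.cast_ncard_eq (Set.toFinite _)]
  have h0 : ∀ b : (Finset.Icc (0 : ℤ × ℤ) 0), (b : ℤ × ℤ) = 0 := fun b =>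
    Finset.mem_singleton.1 (Finset.Icc_self (0 : ℤ × ℤ) ▸ b.2)
  have : {p' : (Finset.Icc (0 : ℤ × ℤ) 0) → W | p' ∈ X.patterns (Finset.Icc 0 0) ∧
      ∀ b : (∅ : Finset (ℤ × ℤ)), p' ⟨b, Finset.empty_subset _ b.2⟩ = p b} =
      (fun w _ => w) '' {w : W | ∃ x ∈ X.carrier, x 0 = w} := by
    ext p'
    constructor
    · rintro ⟨⟨x, hx, hp⟩, -⟩
      exact ⟨x 0, ⟨x, hx, rfl⟩, funext fun b => by rw [← hp b, h0 b]⟩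
    · rintro ⟨w, ⟨x, hx, rfl⟩, rfl⟩
      exact ⟨⟨x, hx, fun b => by rw [h0 b]⟩, fun b => absurd b.2 (Finset.notMem_empty _)⟩
  rw [this, Function.Injective.encard_image]
  intro w w' h
  exact congrFun h ⟨0, by simp⟩

variable [DiscreteTopology W]

theorem isClopen_cylinder (F : Finset (ℤ × ℤ)) (x : X.carrier) :
    IsClopen (X.cylinder (F : Set (ℤ × ℤ)) x) := by
  have : X.cylinder (F : Set (ℤ × ℤ)) x = ⋂ b ∈ F, (fun y : X.carrier => y.1 b) ⁻¹' {x.1 b} := by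
    ext y
    simp [mem_cylinder]
  rw [this]
  exact isClopen_biInter_finset fun b _ => (isClopen_discrete _).preimage (continuous_eval b)

/-- The square `[-N, N]²`. -/
noncomputable def square (N : ℕ) : Finset (ℤ × ℤ) := Finset.Icc (-(N : ℤ), -(N : ℤ)) ((N : ℤ), (N : ℤ))

theorem mem_square {N : ℕ} {b : ℤ × ℤ} :
    b ∈ square N ↔ (-(N : ℤ) ≤ b.1 ∧ -(N : ℤ) ≤ b.2) ∧ b.1 ≤ N ∧ b.2 ≤ N := by
  simp [square, Prod.le_def]

theorem square_mono {M N : ℕ} (h : M ≤ N) : square M ⊆ square N := by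
  intro b
  simp only [mem_square]
  omega

theorem exists_subset_square (F : Finset (ℤ × ℤ)) : ∃ N, F ⊆ square N := by
  refine ⟨F.sup fun b => b.1.natAbs ⊔ b.2.natAbs, fun b hb => ?_⟩
  have : b.1.natAbs ⊔ b.2.natAbs ≤ F.sup fun b => b.1.natAbs ⊔ b.2.natAbs :=
    Finset.le_sup (f := fun b : ℤ × ℤ => b.1.natAbs ⊔ b.2.natAbs) hb
  rw [mem_square]
  omega

/-- A locally constant function depends on a finite window only. -/
theorem exists_window [Finite W] {Y : Type*} {f : X.carrier → Y} (hf : IsLocallyConstant f) :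
    ∃ N, ∀ x y : X.carrier, (∀ b ∈ square N, x.1 b = y.1 b) → f x = f y := by
  have h1 : ∀ x : X.carrier, ∃ N, ∀ y ∈ X.cylinder (square N : Set (ℤ × ℤ)) x, f y = f x := by
    intro x
    obtain ⟨U, hU, hUx⟩ := isOpen_induced_iff.1 (hf.isOpen_fiber (f x))
    have hxU : x.1 ∈ U := by
      have : x ∈ Subtype.val ⁻¹' U := by rw [hUx]; rfl
      exact this
    obtain ⟨I, u, hu, hI⟩ := isOpen_pi_iff.1 hU x.1 hxU
    obtain ⟨N, hN⟩ := exists_subset_square I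
    refine ⟨N, fun y hy => ?_⟩
    have : y ∈ Subtype.val ⁻¹' U := hI fun b hb => by
      rw [hy b (hN hb)]
      exact (hu b hb).2
    rw [hUx] at this
    exact this
  choose N hN using h1
  obtain ⟨t, ht⟩ := isCompact_univ.elim_nhds_subcover'
    (fun x _ => X.cylinder (square (N x) : Set (ℤ × ℤ)) x)
    (fun x _ => (isClopen_cylinder _ _).isOpen.mem_nhds fun _ _ => rfl)
  refine ⟨t.sup fun x => N x, fun x y hxy => ?_⟩
  obtain ⟨z, hz, hxz⟩ := Set.mem_iUnion₂.1 (ht (Set.mem_univ x))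
  have hle : N z ≤ t.sup fun x => N x := Finset.le_sup (f := fun x => N x.1) hz
  rw [hN z x hxz]
  refine (hN z y fun b hb => ?_).symm
  rw [← hxy b (square_mono hle hb), hxz b hb]

variable [MeasurableSpace W] [MeasurableSingletonClass W] [Finite W]

instance : BorelSpace X.carrier := by
  have : BorelSpace W := ⟨by
    rw [borel_eq_top_of_discrete]
    exact eq_top_iff.2 fun s _ => (Set.toFinite s).measurableSet⟩
  infer_instance

/-- If every pattern of shape `F` has `q` extensions of shape `F'`, all of the same mass `c`, then
it has mass `q c`. -/
theorem measure_cylinder_of_hasExtensions {q : ℕ} {F F' : Finset (ℤ × ℤ)} {h : F ⊆ F'}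
    (hF : X.HasExtensions q F F' h) {μ : Measure X.carrier} {c : ℝ≥0∞}
    (hc : ∀ x, μ (X.cylinder (F' : Set (ℤ × ℤ)) x) = c) (x : X.carrier) :
    μ (X.cylinder (F : Set (ℤ × ℤ)) x) = q * c := by
  classical
  set S := {p' : F' → W | p' ∈ X.patterns F' ∧ ∀ b : F, p' ⟨b, h b.2⟩ = x.1 b}
  have hS : S.encard = q := hF _ ⟨x, x.2, fun _ => rfl⟩
  have hfin : S.Finite := Set.finite_of_encard_eq_coe hS
  have hcard : hfin.toFinset.card = q := by
    rw [hfin.encard_eq_coe_toFinset_card] at hS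
    exact_mod_cast hS
  have hrep : ∀ p ∈ S, ∃ y : X.carrier,
      {z : X.carrier | ∀ b : F', z.1 b = p b} = X.cylinder (F' : Set (ℤ × ℤ)) y := by
    rintro p ⟨⟨y, hy, hyp⟩, -⟩
    refine ⟨⟨y, hy⟩, Set.ext fun z => ⟨fun hz b hb => (hz ⟨b, hb⟩).trans (hyp ⟨b, hb⟩).symm,
      fun hz b => (hz b b.2).trans (hyp b)⟩⟩
  have hunion : X.cylinder (F : Set (ℤ × ℤ)) x =
      ⋃ p ∈ hfin.toFinset, {z : X.carrier | ∀ b : F', z.1 b = p b} := by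
    ext z
    simp only [Set.mem_iUnion, exists_prop, Set.Finite.mem_toFinset]
    constructor
    · intro hz
      exact ⟨fun b => z.1 b, ⟨⟨z, z.2, fun _ => rfl⟩, fun b => hz b b.2⟩, fun _ => rfl⟩
    · rintro ⟨p, hp, hz⟩ b hb
      exact (hz ⟨b, h hb⟩).trans (hp.2 ⟨b, hb⟩)
  rw [hunion, measure_biUnion_finset, Finset.sum_congr rfl (g := fun _ => c), Finset.sum_const, hcard,
    nsmul_eq_mul]
  · intro p hp
    obtain ⟨y, hy⟩ := hrep p (hfin.mem_toFinset.1 hp)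
    rw [hy, hc]
  · intro p _ p' _ hpp'
    refine Set.disjoint_left.2 fun z hz hz' => hpp' (funext fun b => ?_)
    rw [← hz b, hz' b]
  · intro p hp
    obtain ⟨y, hy⟩ := hrep p (hfin.mem_toFinset.1 hp)
    rw [hy]
    exact (isClopen_cylinder _ _).isOpen.measurableSet

/-- Two finite measures that agree on the patterns of shape `[-N, N]²` are equal. -/
theorem measure_ext {μ ν : Measure X.carrier} [IsFiniteMeasure μ]
    (h : ∀ (N : ℕ) (x : X.carrier), μ (X.cylinder (square N : Set (ℤ × ℤ)) x) =
      ν (X.cylinder (square N : Set (ℤ × ℤ)) x)) (huniv : μ Set.univ = ν Set.univ) : μ = ν := by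
  set C : Set (Set X.carrier) :=
    {s | ∃ (N : ℕ) (p : square N → W), s = {y | ∀ b : square N, y.1 b = p b}} with hC
  have hclopen : ∀ s ∈ C, s = ∅ ∨ ∃ N x, s = X.cylinder (square N : Set (ℤ × ℤ)) x := by
    rintro s ⟨N, p, rfl⟩
    rcases Set.eq_empty_or_nonempty {y : X.carrier | ∀ b : square N, y.1 b = p b} with he | ⟨x, hx⟩
    · exact Or.inl he
    · refine Or.inr ⟨N, x, Set.ext fun y => ⟨fun hy b hb => ?_, fun hy b => ?_⟩⟩
      · rw [hy ⟨b, hb⟩, hx ⟨b, hb⟩]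
      · rw [hy b b.2, hx b]
  have hgen : (inferInstance : MeasurableSpace X.carrier) = MeasurableSpace.generateFrom C := by
    apply le_antisymm
    · rw [show (inferInstance : MeasurableSpace X.carrier) =
        MeasurableSpace.comap Subtype.val MeasurableSpace.pi from rfl]
      rw [MeasurableSpace.pi, MeasurableSpace.comap_iSup]
      refine iSup_le fun b => ?_
      rw [MeasurableSpace.comap_comp]
      rintro _ ⟨S, -, rfl⟩
      obtain ⟨N, hN⟩ := exists_subset_square {b}
      have hb : b ∈ square N := hN (by simp)
      have : (Function.eval b ∘ Subtype.val) ⁻¹' S = ⋃ p : {p : square N → W // p ⟨b, hb⟩ ∈ S},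
          {y : X.carrier | ∀ c : square N, y.1 c = p.1 c} := by
        ext y
        simp only [Set.mem_preimage, Set.mem_iUnion]
        constructor
        · intro hy
          exact ⟨⟨fun c => y.1 c, hy⟩, fun _ => rfl⟩
        · rintro ⟨p, hp⟩
          have := p.2
          rwa [← hp ⟨b, hb⟩] at this
      rw [this]
      exact MeasurableSet.iUnion fun p => MeasurableSpace.measurableSet_generateFrom ⟨N, p.1, rfl⟩
    · refine MeasurableSpace.generateFrom_le fun s hs => ?_
      rcases hclopen s hs with rfl | ⟨N, x, rfl⟩
      · exact MeasurableSet.empty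
      · exact (isClopen_cylinder _ _).isOpen.measurableSet
  refine ext_of_generate_finite C hgen ?_ (fun s hs => ?_) huniv
  -- Squares are nested, so if two square patterns are compatible, their intersection is the
  -- cylinder of the larger one. This gives the π-system.
  · have key : ∀ (M N : ℕ) (p : square M → W) (p' : square N → W), M ≤ N →
        ({y : X.carrier | ∀ b : square M, y.1 b = p b} ∩
          {y : X.carrier | ∀ b : square N, y.1 b = p' b}).Nonempty →
        {y : X.carrier | ∀ b : square M, y.1 b = p b} ∩
          {y : X.carrier | ∀ b : square N, y.1 b = p' b} =
            {y : X.carrier | ∀ b : square N, y.1 b = p' b} := by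
      rintro M N p p' hMN ⟨x, hx, hx'⟩
      refine Set.inter_eq_right.2 fun y hy b => ?_
      rw [← hx b, hx' ⟨b, square_mono hMN b.2⟩, hy ⟨b, square_mono hMN b.2⟩]
    rintro _ ⟨M, p, rfl⟩ _ ⟨N, p', rfl⟩ hne
    rcases le_total M N with hMN | hMN
    · rw [key M N p p' hMN hne]
      exact ⟨N, p', rfl⟩
    · rw [Set.inter_comm] at hne ⊢
      rw [key N M p' p hMN hne]
      exact ⟨M, p, rfl⟩
  · rcases hclopen s hs with rfl | ⟨N, x, rfl⟩
    · simp
    · exact h N x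

/-- The natural measure is shift-invariant. -/
theorem IsNaturalMeasure.measurePreserving_shift {q : ℕ} {μ : Measure X.carrier}
    (hμ : X.IsNaturalMeasure q μ) (a : ℤ × ℤ) : MeasurePreserving (X.shift a) μ μ := by
  have := hμ.1
  have hm : Measurable (X.shift a) := (continuous_shift a).measurable
  refine ⟨hm, (measure_ext (fun N x => ?_) ?_).symm⟩
  · rw [Measure.map_apply hm (isClopen_cylinder _ _).isOpen.measurableSet]
    have h1 := hμ.2 (-(N : ℤ), -(N : ℤ)) (2 * N) (2 * N) x
    have h2 := hμ.2 (a + (-(N : ℤ), -(N : ℤ))) (2 * N) (2 * N) (X.shift (-a) x)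
    have e : ((-(N : ℤ), -(N : ℤ)) : ℤ × ℤ) + (((2 * N : ℕ) : ℤ), ((2 * N : ℕ) : ℤ)) =
        ((N : ℤ), (N : ℤ)) := by
      ext <;> push_cast <;> simp <;> ring
    rw [e] at h1
    rw [add_assoc, e] at h2
    have e1 : X.cylinder (square N : Set (ℤ × ℤ)) x =
        {y | ∀ b ∈ Set.Icc (-(N : ℤ), -(N : ℤ)) ((N : ℤ), (N : ℤ)), y.1 b = x.1 b} := by
      simp [cylinder, square]
    have e2 : X.shift a ⁻¹' (X.cylinder (square N : Set (ℤ × ℤ)) x) =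
        {y | ∀ b ∈ Set.Icc (a + (-(N : ℤ), -(N : ℤ))) (a + ((N : ℤ), (N : ℤ))),
          y.1 b = (X.shift (-a) x).1 b} := by
      rw [e1]
      ext y
      constructor
      · intro hy b hb
        have := hy (-a + b) ⟨by simpa [add_assoc] using add_le_add_right hb.1 (-a),
          by simpa [add_assoc] using add_le_add_right hb.2 (-a)⟩
        simpa [shift_apply] using this
      · intro hy b hb
        have := hy (a + b) ⟨add_le_add_right hb.1 a, add_le_add_right hb.2 a⟩
        simpa [shift_apply] using this
    rw [e2, e1, h1, h2]
  · rw [Measure.map_apply hm MeasurableSet.univ, Set.preimage_univ]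

end PlaneSubshift

/-! ### The natural measure -/

namespace VHDatum

open PlaneSubshift

variable {V H : Type*} {d : ℕ} {D : VHDatum V H d d}

theorem nonempty_subshift (hd : 1 ≤ d) : Nonempty D.subshift.carrier := by
  obtain ⟨a⟩ := D.nonempty_V hd
  obtain ⟨b⟩ := D.transpose.nonempty_V hd
  obtain ⟨x, hx, -⟩ := D.exists_mem_subshift ⟨fun _ => a, fun _ => (D.invV_ne a).symm⟩
    ⟨fun _ => b, fun _ => (D.invH_ne b).symm⟩
  exact ⟨⟨x, hx⟩⟩

section Existence

variable [Finite V] [Finite H]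

theorem measure_cylinder_right {μ : Measure D.subshift.carrier} {i₁ i₂ j₁ j₂ : ℤ} (hi : i₁ ≤ i₂)
    (hj : j₁ ≤ j₂) (k : ℕ) {c : ℝ≥0∞}
    (hc : ∀ x, μ (D.subshift.cylinder (Finset.Icc (i₁, j₁) (i₂ + k, j₂) : Finset (ℤ × ℤ)) x) = c)
    (x : D.subshift.carrier) :
    μ (D.subshift.cylinder (Finset.Icc (i₁, j₁) (i₂, j₂) : Finset (ℤ × ℤ)) x) =
      ((2 * d - 1 : ℕ) : ℝ≥0∞) ^ k * c := by
  induction k generalizing c with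
  | zero => simpa using hc x
  | succ k ih =>
    rw [pow_succ, mul_assoc]
    refine ih fun x => ?_
    refine measure_cylinder_of_hasExtensions (hasExtensions_right (by omega) hj ?_) (fun x => ?_) x
    · exact Finset.Icc_subset_Icc le_rfl (by simp)
    · rw [← hc x]
      push_cast
      rw [add_assoc]

theorem measure_cylinder_left {μ : Measure D.subshift.carrier} {i₁ i₂ j₁ j₂ : ℤ} (hi : i₁ ≤ i₂)
    (hj : j₁ ≤ j₂) (k : ℕ) {c : ℝ≥0∞}
    (hc : ∀ x, μ (D.subshift.cylinder (Finset.Icc (i₁ - k, j₁) (i₂, j₂) : Finset (ℤ × ℤ)) x) = c)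
    (x : D.subshift.carrier) :
    μ (D.subshift.cylinder (Finset.Icc (i₁, j₁) (i₂, j₂) : Finset (ℤ × ℤ)) x) =
      ((2 * d - 1 : ℕ) : ℝ≥0∞) ^ k * c := by
  induction k generalizing c with
  | zero => simpa using hc x
  | succ k ih =>
    rw [pow_succ, mul_assoc]
    refine ih fun x => ?_
    refine measure_cylinder_of_hasExtensions (hasExtensions_left (by omega) hj ?_) (fun x => ?_) x
    · exact Finset.Icc_subset_Icc (by simp) le_rfl
    · rw [← hc x]
      push_cast
      rw [sub_add_eq_sub_sub]

theorem measure_cylinder_up {μ : Measure D.subshift.carrier} {i₁ i₂ j₁ j₂ : ℤ} (hi : i₁ ≤ i₂)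
    (hj : j₁ ≤ j₂) (k : ℕ) {c : ℝ≥0∞}
    (hc : ∀ x, μ (D.subshift.cylinder (Finset.Icc (i₁, j₁) (i₂, j₂ + k) : Finset (ℤ × ℤ)) x) = c)
    (x : D.subshift.carrier) :
    μ (D.subshift.cylinder (Finset.Icc (i₁, j₁) (i₂, j₂) : Finset (ℤ × ℤ)) x) =
      ((2 * d - 1 : ℕ) : ℝ≥0∞) ^ k * c := by
  induction k generalizing c with
  | zero => simpa using hc x
  | succ k ih =>
    rw [pow_succ, mul_assoc]
    refine ih fun x => ?_
    refine measure_cylinder_of_hasExtensions (hasExtensions_up hi (by omega) ?_) (fun x => ?_) x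
    · exact Finset.Icc_subset_Icc le_rfl (by simp)
    · rw [← hc x]
      push_cast
      rw [add_assoc]

theorem measure_cylinder_down {μ : Measure D.subshift.carrier} {i₁ i₂ j₁ j₂ : ℤ} (hi : i₁ ≤ i₂)
    (hj : j₁ ≤ j₂) (k : ℕ) {c : ℝ≥0∞}
    (hc : ∀ x, μ (D.subshift.cylinder (Finset.Icc (i₁, j₁ - k) (i₂, j₂) : Finset (ℤ × ℤ)) x) = c)
    (x : D.subshift.carrier) :
    μ (D.subshift.cylinder (Finset.Icc (i₁, j₁) (i₂, j₂) : Finset (ℤ × ℤ)) x) =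
      ((2 * d - 1 : ℕ) : ℝ≥0∞) ^ k * c := by
  induction k generalizing c with
  | zero => simpa using hc x
  | succ k ih =>
    rw [pow_succ, mul_assoc]
    refine ih fun x => ?_
    refine measure_cylinder_of_hasExtensions (hasExtensions_down hi (by omega) ?_) (fun x => ?_) x
    · exact Finset.Icc_subset_Icc (by simp) le_rfl
    · rw [← hc x]
      push_cast
      rw [sub_add_eq_sub_sub]

/-- The rectangle is enlarged to the square in 4N - m - n steps, each multiplying the number of
patterns by q; the factor q^(m + n) on the left avoids the subtraction. -/
theorem measure_cylinder_of_square {μ : Measure D.subshift.carrier} {N : ℕ} {c : ℝ≥0∞}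
    (hc : ∀ x, μ (D.subshift.cylinder (square N : Set (ℤ × ℤ)) x) = c) {i j : ℤ} {m n : ℕ}
    (hi : -(N : ℤ) ≤ i) (hi' : i + m ≤ N) (hj : -(N : ℤ) ≤ j) (hj' : j + n ≤ N)
    (x : D.subshift.carrier) :
    ((2 * d - 1 : ℕ) : ℝ≥0∞) ^ (m + n) *
      μ (D.subshift.cylinder (Finset.Icc (i, j) (i + m, j + n) : Finset (ℤ × ℤ)) x) =
      ((2 * d - 1 : ℕ) : ℝ≥0∞) ^ (4 * N) * c := by
  have h1 := measure_cylinder_down (μ := μ) (i₁ := -(N : ℤ)) (i₂ := N) (j₁ := j) (j₂ := N)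
    (by omega) (by omega) (j + N).toNat (c := c) (fun x => by
      rw [← hc x, show j - (j + N).toNat = -(N : ℤ) by omega]; rfl)
  have h2 := measure_cylinder_up (μ := μ) (i₁ := -(N : ℤ)) (i₂ := N) (j₁ := j) (j₂ := j + n)
    (by omega) (by omega) (N - (j + n)).toNat (fun x => by
      rw [show j + n + (N - (j + n)).toNat = (N : ℤ) by omega]; exact h1 x)
  have h3 := measure_cylinder_left (μ := μ) (i₁ := i) (i₂ := N) (j₁ := j) (j₂ := j + n)
    (by omega) (by omega) (i + N).toNat (fun x => by
      rw [show i - (i + N).toNat = -(N : ℤ) by omega]; exact h2 x)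
  have h4 := measure_cylinder_right (μ := μ) (i₁ := i) (i₂ := i + m) (j₁ := j) (j₂ := j + n)
    (by omega) (by omega) (N - (i + m)).toNat (fun x => by
      rw [show i + m + (N - (i + m)).toNat = (N : ℤ) by omega]; exact h3 x) x
  rw [h4, ← mul_assoc, ← mul_assoc, ← mul_assoc, ← mul_assoc, ← pow_add, ← pow_add, ← pow_add,
    ← pow_add]
  congr 2
  omega

/-- If all the patterns on `[-N, N]²` have the same mass, then the smaller rectangles have the
masses required of the natural measure. -/
theorem measure_cylinder_eq_inv {μ : Measure D.subshift.carrier} [IsProbabilityMeasure μ] {N : ℕ}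
    {c : ℝ≥0∞} (hc : ∀ x, μ (D.subshift.cylinder (square N : Set (ℤ × ℤ)) x) = c) {i j : ℤ} {m n : ℕ}
    (hi : -(N : ℤ) ≤ i) (hi' : i + m ≤ N) (hj : -(N : ℤ) ≤ j) (hj' : j + n ≤ N)
    (x : D.subshift.carrier) :
    μ (D.subshift.cylinder (Finset.Icc (i, j) (i + m, j + n) : Finset (ℤ × ℤ)) x) =
      ((D.subshift.symbolCount * (2 * d - 1) ^ m * (2 * d - 1) ^ n : ℕ) : ℝ≥0∞)⁻¹ := by
  have h0 : ∀ x, μ (D.subshift.cylinder (Finset.Icc (0 : ℤ × ℤ) 0 : Finset (ℤ × ℤ)) x) =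
      ((2 * d - 1 : ℕ) : ℝ≥0∞) ^ (4 * N) * c := fun x => by
    have := measure_cylinder_of_square hc (i := 0) (j := 0) (m := 0) (n := 0) (by omega)
      (by simp) (by omega) (by simp) x
    rw [add_zero, pow_zero, one_mul] at this
    exact this
  -- The empty pattern has mass 1 and `symbolCount` extensions to a single cell, which fixes the
  -- normalization.
  have h1 := measure_cylinder_of_hasExtensions hasExtensions_singleton h0 x
  have h2 : D.subshift.cylinder ((∅ : Finset (ℤ × ℤ)) : Set (ℤ × ℤ)) x = Set.univ := by
    ext
    simp [PlaneSubshift.mem_cylinder]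
  rw [h2, measure_univ] at h1
  refine ENNReal.eq_inv_of_mul_eq_one_left ?_
  rw [mul_comm, h1, ← measure_cylinder_of_square hc hi hi' hj hj' x, ← mul_assoc, pow_add]
  push_cast
  ring

/-- The average of point masses, one at a chosen point for each pattern on the square. -/
theorem exists_measure_square (hd : 1 ≤ d) (N : ℕ) :
    ∃ μ : ProbabilityMeasure D.subshift.carrier, ∃ c, ∀ x,
      (μ : Measure D.subshift.carrier) (D.subshift.cylinder (square N : Set (ℤ × ℤ)) x) = c := by
  classical
  have := nonempty_subshift (D := D) hd
  let r : D.subshift.carrier → (square N → D.Tile) := fun x b => x.1 b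
  have hfin : Fintype (Set.range r) := Fintype.ofFinite _
  have hne : Nonempty (Set.range r) := (Set.range_nonempty r).to_subtype
  choose s hs using fun p : Set.range r => p.2
  have hcard : (Fintype.card (Set.range r) : ℝ≥0∞) ≠ 0 := by exact_mod_cast Fintype.card_ne_zero
  have hcard' : (Fintype.card (Set.range r) : ℝ≥0∞) ≠ ⊤ := ENNReal.natCast_ne_top _
  refine ⟨⟨(Fintype.card (Set.range r) : ℝ≥0∞)⁻¹ • ∑ p, Measure.dirac (s p), ⟨?_⟩⟩,
    (Fintype.card (Set.range r) : ℝ≥0∞)⁻¹, fun x => ?_⟩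
  · simp only [Measure.smul_apply, Measure.finsetSum_apply, measure_univ, Finset.sum_const,
      Finset.card_univ, nsmul_eq_mul, mul_one, smul_eq_mul]
    exact ENNReal.inv_mul_cancel hcard hcard'
  · have hm : MeasurableSet (D.subshift.cylinder (square N : Set (ℤ × ℤ)) x) :=
      (isClopen_cylinder _ _).isOpen.measurableSet
    simp only [ProbabilityMeasure.coe_mk, Measure.smul_apply, Measure.finsetSum_apply,
      Measure.dirac_apply' _ hm, smul_eq_mul]
    rw [Finset.sum_eq_single ⟨r x, Set.mem_range_self x⟩]
    · rw [Set.indicator_of_mem, Pi.one_apply, mul_one]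
      intro b hb
      exact congrFun (hs ⟨r x, Set.mem_range_self x⟩) ⟨b, hb⟩
    · intro p _ hp
      refine Set.indicator_of_notMem (fun h => hp (Subtype.ext ?_)) _
      rw [← hs p]
      exact funext fun b => h b b.2
    · simp

/-- The probability measures on the compact space X_D are weakly compact, so the measures uniform on
larger and larger squares have a limit along an ultrafilter. Cylinders are clopen, hence their
masses converge. -/
theorem exists_isNaturalMeasure (hd : 1 ≤ d) :
    ∃ μ : Measure D.subshift.carrier, D.subshift.IsNaturalMeasure (2 * d - 1) μ := by
  choose P c hP using exists_measure_square (D := D) hd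
  obtain ⟨μ, -, hμ⟩ := isCompact_univ.ultrafilter_le_nhds ((hyperfilter ℕ).map P) (by simp)
  have hlim : Tendsto P (hyperfilter ℕ) (nhds μ) := hμ
  refine ⟨μ, inferInstance, fun a m n x => ?_⟩
  have e : {y : D.subshift.carrier | ∀ b ∈ Set.Icc a (a + ((m : ℤ), (n : ℤ))), y.1 b = x.1 b} =
      D.subshift.cylinder (Finset.Icc (a.1, a.2) (a.1 + m, a.2 + n) : Finset (ℤ × ℤ)) x := by
    rw [Finset.coe_Icc]
    rfl
  rw [e]
  have h1 := ProbabilityMeasure.tendsto_measure_of_isClopen_of_tendsto hlim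
    (isClopen_cylinder (Finset.Icc (a.1, a.2) (a.1 + m, a.2 + n)) x)
  have h2 := (ENNReal.tendsto_coe.2 h1)
  simp only [ProbabilityMeasure.ennreal_coeFn_eq_coeFn_toMeasure] at h2
  -- Once [-N, N]² contains the rectangle, the mass is exactly the required one, so the sequence is
  -- eventually constant.
  refine tendsto_nhds_unique h2 (tendsto_const_nhds.congr' ?_)
  have h3 : ∀ᶠ N : ℕ in hyperfilter ℕ, a.1.natAbs + m + a.2.natAbs + n ≤ N :=
    Filter.Eventually.filter_mono (Nat.hyperfilter_le_atTop) (eventually_ge_atTop _)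
  filter_upwards [h3] with N hN
  exact (measure_cylinder_eq_inv (hP N) (by omega) (by omega) (by omega) (by omega) x).symm

end Existence

/-! ### Integration along a rectangle -/

/-- The vertical word of length `K` starting at `a`. -/
def colWord (a : ℤ × ℤ) (K : ℕ) (x : D.subshift.carrier) : ReducedWord D.invV K :=
  ⟨List.ofFn fun j : Fin K => (x.1 (a.1, a.2 + (j : ℕ))).left, List.length_ofFn,
    List.isChain_ofFn.2 fun j _ => by
      have := left_ne_of_mem x.2 a.1 (a.2 + j)
      rw [add_assoc] at this
      exact_mod_cast this⟩

/-- The horizontal word of length `N` starting at `a`. -/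
def rowWord (a : ℤ × ℤ) (N : ℕ) (x : D.subshift.carrier) : ReducedWord D.invH N :=
  ⟨List.ofFn fun i : Fin N => (x.1 (a.1 + (i : ℕ), a.2)).bottom, List.length_ofFn,
    List.isChain_ofFn.2 fun i _ => by
      have := bottom_ne_of_mem x.2 (a.1 + i) a.2
      rw [add_assoc] at this
      exact_mod_cast this⟩

theorem eqOn_Icc_iff_colWord_rowWord (a : ℤ × ℤ) (m n : ℕ) (x y : D.subshift.carrier) :
    (∀ b ∈ Set.Icc a (a + ((m : ℤ), (n : ℤ))), y.1 b = x.1 b) ↔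
      colWord a (n + 1) y = colWord a (n + 1) x ∧ rowWord a (m + 1) y = rowWord a (m + 1) x := by
  constructor
  · intro h
    refine ⟨Subtype.ext (List.ofFn_inj.2 (funext fun j => ?_)),
      Subtype.ext (List.ofFn_inj.2 (funext fun i => ?_))⟩
    · rw [h]
      have := j.2
      simp [Prod.le_def]
      omega
    · rw [h]
      have := i.2
      simp [Prod.le_def]
      omega
  · rintro ⟨hc, hr⟩ b hb
    have hc' := List.ofFn_inj.1 (congrArg Subtype.val hc)
    have hr' := List.ofFn_inj.1 (congrArg Subtype.val hr)
    simp only [Set.mem_Icc, Prod.le_def, Prod.fst_add, Prod.snd_add] at hb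
    refine eq_of_axes_eq (i := b.1) (j := b.2) y.2 x.2 (i₀ := a.1) (j₀ := a.2) (i₁ := a.1)
      (j₁ := a.2) (i₂ := a.1 + m) (j₂ := a.2 + n) le_rfl (by omega) le_rfl (by omega)
      (fun j h h' => ?_) (fun i h h' => ?_) hb.1.1 hb.2.1 hb.1.2 hb.2.2
    · have := congrFun hc' ⟨(j - a.2).toNat, by omega⟩
      simp only [show a.2 + ((j - a.2).toNat : ℤ) = j by omega] at this
      exact this
    · have := congrFun hr' ⟨(i - a.1).toNat, by omega⟩
      simp only [show a.1 + ((i - a.1).toNat : ℤ) = i by omega] at this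
      exact this

theorem exists_colWord_rowWord_eq (a : ℤ × ℤ) {K N : ℕ} (hK : 1 ≤ K) (hN : 1 ≤ N)
    (w : ReducedWord D.invV K) (c : ReducedWord D.invH N) :
    ∃ x : D.subshift.carrier, colWord a K x = w ∧ rowWord a N x = c := by
  obtain ⟨α, hα⟩ := w.exists_biWord D.invV_ne hK a.2
  obtain ⟨β, hβ⟩ := c.exists_biWord D.invH_ne hN a.1
  obtain ⟨x, hx, hl, hb⟩ := D.exists_mem_subshift_base a α β
  refine ⟨⟨x, hx⟩, Subtype.ext ?_, Subtype.ext ?_⟩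
  · refine List.ext_getElem (by simp [colWord, w.2.1]) fun j h h' => ?_
    simp only [colWord, List.getElem_ofFn]
    rw [hl, hα j h']
  · refine List.ext_getElem (by simp [rowWord, c.2.1]) fun j h h' => ?_
    simp only [rowWord, List.getElem_ofFn]
    rw [hb, hβ j h']

theorem isLocallyConstant_colWord (a : ℤ × ℤ) (K : ℕ) :
    IsLocallyConstant (colWord (D := D) a K) := by
  refine (IsLocallyConstant.iff_exists_open _).2 fun x => ?_
  refine ⟨_, (isClopen_cylinder (Finset.Icc a (a + (((0 : ℕ) : ℤ), (K : ℤ)))) x).isOpen,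
    fun _ _ => rfl, fun y hy => Subtype.ext (List.ofFn_inj.2 (funext fun j => ?_))⟩
  rw [hy]
  simp [Prod.le_def]

theorem isLocallyConstant_rowWord (a : ℤ × ℤ) (N : ℕ) :
    IsLocallyConstant (rowWord (D := D) a N) := by
  refine (IsLocallyConstant.iff_exists_open _).2 fun x => ?_
  refine ⟨_, (isClopen_cylinder (Finset.Icc a (a + ((N : ℤ), ((0 : ℕ) : ℤ)))) x).isOpen,
    fun _ _ => rfl, fun y hy => Subtype.ext (List.ofFn_inj.2 (funext fun j => ?_))⟩
  rw [hy]
  simp [Prod.le_def]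

/-- The integral of a function of the left and the bottom edges of a rectangle. -/
theorem integral_colWord_rowWord [Finite V] [Finite H] {μ : Measure D.subshift.carrier}
    (hμ : D.subshift.IsNaturalMeasure (2 * d - 1) μ) (a : ℤ × ℤ) {K N : ℕ} (hK : 1 ≤ K)
    (hN : 1 ≤ N) (Φ : ReducedWord D.invV K → ReducedWord D.invH N → ℂ) :
    ∫ x, Φ (colWord a K x) (rowWord a N x) ∂μ =
      ((D.subshift.symbolCount * (2 * d - 1) ^ (N - 1) * (2 * d - 1) ^ (K - 1) : ℕ) : ℂ)⁻¹ *
        ∑ w, ∑ c, Φ w c := by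
  classical
  have := hμ.1
  let _ : MeasurableSpace (ReducedWord D.invV K × ReducedWord D.invH N) := ⊤
  let _ : TopologicalSpace (ReducedWord D.invV K × ReducedWord D.invH N) := ⊥
  have : DiscreteTopology (ReducedWord D.invV K × ReducedWord D.invH N) := ⟨rfl⟩
  have : BorelSpace (ReducedWord D.invV K × ReducedWord D.invH N) :=
    ⟨borel_eq_top_of_discrete.symm⟩
  let π : D.subshift.carrier → ReducedWord D.invV K × ReducedWord D.invH N :=
    fun x => (colWord a K x, rowWord a N x)
  have hπ : Measurable π :=
    ((isLocallyConstant_colWord a K).prodMk (isLocallyConstant_rowWord a N)).continuous.measurable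
  have : IsProbabilityMeasure (μ.map π) := Measure.isProbabilityMeasure_map hπ.aemeasurable
  have h1 : ∫ x, Φ (colWord a K x) (rowWord a N x) ∂μ = ∫ p, Φ p.1 p.2 ∂(μ.map π) :=
    (integral_map hπ.aemeasurable (f := fun p => Φ p.1 p.2)
      (measurable_from_top.aestronglyMeasurable)).symm
  rw [h1, integral_fintype (Integrable.of_finite), Fintype.sum_prod_type, Finset.mul_sum]
  refine Finset.sum_congr rfl fun w _ => ?_
  rw [Finset.mul_sum]
  refine Finset.sum_congr rfl fun c _ => ?_
  obtain ⟨x, rfl, rfl⟩ := exists_colWord_rowWord_eq a hK hN w c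
  have h2 : (μ.map π) {(colWord a K x, rowWord a N x)} =
      ((D.subshift.symbolCount * (2 * d - 1) ^ (N - 1) * (2 * d - 1) ^ (K - 1) : ℕ) : ℝ≥0∞)⁻¹ := by
    rw [Measure.map_apply hπ (MeasurableSpace.measurableSet_top), ← hμ.2 a (N - 1) (K - 1) x]
    congr 1
    ext y
    rw [Set.mem_ofPred_eq, eqOn_Icc_iff_colWord_rowWord]
    obtain ⟨K, rfl⟩ : ∃ K', K = K' + 1 := ⟨K - 1, by omega⟩
    obtain ⟨N, rfl⟩ : ∃ N', N = N' + 1 := ⟨N - 1, by omega⟩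
    simp [π]
  rw [measureReal_def, h2, ENNReal.toReal_inv, ENNReal.toReal_natCast, ← Complex.coe_smul]
  simp

end VHDatum

/-! ### Sums over reduced words -/

section FollowSum

variable {T : Type*} [Fintype T] (i : T → T)

open Classical in
/-- The sum of `φ` over the words `l` of length `n` such that `t l` is reduced. -/
noncomputable def followSum : ℕ → T → (List T → ℂ) → ℂ
  | 0, _, φ => φ []
  | n + 1, t, φ => ∑ u with u ≠ i t, followSum n u fun l => φ (u :: l)

theorem followSum_zero (t : T) (φ : List T → ℂ) : followSum i 0 t φ = φ [] := rfl

open Classical in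
theorem followSum_succ (n : ℕ) (t : T) (φ : List T → ℂ) :
    followSum i (n + 1) t φ = ∑ u with u ≠ i t, followSum i n u fun l => φ (u :: l) := rfl

theorem followSum_congr {n : ℕ} {t : T} {φ ψ : List T → ℂ}
    (h : ∀ l : List T, l.length = n → φ l = ψ l) : followSum i n t φ = followSum i n t ψ := by
  induction n generalizing t φ ψ with
  | zero => exact h [] rfl
  | succ n ih =>
    rw [followSum_succ, followSum_succ]
    exact Finset.sum_congr rfl fun u _ => ih fun l hl => h _ (by simp [hl])

/-- The second word must be compatible with the last letter of the first, and with t itself when the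
first word is empty; this is the default in `getLastD`. -/
theorem followSum_add (m n : ℕ) (t : T) (φ : List T → ℂ) :
    followSum i (m + n) t φ =
      followSum i m t fun l => followSum i n (l.getLastD t) fun l' => φ (l ++ l') := by
  induction m generalizing t φ with
  | zero => simp [followSum_zero]
  | succ m ih =>
    rw [Nat.add_right_comm, followSum_succ, followSum_succ]
    exact Finset.sum_congr rfl fun u _ => by
      simp only [ih, List.getLastD_cons, List.cons_append]

theorem followSum_mul_left (n : ℕ) (t : T) (c : ℂ) (φ : List T → ℂ) :
    followSum i n t (fun l => c * φ l) = c * followSum i n t φ := by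
  induction n generalizing t φ with
  | zero => rfl
  | succ n ih => simp only [followSum_succ, ih, Finset.mul_sum]

theorem norm_followSum_le (n : ℕ) (t : T) {φ : List T → ℂ} {c : ℝ} (hc : 0 ≤ c)
    (h : ∀ l, ‖φ l‖ ≤ c) : ‖followSum i n t φ‖ ≤ Fintype.card T ^ n * c := by
  induction n generalizing t φ with
  | zero => simpa [followSum_zero] using h []
  | succ n ih =>
    rw [followSum_succ]
    refine (norm_sum_le _ _).trans ?_
    refine (Finset.sum_le_sum fun u _ => ih u fun l => h _).trans ?_
    rw [Finset.sum_const, nsmul_eq_mul, pow_succ', mul_assoc]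
    gcongr
    exact Finset.card_le_univ _

theorem card_filter_ne (t : T) [DecidableEq T] :
    (Finset.univ.filter fun u => u ≠ t).card = Fintype.card T - 1 := by
  rw [Finset.filter_ne', Finset.card_erase_of_mem (Finset.mem_univ _), Finset.card_univ]

theorem followSum_one (n : ℕ) (t : T) :
    followSum i n t (fun _ => 1) = ((Fintype.card T - 1 : ℕ) : ℂ) ^ n := by
  classical
  induction n generalizing t with
  | zero => simp [followSum_zero]
  | succ n ih =>
    simp only [followSum_succ, ih, Finset.sum_const, nsmul_eq_mul]
    rw [pow_succ']
    congr 2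
    convert card_filter_ne (i t)

/-- Words that can follow a letter. -/
def Follow (n : ℕ) (t : T) : Type _ :=
  {l : List T // l.length = n ∧ (t :: l).IsChain (fun x y => y ≠ i x)}

instance (n : ℕ) (t : T) : Finite (Follow i n t) :=
  ((List.finite_length_eq T n).subset fun _ h => h.1).to_subtype

noncomputable instance (n : ℕ) (t : T) : Fintype (Follow i n t) := Fintype.ofFinite _

/-- The first letter of a nonempty word that can follow `t`. -/
def followEquiv (n : ℕ) (t : T) :
    Follow i (n + 1) t ≃ Σ u : {u // u ≠ i t}, Follow i n u.1 where
  toFun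
    | ⟨[], h⟩ => absurd h.1 (by simp)
    | ⟨u :: l, h⟩ => ⟨⟨u, (List.isChain_cons_cons.1 h.2).1⟩, ⟨l, by simpa using h.1,
        (List.isChain_cons_cons.1 h.2).2⟩⟩
  invFun p := ⟨p.1.1 :: p.2.1, by simp [p.2.2.1], List.isChain_cons_cons.2 ⟨p.1.2, p.2.2.2⟩⟩
  left_inv
    | ⟨[], h⟩ => absurd h.1 (by simp)
    | ⟨u :: l, h⟩ => rfl
  right_inv _ := rfl

/-- The first letter of a nonempty reduced word. -/
def reducedWordEquiv (n : ℕ) : ReducedWord i (n + 1) ≃ Σ u : T, Follow i n u where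
  toFun
    | ⟨[], h⟩ => absurd h.1 (by simp)
    | ⟨u :: l, h⟩ => ⟨u, ⟨l, by simpa using h.1, h.2⟩⟩
  invFun p := ⟨p.1 :: p.2.1, by simp [p.2.2.1], p.2.2.2⟩
  left_inv
    | ⟨[], h⟩ => absurd h.1 (by simp)
    | ⟨u :: l, h⟩ => rfl
  right_inv _ := rfl

theorem followSum_eq_sum (n : ℕ) (t : T) (φ : List T → ℂ) :
    followSum i n t φ = ∑ l : Follow i n t, φ l.1 := by
  classical
  induction n generalizing t φ with
  | zero =>
    have : Unique (Follow i 0 t) :=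
      ⟨⟨⟨[], rfl, List.isChain_singleton _⟩⟩, fun l =>
        Subtype.ext (List.length_eq_zero_iff.1 l.2.1)⟩
    rw [Fintype.sum_unique, followSum_zero, List.length_eq_zero_iff.1 (default : Follow i 0 t).2.1]
  | succ n ih =>
    rw [← (followEquiv i n t).symm.sum_comp, Fintype.sum_sigma, followSum_succ]
    simp only [ih]
    rw [Finset.sum_subtype (p := fun u => u ≠ i t) _ (by simp)]
    rfl

theorem sum_reducedWord (n : ℕ) (φ : List T → ℂ) :
    ∑ w : ReducedWord i (n + 1), φ w.1 = ∑ t, followSum i n t fun l => φ (t :: l) := by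
  rw [← (reducedWordEquiv i n).symm.sum_comp, Fintype.sum_sigma]
  simp only [followSum_eq_sum]
  rfl

end FollowSum

/-! ### Sliding vertical words along horizontal words. -/

namespace VHDatum

open PlaneSubshift

variable {V H : Type*} {d : ℕ} (D : VHDatum V H d d)

/-- Sliding a vertical word along a horizontal letter. -/
noncomputable def slidePerm (K : ℕ) (h : H) : Equiv.Perm (ReducedWord D.invV K) :=
  D.colTransducer.actWord K (D.invH h)

theorem slidePerm_val (K : ℕ) (h : H) (w : ReducedWord D.invV K) :
    (D.slidePerm K h w).1 = D.colTransducer.act (D.invH h) w.1 := rfl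

theorem slidePerm_inv (K : ℕ) (h : H) : D.slidePerm K (D.invH h) = (D.slidePerm K h)⁻¹ :=
  D.colTransducer.actWord_j K (D.invH h)

/-- The operator on functions of vertical words given by sliding along a horizontal letter. -/
noncomputable def slide (K : ℕ) (h : H) :
    (ReducedWord D.invV K → ℂ) →ₗ[ℂ] (ReducedWord D.invV K → ℂ) :=
  LinearMap.funLeft ℂ ℂ (D.slidePerm K h)

theorem slide_apply (K : ℕ) (h : H) (v : ReducedWord D.invV K → ℂ) (w : ReducedWord D.invV K) :
    D.slide K h v w = v (D.slidePerm K h w) := rfl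

theorem slide_slide (K : ℕ) (h : H) (v : ReducedWord D.invV K → ℂ) :
    D.slide K h (D.slide K (D.invH h) v) = v := by
  funext w
  simp [slide_apply, slidePerm_inv]

/-- Sliding a vertical word along a horizontal word. -/
noncomputable def move (K : ℕ) : List H → ReducedWord D.invV K → ReducedWord D.invV K
  | [], w => w
  | h :: l, w => move K l (D.slidePerm K h w)

theorem move_cons (K : ℕ) (h : H) (l : List H) (w : ReducedWord D.invV K) :
    D.move K (h :: l) w = D.move K l (D.slidePerm K h w) := rfl

theorem move_append (K : ℕ) (l l' : List H) (w : ReducedWord D.invV K) :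
    D.move K (l ++ l') w = D.move K l' (D.move K l w) := by
  induction l generalizing w with
  | nil => rfl
  | cons h l ih => simp only [List.cons_append, move_cons, ih]

theorem bijective_move (K : ℕ) (l : List H) : Function.Bijective (D.move K l) := by
  induction l with
  | nil => exact Function.bijective_id
  | cons h l ih => exact ih.comp (D.slidePerm K h).bijective

/-- The bridge between configurations and operators: each factor T sums over the admissible next
letters and slides the vertical word along the letter chosen. -/
theorem followSum_move [Fintype H] (K n : ℕ) (F : H → ReducedWord D.invV K → ℂ) (h : H)
    (w : ReducedWord D.invV K) :
    followSum D.invH n h (fun l => F (l.getLastD h) (D.move K l w)) =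
      (nonBacktracking D.invH (D.slide K) ^ n) F h w := by
  classical
  induction n generalizing h w with
  | zero => rfl
  | succ n ih =>
    rw [followSum_succ, pow_succ', Module.End.mul_apply, nonBacktracking_apply_eq_sum,
      Finset.sum_apply]
    refine Finset.sum_congr (by ext; simp) fun u _ => ?_
    rw [slide_apply, ← ih]
    simp only [move_cons, List.getLastD_cons]

variable {D}

/-- The transducer reads right edges and writes left edges. Crossing a column of tiles from left to
right therefore means acting by the inverse of its bottom letter, which explains the inversion in
`slidePerm`. -/
theorem act_ofFn_left (x : D.subshift.carrier) (i j : ℤ) (K : ℕ) :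
    D.colTransducer.act (D.invH (x.1 (i, j)).bottom)
        (List.ofFn fun k : Fin K => (x.1 (i, j + (k : ℕ))).left) =
      List.ofFn fun k : Fin K => (x.1 (i + 1, j + (k : ℕ))).left := by
  induction K generalizing j with
  | zero => rfl
  | succ K ih =>
    have h1 := D.eq_tileBR (D.flipH (x.1 (i, j)))
    have h2 : D.colTransducer.out (D.invH (x.1 (i, j)).bottom) (x.1 (i, j)).left =
        (x.1 (i + 1, j)).left := (congrArg Tile.left h1).trans (isRow_of_mem x.2 j i)
    have h3 : D.colTransducer.next (D.invH (x.1 (i, j)).bottom) (x.1 (i, j)).left =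
        D.invH (x.1 (i, j + 1)).bottom :=
      (congrArg Tile.top h1).trans (congrArg D.invH (top_eq_of_mem x.2 i j))
    rw [List.ofFn_succ, List.ofFn_succ, Transducer.act_cons]
    have h4 := ih (j + 1)
    simp only [Fin.val_zero, Nat.cast_zero, add_zero, h2, h3, Fin.val_succ, Nat.cast_add,
      Nat.cast_one]
    simp only [add_assoc, add_comm (1 : ℤ)] at h4 ⊢
    rw [h4]

theorem colWord_add_one (a : ℤ × ℤ) (K : ℕ) (x : D.subshift.carrier) :
    colWord (a + (1, 0)) K x = D.slidePerm K (x.1 a).bottom (colWord a K x) := by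
  refine Subtype.ext ?_
  have := act_ofFn_left x a.1 a.2 K
  rw [slidePerm_val]
  simp only [colWord, Prod.fst_add, Prod.snd_add, add_zero]
  exact this.symm

theorem colWord_add (a : ℤ × ℤ) (K n : ℕ) (x : D.subshift.carrier) :
    colWord (a + ((n : ℤ), 0)) K x = D.move K (rowWord a n x).1 (colWord a K x) := by
  induction n generalizing a with
  | zero =>
    have : a + (((0 : ℕ) : ℤ), 0) = a := by ext <;> simp
    rw [this]
    rfl
  | succ n ih =>
    have e : a + (((n + 1 : ℕ) : ℤ), 0) = a + (1, 0) + ((n : ℤ), 0) := by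
      ext <;> push_cast <;> simp
      ring
    have e2 : (rowWord a (n + 1) x).1 = (x.1 a).bottom :: (rowWord (a + (1, 0)) n x).1 := by
      simp only [rowWord, List.ofFn_succ, Fin.val_zero, Nat.cast_zero, add_zero, Fin.val_succ,
        Nat.cast_add, Nat.cast_one, Prod.fst_add, Prod.snd_add, add_assoc, add_comm (1 : ℤ)]
    rw [e, ih, colWord_add_one, e2, move_cons]

theorem rowWord_take (a : ℤ × ℤ) {m n : ℕ} (h : m ≤ n) (x : D.subshift.carrier) :
    (rowWord a n x).1.take m = (rowWord a m x).1 := by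
  refine List.ext_getElem (by simp [rowWord, h]) fun k _ _ => ?_
  simp [rowWord]

theorem rowWord_drop (a : ℤ × ℤ) (m n : ℕ) (x : D.subshift.carrier) :
    (rowWord a (m + n) x).1.drop m = (rowWord (a + ((m : ℤ), 0)) n x).1 := by
  refine List.ext_getElem (by simp [rowWord]) fun k _ _ => ?_
  simp [rowWord, add_assoc]

variable [Fintype V] [Fintype H]

/-- The integral over a rectangle as a sum over its left and bottom words. -/
theorem integral_eq_followSum {μ : Measure D.subshift.carrier}
    (hμ : D.subshift.IsNaturalMeasure (2 * d - 1) μ) (a : ℤ × ℤ) {K : ℕ} (hK : 1 ≤ K) (N : ℕ)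
    (Φ : ReducedWord D.invV K → List H → ℂ) :
    ∫ x, Φ (colWord a K x) (rowWord a (N + 1) x).1 ∂μ =
      ((Fintype.card (ReducedWord D.invV K) : ℂ) * (2 * d) * (2 * d - 1 : ℕ) ^ N)⁻¹ *
        ∑ w, ∑ h, followSum D.invH N h fun l => Φ w (h :: l) := by
  have := hμ.1
  have hH : Fintype.card H = 2 * d := by rw [← Nat.card_eq_fintype_card, D.card_H]
  have h1 := integral_colWord_rowWord hμ a hK (N := N + 1) (by omega) fun w c => Φ w c.1
  -- The constant function 1 has integral 1; this identifies the normalizing constant without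
  -- computing `symbolCount`.
  have h2 := integral_colWord_rowWord hμ a hK (N := N + 1) (by omega) fun w c => 1
  simp only [sum_reducedWord] at h1
  have h3 : ∀ c : ReducedWord D.invH (N + 1), (1 : ℂ) = (fun _ => 1) c.1 := fun _ => rfl
  rw [h1]
  congr 1
  have h4 : ∑ c : ReducedWord D.invH (N + 1), (1 : ℂ) = 2 * d * (2 * d - 1 : ℕ) ^ N := by
    rw [sum_reducedWord D.invH N (fun _ => 1)]
    simp [followSum_one, hH]
  rw [h4] at h2
  simp only [integral_const, probReal_univ, one_smul, Finset.sum_const, Finset.card_univ,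
    nsmul_eq_mul] at h2
  refine eq_inv_of_mul_eq_one_left ?_
  rw [mul_assoc (Fintype.card (ReducedWord D.invV K) : ℂ)]
  exact h2.symm

end VHDatum

/-! ### Non-backtracking walks on graphs with a spectral gap -/

section MeanZero

variable {S Ω : Type*} [Fintype S] [Fintype Ω]

/-- The functions of mean zero. -/
def meanZero (Ω : Type*) [Fintype Ω] : Submodule ℂ (EuclideanSpace ℂ Ω) where
  carrier := {v | ∑ w, v w = 0}
  add_mem' {v v'} hv hv' := by
    rw [Set.mem_ofPred_eq] at *
    simp [Finset.sum_add_distrib, hv, hv']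
  zero_mem' := by simp
  smul_mem' c v hv := by
    rw [Set.mem_ofPred_eq] at *
    simp [← Finset.mul_sum, hv]

/-- The Hilbert space of the functions of mean zero. -/
def MeanZero (Ω : Type*) [Fintype Ω] : Type _ := meanZero Ω

noncomputable instance : NormedAddCommGroup (MeanZero Ω) :=
  inferInstanceAs (NormedAddCommGroup (meanZero Ω))

noncomputable instance : InnerProductSpace ℂ (MeanZero Ω) :=
  inferInstanceAs (InnerProductSpace ℂ (meanZero Ω))

instance : FiniteDimensional ℂ (MeanZero Ω) :=
  inferInstanceAs (FiniteDimensional ℂ (meanZero Ω))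

/-- The value of a function of mean zero. -/
noncomputable def MeanZero.eval (w : Ω) : MeanZero Ω →ₗ[ℂ] ℂ :=
  (EuclideanSpace.proj (𝕜 := ℂ) w).toLinearMap ∘ₗ (meanZero Ω).subtype

theorem MeanZero.ext {v v' : MeanZero Ω} (h : ∀ w, MeanZero.eval w v = MeanZero.eval w v') :
    v = v' :=
  Subtype.ext (PiLp.ext h)

theorem MeanZero.sum_eval (v : MeanZero Ω) : ∑ w, MeanZero.eval w v = 0 := v.2

theorem MeanZero.norm_eq (v : MeanZero Ω) : ‖v‖ = √(∑ w, ‖MeanZero.eval w v‖ ^ 2) :=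
  EuclideanSpace.norm_eq v.1

theorem MeanZero.exists_eval_eq (F : Ω → ℂ) (h : ∑ w, F w = 0) :
    ∃ v : MeanZero Ω, ∀ w, MeanZero.eval w v = F w :=
  ⟨⟨WithLp.toLp 2 F, h⟩, fun _ => rfl⟩

/-- A permutation acting on functions. -/
noncomputable def permIsometry (σ : Equiv.Perm Ω) :
    EuclideanSpace ℂ Ω ≃ₗᵢ[ℂ] EuclideanSpace ℂ Ω :=
  LinearIsometryEquiv.piLpCongrLeft 2 ℂ ℂ σ.symm

/-- A permutation acting on functions of mean zero. -/
noncomputable def permMeanZero (σ : Equiv.Perm Ω) : MeanZero Ω →ₗ[ℂ] MeanZero Ω :=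
  ((permIsometry σ).toLinearEquiv.toLinearMap.restrict fun v hv =>
    (Equiv.sum_comp σ fun w => v w).trans hv : meanZero Ω →ₗ[ℂ] meanZero Ω)

theorem permMeanZero_apply (σ : Equiv.Perm Ω) (v : MeanZero Ω) (w : Ω) :
    MeanZero.eval w (permMeanZero σ v) = MeanZero.eval (σ w) v := rfl

theorem norm_permMeanZero (σ : Equiv.Perm Ω) (v : MeanZero Ω) : ‖permMeanZero σ v‖ = ‖v‖ :=
  (permIsometry σ).norm_map v.1

theorem nonBacktracking_pow_permMeanZero (i : S → S) (U : S → Equiv.Perm Ω) (n : ℕ)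
    (F : S → MeanZero Ω) (h : S) (w : Ω) :
    MeanZero.eval w ((nonBacktracking i (fun s => permMeanZero (U s)) ^ n) F h) =
      (nonBacktracking i (fun s => LinearMap.funLeft ℂ ℂ (U s)) ^ n)
        (fun s w => MeanZero.eval w (F s)) h w := by
  induction n generalizing F with
  | zero => rfl
  | succ n ih =>
    rw [pow_succ, pow_succ, Module.End.mul_apply, Module.End.mul_apply, ih]
    refine congrArg (fun G => (nonBacktracking i (fun s => LinearMap.funLeft ℂ ℂ (U s)) ^ n) G h w)
      (funext fun s => funext fun w => ?_)
    simp [nonBacktracking_apply, letterSum_apply, backtrack_apply, permMeanZero_apply,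
      LinearMap.funLeft_apply]

namespace LoopMultigraph

/-- The real and the imaginary part satisfy the same real eigenvalue equation, and one of them is
nonzero. -/
theorem HasSpectralGap.abs_le_of_complex {U : S → Equiv.Perm Ω} {d : ℕ} (hU : HasSpectralGap U d)
    {ev : ℝ} {v : MeanZero Ω} (hv : v ≠ 0)
    (h : ∑ s, permMeanZero (U s) v = (ev : ℂ) • v) : |ev| ≤ 2 * √(2 * d - 1) := by
  have hsum : ∀ w, ∑ s, MeanZero.eval (U s w) v = ev * MeanZero.eval w v := by
    intro w
    have := congrArg (MeanZero.eval w) h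
    simpa [permMeanZero_apply] using this
  have hmean : ∑ w, MeanZero.eval w v = 0 := v.sum_eval
  by_cases hre : (fun w => (MeanZero.eval w v).re) = 0
  · have him : (fun w => (MeanZero.eval w v).im) ≠ 0 := by
      intro him
      refine hv (MeanZero.ext fun w => ?_)
      rw [map_zero]
      exact Complex.ext (congrFun hre w) (congrFun him w)
    refine (hU _ ev him ?_ fun w => ?_).1
    · simpa using congrArg Complex.im hmean
    · simpa using congrArg Complex.im (hsum w)
  · refine (hU _ ev hre ?_ fun w => ?_).1
    · simpa using congrArg Complex.re hmean
    · simpa using congrArg Complex.re (hsum w)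

theorem HasSpectralGap.norm_pow_le {i : S → S} {U : S → Equiv.Perm Ω} {d : ℕ}
    (hgap : HasSpectralGap U d) (hi : ∀ s, i (i s) = s)
    (hU : ∀ s, U (i s) = (U s)⁻¹) (hd : 1 ≤ d) (hS : Fintype.card S = 2 * d)
    (n : ℕ) (G : S → MeanZero Ω) :
    ‖(nonBacktracking i (fun s => permMeanZero (U s)) ^ n) G‖ ≤
      (2 * d - 1 + 1 : ℝ) * (7 * (2 * d - 1) + 1) * (n + 1) ^ 3 * √(2 * d - 1) ^ n * ‖G‖ := by
  have hd' : (1 : ℝ) ≤ d := by exact_mod_cast hd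
  have h1 : ∀ s (v : MeanZero Ω), permMeanZero (U s) (permMeanZero (U (i s)) v) = v :=
    fun s v => MeanZero.ext (fun w => by
      simp [permMeanZero_apply, hU])
  have h2 : (Fintype.card S : ℝ) = (2 * d - 1 : ℝ) + 1 := by rw [hS]; push_cast; ring
  have h3 : (1 : ℝ) ≤ 2 * d - 1 := by linarith
  exact norm_nonBacktracking_pow_le hi h1 (fun s => norm_permMeanZero (U s)) h3 h2
    (fun ev v hv he => hgap.abs_le_of_complex hv he) n G

/-- A sup bound M gives ℓ² norm at most √|Ω| M, and Cauchy–Schwarz loses another √|Ω| in returning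
to ℓ¹. Together they are exactly |Ω|, so the averaged estimate does not depend on the size of Ω.
This uniformity is what permits arbitrarily tall rectangles later. -/
theorem HasSpectralGap.sum_norm_le {i : S → S} {U : S → Equiv.Perm Ω} {d : ℕ}
    (hgap : HasSpectralGap U d) (hi : ∀ s, i (i s) = s)
    (hU : ∀ s, U (i s) = (U s)⁻¹) (hd : 1 ≤ d) (hS : Fintype.card S = 2 * d)
    {F : S → Ω → ℂ} {M : ℝ} (hM : ∀ h w, ‖F h w‖ ≤ M) (h0 : ∀ h, ∑ w, F h w = 0)
    (n : ℕ) (h : S) :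
    ∑ w, ‖(nonBacktracking i (fun s => LinearMap.funLeft ℂ ℂ (U s)) ^ n) F h w‖ ≤
      Fintype.card Ω * (2 * d * (14 * d) * (n + 1) ^ 3 * √(2 * d - 1) ^ n * M) := by
  have hd' : (1 : ℝ) ≤ d := by exact_mod_cast hd
  cases isEmpty_or_nonempty Ω
  · simp
  have hM0 : 0 ≤ M := (norm_nonneg _).trans (hM h (Classical.arbitrary Ω))
  choose G hG using fun s => MeanZero.exists_eval_eq (F s) (h0 s)
  have hGn : ‖G‖ ≤ √(Fintype.card Ω) * M := by
    refine (pi_norm_le_iff_of_nonneg (by positivity)).2 fun s => ?_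
    rw [MeanZero.norm_eq]
    simp only [hG]
    refine Real.sqrt_le_iff.2 ⟨by positivity, ?_⟩
    rw [mul_pow, Real.sq_sqrt (by positivity)]
    refine (Finset.sum_le_card_nsmul _ _ (M ^ 2) fun w _ => ?_).trans_eq (by simp)
    gcongr
    exact hM s w
  have hb := hgap.norm_pow_le hi hU hd hS n G
  have hF : F = fun s w => MeanZero.eval w (G s) := funext fun s => funext fun w => (hG s w).symm
  obtain ⟨v, hv⟩ : ∃ v, v = (nonBacktracking i (fun s => permMeanZero (U s)) ^ n) G h := ⟨_, rfl⟩
  have hFv : ∀ w, (nonBacktracking i (fun s => LinearMap.funLeft ℂ ℂ (U s)) ^ n) F h w = MeanZero.eval w v := by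
    intro w
    rw [hv, nonBacktracking_pow_permMeanZero, hF]
  simp only [hFv]
  have hvn : ‖v‖ ≤ 2 * d * (14 * d) * (n + 1) ^ 3 * √(2 * d - 1) ^ n * (√(Fintype.card Ω) * M) := by
    rw [hv]
    refine (norm_le_pi_norm ((nonBacktracking i (fun s => permMeanZero (U s)) ^ n) G) h).trans
      (hb.trans ?_)
    gcongr <;> linarith
  have hcs : ∑ w, ‖MeanZero.eval w v‖ ≤ √(Fintype.card Ω) * ‖v‖ := by
    have : ‖v‖ = √(∑ w, ‖MeanZero.eval w v‖ ^ 2) := v.norm_eq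
    rw [this, ← Real.sqrt_mul (by positivity)]
    refine Real.le_sqrt_of_sq_le ?_
    simpa using sq_sum_le_card_mul_sum_sq (s := Finset.univ) (f := fun w => ‖MeanZero.eval w v‖)
  refine hcs.trans ?_
  have hsq : √(Fintype.card Ω : ℝ) * √(Fintype.card Ω) = Fintype.card Ω :=
    Real.mul_self_sqrt (by positivity)
  calc _ ≤ √(Fintype.card Ω) *
        (2 * d * (14 * d) * (n + 1) ^ 3 * √(2 * d - 1) ^ n * (√(Fintype.card Ω) * M)) := by gcongr
    _ = _ := by
      linear_combination 2 * d * (14 * d) * (n + 1 : ℝ) ^ 3 * √(2 * d - 1) ^ n * M * hsq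

/-- On functions of the letter alone with total sum zero, T reduces to m ↦ -m ∘ i, which preserves
the supremum. -/
theorem norm_nonBacktracking_pow_const_le {S Ω : Type*} [Fintype S] {i : S → S}
    {U : S → Equiv.Perm Ω} (hi : ∀ s, i (i s) = s) {m : S → ℂ} {M : ℝ}
    (hM : ∀ h, ‖m h‖ ≤ M) (h0 : ∑ h, m h = 0) (n : ℕ) (h : S) (w : Ω) :
    ‖(nonBacktracking i (fun s => LinearMap.funLeft ℂ ℂ (U s)) ^ n) (fun h _ => m h) h w‖ ≤ M := by
  induction n generalizing m with
  | zero => exact hM h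
  | succ n ih =>
    have h1 : nonBacktracking i (fun s => LinearMap.funLeft ℂ ℂ (U s)) (fun h _ => m h) =
        fun h _ => -m (i h) := by
      funext h w
      simp [nonBacktracking_apply, letterSum_apply, backtrack_apply, LinearMap.funLeft_apply, h0]
    rw [pow_succ, Module.End.mul_apply, h1]
    refine ih (fun h => by simpa using hM _) ?_
    rw [Finset.sum_neg_distrib, neg_eq_zero]
    exact (Equiv.sum_comp (Function.Involutive.toPerm i hi) m).trans h0

/-- Only the total sum over letters and words vanishes, not the mean for each letter. Subtracting
the means leaves functions covered by the gap; the means themselves add up to zero and are covered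
by `norm_nonBacktracking_pow_const_le`. -/
theorem HasSpectralGap.sum_norm_le_of_sum {i : S → S} {U : S → Equiv.Perm Ω} {d : ℕ}
    (hgap : HasSpectralGap U d) (hi : ∀ s, i (i s) = s)
    (hU : ∀ s, U (i s) = (U s)⁻¹) (hd : 1 ≤ d) (hS : Fintype.card S = 2 * d)
    {F : S → Ω → ℂ} {M : ℝ} (hM : ∀ h w, ‖F h w‖ ≤ M) (h0 : ∑ h, ∑ w, F h w = 0)
    (n : ℕ) (h : S) :
    ∑ w, ‖(nonBacktracking i (fun s => LinearMap.funLeft ℂ ℂ (U s)) ^ n) F h w‖ ≤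
      Fintype.card Ω * (57 * d ^ 2 * (n + 1) ^ 3 * √(2 * d - 1) ^ n * M) := by
  have hd' : (1 : ℝ) ≤ d := by exact_mod_cast hd
  have hs : 1 ≤ √(2 * d - 1 : ℝ) := Real.one_le_sqrt.2 (by linarith)
  cases isEmpty_or_nonempty Ω
  · simp
  have hM0 : 0 ≤ M := (norm_nonneg _).trans (hM h (Classical.arbitrary Ω))
  have hc : (Fintype.card Ω : ℂ) ≠ 0 := by simp
  have hc' : 0 < (Fintype.card Ω : ℝ) := by exact_mod_cast Fintype.card_pos
  set m : S → ℂ := fun h => (∑ w, F h w) / Fintype.card Ω with hm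
  have hmM : ∀ h, ‖m h‖ ≤ M := by
    intro h
    rw [hm, norm_div, Complex.norm_natCast, div_le_iff₀ hc', mul_comm]
    refine (norm_sum_le _ _).trans ?_
    refine (Finset.sum_le_card_nsmul _ _ M fun w _ => hM h w).trans_eq (by simp)
  have hm0 : ∑ h, m h = 0 := by rw [← Finset.sum_div, h0, zero_div]
  have h1 := hgap.sum_norm_le hi hU hd hS (F := fun h w => F h w - m h) (M := 2 * M)
    (fun h w => (norm_sub_le _ _).trans (by linarith [hM h w, hmM h]))
    (fun h => by simp [hm, mul_div_cancel₀ _ hc]) n h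
  have h2 : F = (fun h w => F h w - m h) + fun h _ => m h := by
    funext h w
    simp
  have h3 : ∀ w, ‖(nonBacktracking i (fun s => LinearMap.funLeft ℂ ℂ (U s)) ^ n) F h w‖ ≤
      ‖(nonBacktracking i (fun s => LinearMap.funLeft ℂ ℂ (U s)) ^ n)
        (fun h w => F h w - m h) h w‖ + M := by
    intro w
    conv_lhs => rw [h2, map_add, Pi.add_apply, Pi.add_apply]
    exact (norm_add_le _ _).trans (by
      gcongr
      exact norm_nonBacktracking_pow_const_le hi hmM hm0 n h w)
  refine (Finset.sum_le_sum fun w _ => h3 w).trans ?_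
  rw [Finset.sum_add_distrib]
  refine (add_le_add_left h1 _).trans ?_
  simp only [Finset.sum_const, Finset.card_univ, nsmul_eq_mul]
  rw [← mul_add]
  gcongr
  -- The centred part contributes 28 · 2 = 56 and the constant part one more, whence 57.
  have h4 : 1 ≤ (d : ℝ) ^ 2 * (n + 1) ^ 3 * √(2 * d - 1) ^ n :=
    one_le_mul_of_one_le_of_one_le (one_le_mul_of_one_le_of_one_le (one_le_pow₀ hd')
      (one_le_pow₀ (by linarith [(n.cast_nonneg : (0 : ℝ) ≤ n)]))) (one_le_pow₀ hs)
  nlinarith [mul_le_mul_of_nonneg_right h4 hM0]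

end LoopMultigraph

end MeanZero

/-! ### Decay of horizontal correlations -/

theorem sum_norm_followSum_le {T ι : Type*} [Fintype T] (i : T → T) (s : Finset ι) (n : ℕ) (t : T)
    {φ : ι → List T → ℂ} {c : ℝ} (hc : 0 ≤ c) (h : ∀ l, ∑ x ∈ s, ‖φ x l‖ ≤ c) :
    ∑ x ∈ s, ‖followSum i n t (φ x)‖ ≤ Fintype.card T ^ n * c := by
  classical
  induction n generalizing t φ with
  | zero => simpa [followSum_zero] using h []
  | succ n ih =>
    simp only [followSum_succ]
    refine (Finset.sum_le_sum fun x _ => norm_sum_le _ _).trans ?_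
    rw [Finset.sum_comm]
    refine (Finset.sum_le_sum fun u _ => ih u (φ := fun x l => φ x (u :: l)) fun l => h _).trans ?_
    rw [Finset.sum_const, nsmul_eq_mul, pow_succ', mul_assoc]
    gcongr
    exact Finset.card_le_univ _

/-- Every first letter u has |T| - 1 admissible predecessors. -/
theorem sum_followSum_succ {T : Type*} [Fintype T] {i : T → T} (hi : ∀ t, i (i t) = t) (n : ℕ)
    (φ : List T → ℂ) :
    ∑ t, followSum i (n + 1) t φ =
      (Fintype.card T - 1 : ℕ) * ∑ u, followSum i n u fun l => φ (u :: l) := by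
  classical
  simp only [followSum_succ]
  have h1 : ∀ t u, u ≠ i t ↔ t ≠ i u := fun t u => by
    rw [not_iff_not]
    constructor <;> rintro rfl <;> simp [hi]
  simp only [Finset.sum_filter]
  rw [Finset.sum_comm, Finset.mul_sum]
  refine Finset.sum_congr rfl fun u _ => ?_
  rw [← Finset.sum_filter, Finset.sum_const, nsmul_eq_mul]
  rw [Finset.filter_congr fun t _ => h1 t u, card_filter_ne]

theorem Function.FactorsThrough.exists_norm_le {X A : Type*} {π : X → A} {f : X → ℂ}
    (hf : f.FactorsThrough π) {M : ℝ} (hM0 : 0 ≤ M) (hM : ∀ x, ‖f x‖ ≤ M) :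
    ∃ F : A → ℂ, (∀ x, f x = F (π x)) ∧ ∀ a, ‖F a‖ ≤ M := by
  -- Extension by 0 off the range of π keeps the bound.
  refine ⟨Function.extend π f 0, fun x => (hf.extend_apply 0 x).symm, fun a => ?_⟩
  by_cases h : ∃ x, π x = a
  · obtain ⟨x, rfl⟩ := h
    rw [hf.extend_apply]
    exact hM x
  · rw [Function.extend_apply' _ _ _ h]
    simpa using hM0

namespace PlaneSubshift

variable {W : Type*} [TopologicalSpace W] [DiscreteTopology W] [MeasurableSpace W]
  [MeasurableSingletonClass W] [Finite W] {X : PlaneSubshift W} {μ : Measure X.carrier} {q : ℕ}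

theorem integrable_of_isLocallyConstant [IsFiniteMeasure μ] {f : X.carrier → ℂ}
    (hf : IsLocallyConstant f) : Integrable f μ := by
  refine hf.continuous.integrable_of_hasCompactSupport ?_
  exact HasCompactSupport.of_compactSpace f

theorem isLocallyConstant_comp_shift {W Y : Type*} [TopologicalSpace W] {X : PlaneSubshift W}
    {f : X.carrier → Y} (hf : IsLocallyConstant f)
    (a : ℤ × ℤ) : IsLocallyConstant fun x => f (X.shift a x) :=
  hf.comp_continuous (continuous_shift a)

theorem IsNaturalMeasure.integral_shift (hμ : X.IsNaturalMeasure q μ) {f : X.carrier → ℂ}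
    (hf : IsLocallyConstant f) (a : ℤ × ℤ) : ∫ x, f (X.shift a x) ∂μ = ∫ x, f x ∂μ := by
  have h := (hμ.measurePreserving_shift a)
  conv_rhs => rw [← h.map_eq]
  exact (integral_map h.measurable.aemeasurable hf.continuous.aestronglyMeasurable).symm

theorem IsNaturalMeasure.correlation_eq_integral (hμ : X.IsNaturalMeasure q μ)
    {f g : X.carrier → ℂ} (hf : IsLocallyConstant f) (hg : IsLocallyConstant g) (n : ℤ × ℤ) :
    X.correlation μ f g n = ∫ x, (f (X.shift n x) - ∫ y, f y ∂μ) * g x ∂μ := by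
  have := hμ.1
  have h1 : Integrable (fun x => f (X.shift n x) * g x) μ :=
    integrable_of_isLocallyConstant ((isLocallyConstant_comp_shift hf n).mul hg)
  simp only [sub_mul]
  rw [integral_sub h1 ((integrable_of_isLocallyConstant hg).const_mul _), integral_const_mul]
  rfl

theorem _root_.MeasureTheory.norm_integral_le_of_forall {X : Type*} [MeasurableSpace X]
    {μ : Measure X} [IsProbabilityMeasure μ] {f : X → ℂ} {M : ℝ}
    (hM : ∀ x, ‖f x‖ ≤ M) : ‖∫ x, f x ∂μ‖ ≤ M := by
  simpa using norm_integral_le_of_norm_le_const (μ := μ) (Eventually.of_forall hM)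

end PlaneSubshift

namespace VHDatum

open PlaneSubshift

variable {V H : Type*} {d : ℕ} {D : VHDatum V H d d}

theorem colWord_shift (a b : ℤ × ℤ) (K : ℕ) (x : D.subshift.carrier) :
    colWord a K (D.subshift.shift b x) = colWord (a + b) K x := by
  refine Subtype.ext (List.ofFn_inj.2 (funext fun j =>
    congrArg (fun c => (x.1 c).left) (Prod.ext ?_ ?_)))
  · simp [add_comm]
  · simp [add_assoc, add_left_comm]

theorem rowWord_shift (a b : ℤ × ℤ) (N : ℕ) (x : D.subshift.carrier) :
    rowWord a N (D.subshift.shift b x) = rowWord (a + b) N x := by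
  refine Subtype.ext (List.ofFn_inj.2 (funext fun j =>
    congrArg (fun c => (x.1 c).bottom) (Prod.ext ?_ ?_)))
  · simp [add_assoc, add_left_comm]
  · simp [add_comm]

theorem card_H_eq [Fintype H] (D : VHDatum V H d d) : Fintype.card H = 2 * d := by
  rw [← Nat.card_eq_fintype_card, D.card_H]

variable [Fintype V] [Fintype H]

/-- The two families of permutations differ by inverting the letter, which only reorders the sum. -/
theorem spectralGap_iff (K : ℕ) :
    D.SpectralGap K ↔ LoopMultigraph.HasSpectralGap (D.slidePerm K) d := by
  have h : ∀ (v : ReducedWord D.invV K → ℝ) w,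
      ∑ h, v (D.slidePerm K h w) = ∑ s, v (D.colTransducer.actWord K s w) := fun v w =>
    Equiv.sum_comp (Function.Involutive.toPerm D.invH D.invH_invH)
      fun s => v (D.colTransducer.actWord K s w)
  exact ⟨fun hgap v ev hv h0 hev => hgap v ev hv h0 fun w => (h v w).symm.trans (hev w),
    fun hgap v ev hv h0 hev => hgap v ev hv h0 fun w => (h v w).trans (hev w)⟩

theorem SpectralGap.sum_norm_le {K : ℕ} (h : D.SpectralGap K) (hd : 1 ≤ d)
    {F : H → ReducedWord D.invV K → ℂ} {M : ℝ} (hM : ∀ h w, ‖F h w‖ ≤ M)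
    (h0 : ∑ h, ∑ w, F h w = 0) (n : ℕ) (t : H) :
    ∑ w, ‖(nonBacktracking D.invH (D.slide K) ^ n) F t w‖ ≤
      Fintype.card (ReducedWord D.invV K) *
        (57 * d ^ 2 * (n + 1) ^ 3 * √((2 * d - 1 : ℕ) : ℝ) ^ n * M) := by
  have := ((spectralGap_iff K).1 h).sum_norm_le_of_sum D.invH_invH (D.slidePerm_inv K) hd D.card_H_eq hM h0 n t
  have hq : ((2 * d - 1 : ℕ) : ℝ) = 2 * d - 1 := by
    rw [Nat.cast_sub (by omega)]
    push_cast
    ring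
  rw [hq]
  exact this

/-- The integral of a product of two functions of distant rectangles. -/
theorem integral_mul_eq_sum {μ : Measure D.subshift.carrier}
    (hμ : D.subshift.IsNaturalMeasure (2 * d - 1) μ) (a : ℤ × ℤ) {K : ℕ} (hK : 1 ≤ K) (m l : ℕ)
    (F G : ReducedWord D.invV K × List H → ℂ) :
    ∫ x, F (colWord (a + (((m + 1 + l : ℕ) : ℤ), 0)) K x,
        (rowWord (a + (((m + 1 + l : ℕ) : ℤ), 0)) (m + 1) x).1) *
        G (colWord a K x, (rowWord a (m + 1) x).1) ∂μ =
      ((Fintype.card (ReducedWord D.invV K) : ℂ) * (2 * d) *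
          (2 * d - 1 : ℕ) ^ (m + (l + (m + 1))))⁻¹ *
        ∑ w, ∑ h, followSum D.invH m h fun u => G (w, h :: u) *
          (nonBacktracking D.invH (D.slide K) ^ l)
            (fun t w => followSum D.invH (m + 1) t fun z => F (w, z)) (u.getLastD h)
            (D.move K (h :: u) w) := by
  -- A single bottom word spans both windows: m + 1 letters for G, a gap of l letters, and m + 1
  -- letters for F. The left word of the second window is the first one moved along the first m + 1
  -- + l letters.
  have h1 := integral_eq_followSum hμ a hK (m + (l + (m + 1))) fun w L =>
    F (D.move K (L.take (m + 1 + l)) w, L.drop (m + 1 + l)) * G (w, L.take (m + 1))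
  rw [show m + (l + (m + 1)) + 1 = (m + 1 + l) + (m + 1) by ring] at h1
  simp only [rowWord_drop, rowWord_take a (show m + 1 + l ≤ m + 1 + l + (m + 1) by omega),
    rowWord_take a (show m + 1 ≤ m + 1 + l + (m + 1) by omega), ← colWord_add] at h1
  rw [h1]
  congr 1
  refine Finset.sum_congr rfl fun w _ => Finset.sum_congr rfl fun h _ => ?_
  rw [followSum_add]
  refine followSum_congr _ fun u hu => ?_
  rw [followSum_add, ← followSum_move, ← followSum_mul_left]
  refine followSum_congr _ fun y hy => ?_
  rw [← followSum_mul_left]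
  refine followSum_congr _ fun z hz => ?_
  have e1 : (h :: (u ++ (y ++ z))).take (m + 1) = h :: u := by
    rw [List.take_succ_cons, List.take_left' hu]
  have e2 : (h :: (u ++ (y ++ z))).take (m + 1 + l) = h :: u ++ y := by
    rw [← List.append_assoc, ← List.cons_append, ← List.cons_append,
      List.take_left' (by simp [hu, hy]; ring)]
  have e3 : (h :: (u ++ (y ++ z))).drop (m + 1 + l) = z := by
    rw [← List.append_assoc, ← List.cons_append, List.drop_left' (by simp [hu, hy]; ring)]
  rw [e1, e2, e3, move_append, mul_comm]

/-- Decay of the correlations of functions of a rectangle in the horizontal direction. -/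
theorem exists_norm_correlation_le (hd : 1 ≤ d) (hgap : ∀ K, D.SpectralGap K)
    {μ : Measure D.subshift.carrier} (hμ : D.subshift.IsNaturalMeasure (2 * d - 1) μ) (m : ℕ) :
    ∃ C : ℝ, 0 < C ∧ ∀ (a : ℤ × ℤ) (K : ℕ), 1 ≤ K → ∀ (f g : D.subshift.carrier → ℂ) (Mf Mg : ℝ),
      (∀ x, ‖f x‖ ≤ Mf) → (∀ x, ‖g x‖ ≤ Mg) →
      f.FactorsThrough (fun x => (colWord a K x, (rowWord a (m + 1) x).1)) →
      g.FactorsThrough (fun x => (colWord a K x, (rowWord a (m + 1) x).1)) → ∀ n : ℕ, 1 ≤ n →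
        ‖D.subshift.correlation μ f g ((n : ℤ), 0)‖ ≤
          C * Mf * Mg * n ^ 3 * (1 / √((2 * d - 1 : ℕ) : ℝ)) ^ n := by
  have := hμ.1
  have hd' : (1 : ℝ) ≤ d := by exact_mod_cast hd
  set q : ℝ := ((2 * d - 1 : ℕ) : ℝ) with hq
  have hq1 : 1 ≤ q := by
    rw [hq]
    exact_mod_cast (by omega : 1 ≤ 2 * d - 1)
  have hs : 1 ≤ √q := Real.one_le_sqrt.2 hq1
  have hs0 : 0 < √q := by linarith
  -- The first summand serves disjoint windows (114 = 2 · 57, the 2 coming from centring f), the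
  -- second overlapping ones. Neither involves the height K.
  refine ⟨114 * d ^ 2 * (2 * d) ^ (2 * m + 1) + 2 * √q ^ m, by positivity, ?_⟩
  intro a K hK f g Mf Mg hMf hMg hf hg n hn
  obtain ⟨x₀⟩ := nonempty_subshift (D := D) hd
  have hMf0 : 0 ≤ Mf := (norm_nonneg _).trans (hMf x₀)
  have hMg0 : 0 ≤ Mg := (norm_nonneg _).trans (hMg x₀)
  have hloc : IsLocallyConstant
      fun x : D.subshift.carrier => (colWord a K x, (rowWord a (m + 1) x).1) :=
    (isLocallyConstant_colWord a K).prodMk ((isLocallyConstant_rowWord a (m + 1)).comp Subtype.val)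
  have hlc : ∀ f : D.subshift.carrier → ℂ,
      f.FactorsThrough (fun x => (colWord a K x, (rowWord a (m + 1) x).1)) →
        IsLocallyConstant f := by
    intro f hf
    obtain ⟨F, rfl⟩ : ∃ F, f = F ∘ fun x => (colWord a K x, (rowWord a (m + 1) x).1) :=
      ⟨Function.extend _ f 0, funext fun x => (hf.extend_apply 0 x).symm⟩
    exact hloc.comp F
  have hfl := hlc f hf
  rw [hμ.correlation_eq_integral hfl (hlc g hg)]
  have hI : ‖∫ x, f x ∂μ‖ ≤ Mf := norm_integral_le_of_forall hMf
  set I := ∫ x, f x ∂μ with hIdef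
  have hM2 : ∀ x, ‖f x - I‖ ≤ 2 * Mf := fun x =>
    (norm_sub_le _ _).trans (by linarith [hMf x])
  have hn1 : (1 : ℝ) ≤ n ^ 3 := one_le_pow₀ (by exact_mod_cast hn)
  -- For n ≤ m the windows overlap and the trivial bound 2 Mf Mg suffices.
  rcases Nat.lt_or_ge n (m + 1) with hnm | hnm
  · have h1 : ‖∫ x, (f (D.subshift.shift ((n : ℤ), 0) x) - I) * g x ∂μ‖ ≤ 2 * Mf * Mg := by
      refine norm_integral_le_of_forall fun x => ?_
      rw [norm_mul]
      gcongr
      · exact hM2 _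
      · exact hMg x
    refine h1.trans ?_
    have h2 : 1 ≤ √q ^ m * (1 / √q) ^ n := by
      rw [one_div, inv_pow, ← div_eq_mul_inv, one_le_div (by positivity)]
      exact pow_le_pow_right₀ hs (by omega)
    have h3 : 2 * 1 * 1 ≤ (114 * d ^ 2 * (2 * d) ^ (2 * m + 1) + 2 * √q ^ m) * n ^ 3 *
        (1 / √q) ^ n := by
      have h4 : 2 * √q ^ m * 1 * (1 / √q) ^ n ≤ (114 * d ^ 2 * (2 * d) ^ (2 * m + 1) + 2 * √q ^ m) *
          n ^ 3 * (1 / √q) ^ n := by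
        gcongr
        exact le_add_of_nonneg_left (by positivity)
      linarith
    have := mul_le_mul_of_nonneg_right h3 (mul_nonneg hMf0 hMg0)
    linarith
  · obtain ⟨l, rfl⟩ : ∃ l, n = m + 1 + l := ⟨n - (m + 1), by omega⟩
    have hf' : (fun x => f x - I).FactorsThrough
        (fun x => (colWord a K x, (rowWord a (m + 1) x).1)) := fun x y h => by
      simp only [hf h]
    obtain ⟨F, hF, hFM⟩ := hf'.exists_norm_le (by positivity) hM2
    obtain ⟨G, hG, hGM⟩ := hg.exists_norm_le hMg0 hMg
    have h1 := integral_mul_eq_sum hμ a hK m l F G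
    have h2 : ∀ x, (f (D.subshift.shift (((m + 1 + l : ℕ) : ℤ), 0) x) - I) * g x =
        F (colWord (a + (((m + 1 + l : ℕ) : ℤ), 0)) K x,
          (rowWord (a + (((m + 1 + l : ℕ) : ℤ), 0)) (m + 1) x).1) *
        G (colWord a K x, (rowWord a (m + 1) x).1) := by
      intro x
      rw [hF, hG, colWord_shift, rowWord_shift]
    simp only [h2]
    rw [h1]
    set 𝓕 : H → ReducedWord D.invV K → ℂ := fun t w => followSum D.invH (m + 1) t fun z => F (w, z)
    have hcard : (Fintype.card H : ℝ) = 2 * d := by rw [D.card_H_eq]; push_cast; ring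
    have h𝓕 : ∀ t w, ‖𝓕 t w‖ ≤ (2 * d) ^ (m + 1) * (2 * Mf) := fun t w => by
      rw [← hcard]
      exact norm_followSum_le _ _ _ (by positivity) fun l => hFM _
    have hΩ : (Fintype.card (ReducedWord D.invV K) : ℝ) ≠ 0 := by
      have := D.nonempty_V hd
      have : Nonempty (ReducedWord D.invV K) := ReducedWord.nonempty_of_fixedPointFree D.invV_ne K
      simp
    -- The integral of the centred f vanishes. The sum in question has one extra leading letter t,
    -- which by `sum_followSum_succ` only contributes a factor.
    have h0 : ∑ t, ∑ w, 𝓕 t w = 0 := by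
      have h3 : ∫ x, F (colWord a K x, (rowWord a (m + 1) x).1) ∂μ = 0 := by
        simp only [← hF]
        rw [integral_sub (integrable_of_isLocallyConstant hfl) (integrable_const _)]
        simp [hIdef]
      rw [integral_eq_followSum hμ a hK m fun w L => F (w, L)] at h3
      rcases mul_eq_zero.1 h3 with h4 | h4
      · have hq0 : ((2 * d - 1 : ℕ) : ℂ) ≠ 0 := by
          exact_mod_cast (by omega : 2 * d - 1 ≠ 0)
        have hd0 : (d : ℂ) ≠ 0 := by exact_mod_cast (by omega : d ≠ 0)
        have hΩ' : (Fintype.card (ReducedWord D.invV K) : ℂ) ≠ 0 := by exact_mod_cast hΩ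
        exact absurd h4 (inv_ne_zero (mul_ne_zero (mul_ne_zero hΩ'
          (mul_ne_zero two_ne_zero hd0)) (pow_ne_zero _ hq0)))
      · rw [Finset.sum_comm]
        simp only [𝓕, sum_followSum_succ D.invH_invH]
        rw [← Finset.mul_sum, h4, mul_zero]
    have h5 : ∑ w, ∑ h, ‖followSum D.invH m h fun u => G (w, h :: u) *
          (nonBacktracking D.invH (D.slide K) ^ l) 𝓕 (u.getLastD h) (D.move K (h :: u) w)‖ ≤
        2 * d * ((2 * d) ^ m * (Mg * (Fintype.card (ReducedWord D.invV K) *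
          (57 * d ^ 2 * (l + 1) ^ 3 * √q ^ l * ((2 * d) ^ (m + 1) * (2 * Mf)))))) := by
      rw [Finset.sum_comm]
      refine (Finset.sum_le_card_nsmul _ _ ((2 * d) ^ m * (Mg *
        (Fintype.card (ReducedWord D.invV K) *
          (57 * d ^ 2 * (l + 1) ^ 3 * √q ^ l * ((2 * d) ^ (m + 1) * (2 * Mf)))))) fun h _ => ?_).trans_eq
        (by rw [Finset.card_univ, nsmul_eq_mul, hcard])
      rw [← hcard]
      refine sum_norm_followSum_le _ _ _ _ (by positivity) fun u => ?_
      rw [hcard]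
      simp only [norm_mul]
      refine (Finset.sum_le_sum fun w _ => mul_le_mul_of_nonneg_right (hGM _)
        (norm_nonneg _)).trans ?_
      rw [← Finset.mul_sum]
      gcongr
      refine Eq.trans_le ?_ ((hgap K).sum_norm_le hd h𝓕 h0 l (u.getLastD h))
      -- Sliding along a fixed word permutes the vertical words and leaves the ℓ¹ norm unchanged.
      exact (D.bijective_move K (h :: u)).sum_comp fun w =>
        ‖(nonBacktracking D.invH (D.slide K) ^ l) 𝓕 (u.getLastD h) w‖
    rw [norm_mul, norm_inv, norm_mul, norm_mul, norm_pow, norm_mul, Complex.norm_natCast,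
      Complex.norm_natCast, Complex.norm_natCast, ← hq, Complex.norm_ofNat]
    refine (mul_le_mul_of_nonneg_left (((norm_sum_le _ _).trans
      (Finset.sum_le_sum fun w _ => norm_sum_le _ _)).trans h5) (by positivity)).trans ?_
    have hpow : (q ^ (m + (l + (m + 1))))⁻¹ * √q ^ l ≤ (1 / √q) ^ (m + 1 + l) := by
      rw [one_div, inv_pow, inv_mul_le_iff₀ (by positivity), ← div_eq_mul_inv,
        le_div_iff₀ (by positivity), ← pow_add]
      calc √q ^ (l + (m + 1 + l)) ≤ √q ^ (2 * (m + (l + (m + 1)))) :=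
            pow_le_pow_right₀ hs (by omega)
        _ = _ := by rw [pow_mul, Real.sq_sqrt (by positivity)]
    have hl : ((l : ℝ) + 1) ^ 3 ≤ ((m + 1 + l : ℕ) : ℝ) ^ 3 := by
      gcongr
      push_cast
      linarith [(m.cast_nonneg : (0 : ℝ) ≤ m)]
    calc _ = 114 * d ^ 2 * (2 * d : ℝ) ^ (2 * m + 1) * Mf * Mg * (l + 1) ^ 3 *
          ((q ^ (m + (l + (m + 1))))⁻¹ * √q ^ l) := by
          field_simp
          ring
      _ ≤ 114 * d ^ 2 * (2 * d : ℝ) ^ (2 * m + 1) * Mf * Mg * ((m + 1 + l : ℕ) : ℝ) ^ 3 *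
          (1 / √q) ^ (m + 1 + l) := by gcongr
      _ ≤ _ := by
        gcongr
        exact le_add_of_nonneg_right (by positivity)

end VHDatum

/-! ### From decay of correlations to spectral gaps -/

theorem wordSeq_zero (ev q : ℝ) : wordSeq ev q 0 = ev := rfl

theorem wordSeq_one (ev q : ℝ) : wordSeq ev q 1 = ev ^ 2 - (q + 1) := rfl

/-- At the trivial eigenvalues the sum over words has the size of the number of words, so after
normalization there is no decay. -/
theorem abs_wordSeq_of_abs_eq {ev q : ℝ} (hq : 0 ≤ q) (h : |ev| = q + 1) (n : ℕ) :
    |wordSeq ev q n| = (q + 1) * q ^ n := by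
  obtain ⟨s, hs, rfl⟩ : ∃ s : ℝ, |s| = 1 ∧ ev = s * (q + 1) := by
    rcases abs_eq (by linarith) |>.1 h with h | h
    · exact ⟨1, by simp, by linarith⟩
    · exact ⟨-1, by simp, by linarith⟩
  have hs2 : s ^ 2 = 1 := by rw [← sq_abs, hs, one_pow]
  suffices ∀ n, wordSeq (s * (q + 1)) q n = s ^ (n + 1) * ((q + 1) * q ^ n) ∧
      wordSeq (s * (q + 1)) q (n + 1) = s ^ (n + 2) * ((q + 1) * q ^ (n + 1)) by
    rw [(this n).1, abs_mul, abs_pow, hs, one_pow, one_mul, abs_of_nonneg (by positivity)]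
  intro n
  induction n with
  | zero =>
    rw [wordSeq_zero, wordSeq_one, mul_pow, hs2]
    constructor
    · ring
    · ring
  | succ n ih =>
    refine ⟨ih.2, ?_⟩
    rw [show n + 1 + 1 = n + 2 from rfl, wordSeq_add_two, ih.1, ih.2]
    linear_combination s ^ (n + 1) * (q + 1) * q ^ (n + 1) * hs2

/-- The other root of the characteristic polynomial is q / θ; removing its contribution leaves a
geometric sequence of ratio θ. -/
theorem wordSeq_succ_sub {ev q θ : ℝ} (hθ : θ ≠ 0) (h : θ ^ 2 - ev * θ + q = 0) (n : ℕ) :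
    wordSeq ev q (n + 1) - q / θ * wordSeq ev q n = θ ^ n * (θ ^ 2 - 1) := by
  have hev : ev = θ + q / θ := by
    field_simp
    linarith
  have hq : q = θ * (q / θ) := by field_simp
  induction n with
  | zero =>
    rw [wordSeq_zero, wordSeq_one, pow_zero, one_mul]
    generalize hy : q / θ = y at *
    subst hev
    linear_combination (-1 : ℝ) * hq
  | succ n ih =>
    rw [show n + 1 + 1 = n + 2 from rfl, wordSeq_add_two, pow_succ]
    generalize hy : q / θ = y at *
    subst hev
    linear_combination θ * ih - wordSeq (θ + y) q n * hq

/-- If |ev| exceeded 2√q, the larger root t in absolute value would be real with t > √q. The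
sequence of `wordSeq_succ_sub` would then grow like t^n with the nonzero factor t² - 1, faster than
a polynomial times √q^n. -/
theorem abs_le_of_wordSeq_le {ev q B : ℝ} {k : ℕ} (hq : 1 ≤ q)
    (h : ∀ n, |wordSeq ev q n| ≤ B * (n + 1) ^ k * √q ^ n) : |ev| ≤ 2 * √q := by
  by_contra! hlt
  have hs : 1 ≤ √q := Real.one_le_sqrt.2 hq
  have hsq : √q * √q = q := Real.mul_self_sqrt (by linarith)
  have hB : 0 ≤ B := by
    have := (abs_nonneg _).trans (h 0)
    simpa using this
  have hdisc : 0 ≤ |ev| ^ 2 - 4 * q := by nlinarith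
  set y := √(|ev| ^ 2 - 4 * q) with hy
  have hy2 : y ^ 2 = |ev| ^ 2 - 4 * q := Real.sq_sqrt hdisc
  set t := (|ev| + y) / 2 with ht
  have htq : √q < t := by
    have : 0 ≤ y := Real.sqrt_nonneg _
    linarith
  have ht0 : 0 < t := by linarith
  have ht1 : 0 < t ^ 2 - 1 := by nlinarith
  -- With s the sign of ev, the dominant root is s t.
  obtain ⟨s, hs1, hs2⟩ : ∃ s : ℝ, |s| = 1 ∧ ev = s * |ev| := by
    rcases abs_cases ev with h | h
    · exact ⟨1, by simp, by linarith⟩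
    · exact ⟨-1, by simp, by linarith⟩
  have hss : s ^ 2 = 1 := by rw [← sq_abs, hs1, one_pow]
  have habs : |s * t| = t := by rw [abs_mul, hs1, one_mul, abs_of_pos ht0]
  have hθ : (s * t) ^ 2 - ev * (s * t) + q = 0 := by
    rw [hs2]
    generalize |ev| = e at *
    rw [ht]
    linear_combination ((e + y) ^ 2 / 4 - e * (e + y) / 2) * hss + hy2 / 4
  have key : ∀ n : ℕ, (t / √q) ^ n * (t ^ 2 - 1) ≤ B * (√q + q / t) * (n + 2) ^ k := by
    intro n
    have h1 := wordSeq_succ_sub (fun h0 => by rw [h0, abs_zero] at habs; linarith) hθ n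
    have h2 : t ^ n * (t ^ 2 - 1) = |(s * t) ^ n * ((s * t) ^ 2 - 1)| := by
      rw [abs_mul, abs_pow, habs, mul_pow, hss, one_mul, abs_of_pos ht1]
    rw [← h1] at h2
    have h3 : t ^ n * (t ^ 2 - 1) ≤ B * (√q + q / t) * (n + 2) ^ k * √q ^ n := by
      rw [h2]
      refine (abs_sub _ _).trans ?_
      rw [abs_mul, abs_div, habs, abs_of_pos (by linarith : 0 < q)]
      have h4 := h (n + 1)
      have h5 := h n
      have h6 : B * ((n : ℝ) + 1) ^ k * √q ^ n ≤ B * (n + 2) ^ k * √q ^ n := by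
        gcongr
        norm_num
      have h7 : q / t * |wordSeq ev q n| ≤ q / t * (B * (n + 2) ^ k * √q ^ n) := by
        gcongr
        exact h5.trans h6
      push_cast at h4
      rw [pow_succ, add_assoc, one_add_one_eq_two] at h4
      linarith
    rw [div_pow, div_mul_eq_mul_div, div_le_iff₀ (by positivity)]
    exact h3
  have hρ : 1 < t / √q := (one_lt_div (by linarith)).2 htq
  have hlim := (tendsto_pow_const_div_const_pow_of_one_lt k hρ).comp (tendsto_add_atTop_nat 2)
  set ρ := t / √q with hρ'
  have hlim2 : Tendsto (fun n : ℕ => B * (√q + q / t) * ρ ^ 2 *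
      (((n + 2 : ℕ) : ℝ) ^ k / ρ ^ (n + 2))) atTop (nhds 0) := by
    have := hlim.const_mul (B * (√q + q / t) * ρ ^ 2)
    rw [mul_zero] at this
    exact this
  have hle : t ^ 2 - 1 ≤ 0 := by
    refine ge_of_tendsto' hlim2 fun n => ?_
    have hρ0 : 0 < ρ := by linarith
    have : B * (√q + q / t) * ρ ^ 2 * (((n + 2 : ℕ) : ℝ) ^ k / ρ ^ (n + 2)) =
        B * (√q + q / t) * (n + 2) ^ k / ρ ^ n := by
      push_cast
      rw [pow_add]
      field_simp
    rw [this, le_div_iff₀ (by positivity), mul_comm]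
    exact key n
  linarith

namespace VHDatum

open PlaneSubshift

variable {V H : Type*} {d : ℕ} {D : VHDatum V H d d} [Fintype V] [Fintype H]

theorem integral_comp_colWord {μ : Measure D.subshift.carrier}
    (hμ : D.subshift.IsNaturalMeasure (2 * d - 1) μ) (a : ℤ × ℤ) {K : ℕ} (hK : 1 ≤ K)
    {v : ReducedWord D.invV K → ℂ} (hv : ∑ w, v w = 0) : ∫ x, v (colWord a K x) ∂μ = 0 := by
  rw [integral_eq_followSum hμ a hK 0 fun w _ => v w]
  simp [followSum_zero, ← Finset.mul_sum, hv]

/-- The conditional average of v over all slides of length n + 1 is a word sum, and word sums act on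
an eigenvector by the scalar `wordSeq`. -/
theorem correlation_comp_colWord {μ : Measure D.subshift.carrier}
    (hμ : D.subshift.IsNaturalMeasure (2 * d - 1) μ) (hd : 1 ≤ d) {K : ℕ} (hK : 1 ≤ K)
    {v : ReducedWord D.invV K → ℝ} (hv : ∑ w, v w = 0) {ev : ℝ}
    (hev : ∀ w, ∑ h, v (D.slidePerm K h w) = ev * v w) (n : ℕ) :
    D.subshift.correlation μ (fun x => (v (colWord 0 K x) : ℂ)) (fun x => (v (colWord 0 K x) : ℂ))
        (((n + 1 : ℕ) : ℤ), 0) =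
      ((Fintype.card (ReducedWord D.invV K) : ℂ) * (2 * d) * (2 * d - 1 : ℕ) ^ n)⁻¹ *
        (wordSeq ev (2 * d - 1 : ℕ) n * ∑ w, (v w : ℂ) ^ 2) := by
  have h0 : ∑ w, (v w : ℂ) = 0 := by exact_mod_cast congrArg ((↑) : ℝ → ℂ) hv
  have h1 := integral_eq_followSum hμ 0 hK n fun w L => (v (D.move K L w) : ℂ) * v w
  simp only [← colWord_add] at h1
  rw [correlation, integral_comp_colWord hμ 0 hK (v := fun w => (v w : ℂ)) h0, zero_mul, sub_zero]
  simp only [colWord_shift, h1]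
  congr 1
  rw [Finset.mul_sum]
  refine Finset.sum_congr rfl fun w _ => ?_
  have h2 : ∀ h, (followSum D.invH n h fun l => (v (D.move K (h :: l) w) : ℂ) * v w) =
      v w * (nonBacktracking D.invH (D.slide K) ^ n) (fun _ w => (v w : ℂ)) h
        (D.slidePerm K h w) := by
    intro h
    rw [← followSum_move, ← followSum_mul_left]
    exact followSum_congr _ fun l _ => by rw [move_cons, mul_comm]
  have h3 : wordSum D.invH (D.slide K) n (fun w => (v w : ℂ)) =
      (wordSeq ev (2 * d - 1 : ℕ) n : ℂ) • fun w => (v w : ℂ) := by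
    refine wordSum_eq_wordSeq_smul D.invH_invH (D.slide_slide K) ?_ ?_ n
    · rw [D.card_H_eq, ← Nat.cast_add_one]
      congr 1
      omega
    · funext w
      rw [Finset.sum_apply]
      simp only [slide_apply, Pi.smul_apply, smul_eq_mul]
      exact_mod_cast congrArg ((↑) : ℝ → ℂ) (hev w)
  have h4 := congrFun h3 w
  rw [wordSum_apply, letterSum_apply, Finset.sum_apply] at h4
  simp only [slide_apply, Pi.smul_apply, smul_eq_mul] at h4
  simp only [h2]
  rw [← Finset.mul_sum, h4]
  ring

/-- Eigenvectors serve as test functions: the decay rate bounds `wordSeq`, hence the eigenvalue,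
while mixing excludes ±2d. Only autocorrelations in the horizontal direction are needed. -/
theorem spectralGap_of_decay (hd : 1 ≤ d) {μ : Measure D.subshift.carrier}
    (hμ : D.subshift.IsNaturalMeasure (2 * d - 1) μ)
    (hmix : ∀ f : D.subshift.carrier → ℂ, IsLocallyConstant f →
      Tendsto (fun n : ℕ => D.subshift.correlation μ f f (((n + 1 : ℕ) : ℤ), 0)) atTop (nhds 0))
    {r : ℝ} (hdecay : ∀ f : D.subshift.carrier → ℂ, IsLocallyConstant f →
      ∃ C : ℝ, ∀ n : ℕ, ‖D.subshift.correlation μ f f (((n + 1 : ℕ) : ℤ), 0)‖ ≤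
        C * ((n + 1 : ℕ) : ℝ) ^ r * (1 / √((2 * d - 1 : ℕ) : ℝ)) ^ (n + 1)) (K : ℕ) :
    D.SpectralGap K := by
  rw [spectralGap_iff]
  intro v ev hv0 hv hev
  rcases Nat.eq_zero_or_pos K with rfl | hK
  -- There is only one word of length 0, so a function of mean zero vanishes.
  · refine absurd (funext fun w => ?_) hv0
    have : Unique (ReducedWord D.invV 0) :=
      ⟨⟨w⟩, fun w' => Subtype.ext (by
        exact (List.length_eq_zero_iff.1 w'.2.1).trans (List.length_eq_zero_iff.1 w.2.1).symm)⟩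
    rw [Fintype.sum_unique] at hv
    rw [Subsingleton.elim w default]
    exact hv
  have hd' : (1 : ℝ) ≤ d := by exact_mod_cast hd
  have hqd : ((2 * d - 1 : ℕ) : ℝ) = 2 * d - 1 := by
    rw [Nat.cast_sub (by omega)]
    push_cast
    ring
  set q : ℝ := ((2 * d - 1 : ℕ) : ℝ) with hq
  have hq1 : 1 ≤ q := by linarith
  have hs : 1 ≤ √q := Real.one_le_sqrt.2 hq1
  set f : D.subshift.carrier → ℂ := fun x => (v (colWord 0 K x) : ℂ) with hf
  have hloc : IsLocallyConstant f := (isLocallyConstant_colWord 0 K).comp fun w => (v w : ℂ)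
  have hvw : ∃ w, v w ≠ 0 := Function.ne_iff.1 hv0
  have hsum : 0 < ∑ w, v w ^ 2 := by
    obtain ⟨w, hw⟩ := hvw
    exact Finset.sum_pos' (fun w _ => sq_nonneg _) ⟨w, Finset.mem_univ _, by positivity⟩
  have hΩ : 0 < (Fintype.card (ReducedWord D.invV K) : ℝ) := by
    obtain ⟨w, hw⟩ := hvw
    exact_mod_cast Fintype.card_pos_iff.2 ⟨w⟩
  set A : ℝ := (∑ w, v w ^ 2) / (Fintype.card (ReducedWord D.invV K) * (2 * d)) with hA
  have hA0 : 0 < A := by positivity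
  have hcorr : ∀ n : ℕ, ‖D.subshift.correlation μ f f (((n + 1 : ℕ) : ℤ), 0)‖ =
      A * (|wordSeq ev q n| / q ^ n) := by
    intro n
    rw [hf, correlation_comp_colWord hμ hd hK hv hev]
    have h1 : (∑ w, (v w : ℂ) ^ 2) = ((∑ w, v w ^ 2 : ℝ) : ℂ) := by push_cast; rfl
    rw [h1, norm_mul, norm_inv, norm_mul, norm_mul, norm_mul, norm_mul, norm_pow,
      Complex.norm_natCast, Complex.norm_natCast, Complex.norm_natCast, Complex.norm_real,
      Complex.norm_real, Real.norm_eq_abs, Real.norm_eq_abs, abs_of_pos hsum, Complex.norm_ofNat,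
      ← hq, hA]
    field_simp
  constructor
  · rw [← hqd]
    obtain ⟨C, hC⟩ := hdecay f hloc
    -- Raising r to an integer k is harmless, because the base n + 1 is at least 1.
    obtain ⟨k, hk⟩ := exists_nat_ge r
    refine abs_le_of_wordSeq_le (B := |C| / A) (k := k) hq1 fun n => ?_
    have h1 := hC n
    rw [hcorr] at h1
    have h2 : A * (|wordSeq ev q n| / q ^ n) ≤ |C| * (n + 1) ^ k * (1 / √q) ^ n := by
      refine h1.trans ?_
      have h3 : ((n + 1 : ℕ) : ℝ) ^ r ≤ ((n : ℝ) + 1) ^ k := by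
        rw [← Real.rpow_natCast]
        push_cast
        exact Real.rpow_le_rpow_of_exponent_le (by linarith [(n.cast_nonneg : (0 : ℝ) ≤ n)]) hk
      have h4 : (1 / √q) ^ (n + 1) ≤ (1 / √q) ^ n :=
        pow_le_pow_of_le_one (by positivity) ((div_le_one (by linarith)).2 hs) (by simp)
      gcongr
      exact le_abs_self C
    have h5 : (1 / √q) ^ n * q ^ n = √q ^ n := by
      rw [← mul_pow]
      congr 1
      rw [one_div, inv_mul_eq_iff_eq_mul₀ (by positivity), Real.mul_self_sqrt (by linarith)]
    have h6 : |wordSeq ev q n| * A ≤ |C| * (n + 1) ^ k * √q ^ n := by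
      rw [← h5]
      rw [← mul_div_assoc, div_le_iff₀ (by positivity)] at h2
      linarith
    calc |wordSeq ev q n| ≤ |C| * (n + 1) ^ k * √q ^ n / A := (le_div_iff₀ hA0).2 h6
      _ = _ := by ring
  -- For |ev| = q + 1 the autocorrelations have the constant positive size A (q + 1).
  · intro habs
    have h1 := (hmix f hloc).norm
    simp only [hcorr, norm_zero] at h1
    have h2 : ∀ n, A * (|wordSeq ev q n| / q ^ n) = A * (q + 1) := by
      intro n
      rw [abs_wordSeq_of_abs_eq (by linarith) (by rw [habs, hqd]; ring),
        mul_div_cancel_right₀ _ (by positivity)]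
    simp only [h2] at h1
    have h3 := tendsto_nhds_unique h1 tendsto_const_nhds
    have : 0 < A * (q + 1) := by positivity
    linarith

end VHDatum

/-! ### Mixing on locally constant functions -/

namespace PlaneSubshift

variable {W : Type*} [TopologicalSpace W] [DiscreteTopology W] [MeasurableSpace W]
  [MeasurableSingletonClass W] [Finite W] {X : PlaneSubshift W} {μ : Measure X.carrier} {q : ℕ}

theorem measureDense_isClopen [IsFiniteMeasure μ] :
    μ.MeasureDense {s : Set X.carrier | IsClopen s} := by
  have h𝒜 : IsSetAlgebra {s : Set X.carrier | IsClopen s} :=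
    ⟨isClopen_empty, fun s hs => IsClopen.compl hs, fun s t hs ht => IsClopen.union hs ht⟩
  refine .of_generateFrom_isSetAlgebra_finite _ h𝒜 (le_antisymm ?_ ?_)
  · rw [Subtype.instMeasurableSpace, MeasurableSpace.pi, MeasurableSpace.comap_iSup]
    refine iSup_le fun b => ?_
    rw [MeasurableSpace.comap_comp]
    rintro _ ⟨S, -, rfl⟩
    exact MeasurableSpace.measurableSet_generateFrom
      ((isClopen_discrete S).preimage (continuous_eval b))
  · exact MeasurableSpace.generateFrom_le fun s hs => (IsClopen.isOpen hs).measurableSet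

/-- Locally constant functions are dense in `L²`. -/
theorem exists_isLocallyConstant_eLpNorm_sub_le [IsFiniteMeasure μ] {f : X.carrier → ℂ}
    (hf : MemLp f 2 μ) {ε : ℝ≥0∞} (hε : ε ≠ 0) :
    ∃ g : X.carrier → ℂ, eLpNorm (f - g) 2 μ ≤ ε ∧ IsLocallyConstant g := by
  refine MemLp.induction_dense (by simp) _ (fun c s hs _ ε hε => ?_) (fun f g hf hg => hf.add hg)
    (fun f hf => hf.continuous.aestronglyMeasurable) hf hε
  obtain ⟨η, hη, h⟩ := exists_eLpNorm_indicator_le (μ := μ) (p := 2) (by simp) c hε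
  obtain ⟨t, ht, hst⟩ := measureDense_isClopen.approx s hs (measure_ne_top μ s) η hη
  refine ⟨t.indicator fun _ => c, ?_, ?_⟩
  · rw [eLpNorm_indicator_sub_indicator, symmDiff_comm]
    exact h _ (hst.le.trans_eq (by simp))
  · exact ((LocallyConstant.const _ c).indicator ht).isLocallyConstant

theorem _root_.MeasureTheory.norm_integral_mul_le {α : Type*} [MeasurableSpace α] {μ : Measure α} {f g : α → ℂ}
    (hf : MemLp f 2 μ) (hg : MemLp g 2 μ) :
    ‖∫ x, f x * g x ∂μ‖ ≤ (eLpNorm f 2 μ).toReal * (eLpNorm g 2 μ).toReal := by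
  have h1 : eLpNorm (f • g) 1 μ ≤ eLpNorm f 2 μ * eLpNorm g 2 μ :=
    eLpNorm_smul_le_mul_eLpNorm hg.1 hf.1
  have h2 : ‖∫ x, f x * g x ∂μ‖ₑ ≤ eLpNorm (f • g) 1 μ := by
    rw [eLpNorm_one_eq_lintegral_enorm]
    exact enorm_integral_le_lintegral_enorm _
  have h3 := ENNReal.toReal_mono (ENNReal.mul_ne_top hf.2.ne hg.2.ne) (h2.trans h1)
  rwa [toReal_enorm, ENNReal.toReal_mul] at h3

theorem _root_.MeasureTheory.norm_integral_le_eLpNorm {α : Type*} [MeasurableSpace α]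
    {μ : Measure α} [IsProbabilityMeasure μ] {f : α → ℂ}
    (hf : MemLp f 2 μ) : ‖∫ x, f x ∂μ‖ ≤ (eLpNorm f 2 μ).toReal := by
  have h := norm_integral_mul_le hf (memLp_const (1 : ℂ))
  have h1 : eLpNorm (fun _ : α => (1 : ℂ)) 2 μ = 1 := by
    rw [eLpNorm_const _ (by simp) (IsProbabilityMeasure.ne_zero μ)]
    simp
  simpa [h1] using h

theorem IsNaturalMeasure.norm_correlation_le (hμ : X.IsNaturalMeasure q μ)
    {f g : X.carrier → ℂ} (hf : MemLp f 2 μ) (hg : MemLp g 2 μ) (n : ℤ × ℤ) :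
    ‖X.correlation μ f g n‖ ≤ 2 * ((eLpNorm f 2 μ).toReal * (eLpNorm g 2 μ).toReal) := by
  have := hμ.1
  have hσ := hμ.measurePreserving_shift n
  have h1 := norm_integral_mul_le (hf.comp_measurePreserving hσ) hg
  rw [eLpNorm_comp_measurePreserving hf.1 hσ] at h1
  have h2 := norm_integral_le_eLpNorm hf
  have h3 := norm_integral_le_eLpNorm hg
  refine (norm_sub_le _ _).trans ?_
  rw [norm_mul, two_mul]
  exact add_le_add h1 (by gcongr)

theorem IsNaturalMeasure.correlation_sub_left (hμ : X.IsNaturalMeasure q μ)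
    {f f' g : X.carrier → ℂ} (hf : MemLp f 2 μ) (hf' : MemLp f' 2 μ) (hg : MemLp g 2 μ)
    (n : ℤ × ℤ) :
    X.correlation μ (f - f') g n = X.correlation μ f g n - X.correlation μ f' g n := by
  have := hμ.1
  have hσ := hμ.measurePreserving_shift n
  simp only [correlation, Pi.sub_apply, sub_mul]
  have h1 : Integrable (fun x => f (X.shift n x) * g x) μ :=
    (hf.comp_measurePreserving hσ).integrable_mul hg
  have h2 : Integrable (fun x => f' (X.shift n x) * g x) μ :=
    (hf'.comp_measurePreserving hσ).integrable_mul hg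
  rw [integral_sub h1 h2,
    integral_sub (hf.integrable one_le_two) (hf'.integrable one_le_two)]
  ring

theorem IsNaturalMeasure.correlation_sub_right (hμ : X.IsNaturalMeasure q μ)
    {f g g' : X.carrier → ℂ} (hf : MemLp f 2 μ) (hg : MemLp g 2 μ) (hg' : MemLp g' 2 μ)
    (n : ℤ × ℤ) :
    X.correlation μ f (g - g') n = X.correlation μ f g n - X.correlation μ f g' n := by
  have := hμ.1
  have hσ := hμ.measurePreserving_shift n
  simp only [correlation, Pi.sub_apply, mul_sub]
  have h1 : Integrable (fun x => f (X.shift n x) * g x) μ :=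
    (hf.comp_measurePreserving hσ).integrable_mul hg
  have h2 : Integrable (fun x => f (X.shift n x) * g' x) μ :=
    (hf.comp_measurePreserving hσ).integrable_mul hg'
  rw [integral_sub h1 h2,
    integral_sub (hg.integrable one_le_two) (hg'.integrable one_le_two)]
  ring

theorem memLp_of_isLocallyConstant [IsFiniteMeasure μ] {f : X.carrier → ℂ}
    (hf : IsLocallyConstant f) : MemLp f 2 μ := by
  obtain ⟨M, hM⟩ := isCompact_univ.exists_bound_of_continuousOn hf.continuous.continuousOn
  exact MemLp.of_bound hf.continuous.aestronglyMeasurable M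
    (Eventually.of_forall fun x => hM x (Set.mem_univ x))

/-- It suffices to verify strong mixing on locally constant functions. -/
theorem IsNaturalMeasure.isStronglyMixing (hμ : X.IsNaturalMeasure q μ)
    (h : ∀ f g : X.carrier → ℂ, IsLocallyConstant f → IsLocallyConstant g →
      Tendsto (X.correlation μ f g) cofinite (nhds 0)) : X.IsStronglyMixing μ := by
  have := hμ.1
  intro f g hf hg
  set A := (eLpNorm f 2 μ).toReal
  set B := (eLpNorm g 2 μ).toReal
  have hA : 0 ≤ A := ENNReal.toReal_nonneg
  have hB : 0 ≤ B := ENNReal.toReal_nonneg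
  refine Metric.tendsto_nhds.2 fun ε hε => ?_
  -- Replacing f costs at most 2Bδ and replacing g at most 2(A + 1)δ, half of ε in total.
  obtain ⟨δ, hδ, hδ1, hδε⟩ : ∃ δ : ℝ, 0 < δ ∧ δ ≤ 1 ∧ 2 * (A + B + 1) * δ ≤ ε / 2 := by
    refine ⟨min 1 (ε / 2 / (2 * (A + B + 1))), by positivity, min_le_left _ _, ?_⟩
    rw [mul_comm, ← le_div_iff₀ (by positivity)]
    exact min_le_right _ _
  have hδ0 : ENNReal.ofReal δ ≠ 0 := by simpa using hδ
  obtain ⟨f', hff', hf'⟩ := exists_isLocallyConstant_eLpNorm_sub_le hf hδ0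
  obtain ⟨g', hgg', hg'⟩ := exists_isLocallyConstant_eLpNorm_sub_le hg hδ0
  have hf'2 : MemLp f' 2 μ := memLp_of_isLocallyConstant hf'
  have hg'2 : MemLp g' 2 μ := memLp_of_isLocallyConstant hg'
  have h1 : (eLpNorm (f - f') 2 μ).toReal ≤ δ := ENNReal.toReal_le_of_le_ofReal hδ.le hff'
  have h2 : (eLpNorm (g - g') 2 μ).toReal ≤ δ := ENNReal.toReal_le_of_le_ofReal hδ.le hgg'
  have h3 : (eLpNorm f' 2 μ).toReal ≤ A + 1 := by
    have h4 : eLpNorm f' 2 μ ≤ eLpNorm f 2 μ + eLpNorm (f - f') 2 μ := by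
      have := eLpNorm_sub_le (p := 2) hf.1 (hf.sub hf'2).1 (by norm_num)
      rwa [sub_sub_cancel] at this
    have h5 := ENNReal.toReal_mono (ENNReal.add_ne_top.2 ⟨hf.2.ne, (hf.sub hf'2).2.ne⟩) h4
    rw [ENNReal.toReal_add hf.2.ne (hf.sub hf'2).2.ne] at h5
    linarith
  filter_upwards [Metric.tendsto_nhds.1 (h f' g' hf' hg') (ε / 2) (by positivity)] with n hn
  rw [dist_zero_right] at hn ⊢
  have h6 : X.correlation μ f g n = X.correlation μ (f - f') g n +
      X.correlation μ f' (g - g') n + X.correlation μ f' g' n := by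
    rw [hμ.correlation_sub_left hf hf'2 hg, hμ.correlation_sub_right hf'2 hg hg'2]
    ring
  have h7 := hμ.norm_correlation_le (hf.sub hf'2) hg n
  have h8 := hμ.norm_correlation_le hf'2 (hg.sub hg'2) n
  have h9 : (eLpNorm (f - f') 2 μ).toReal * B ≤ δ * B := by gcongr
  have h10 : (eLpNorm f' 2 μ).toReal * (eLpNorm (g - g') 2 μ).toReal ≤ (A + 1) * δ := by gcongr
  rw [h6]
  refine (norm_add₃_le).trans_lt ?_
  change _ ≤ 2 * (_ * B) at h7
  nlinarith

theorem IsNaturalMeasure.correlation_neg (hμ : X.IsNaturalMeasure q μ) {f g : X.carrier → ℂ}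
    (hf : IsLocallyConstant f) (hg : IsLocallyConstant g) (n : ℤ × ℤ) :
    X.correlation μ f g (-n) = X.correlation μ g f n := by
  have h := hμ.integral_shift ((isLocallyConstant_comp_shift hf (-n)).mul hg) n
  simp only [Pi.mul_apply, ← shift_add, add_neg_cancel, shift_zero] at h
  rw [correlation, correlation, ← h, mul_comm (∫ x, f x ∂μ)]
  simp only [mul_comm]

/-- Lets the vertical component of a shift be absorbed into f. -/
theorem IsNaturalMeasure.correlation_add (hμ : X.IsNaturalMeasure q μ) {f g : X.carrier → ℂ}
    (hf : IsLocallyConstant f) (m n : ℤ × ℤ) :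
    X.correlation μ f g (n + m) = X.correlation μ (fun x => f (X.shift m x)) g n := by
  rw [correlation, correlation, hμ.integral_shift hf]
  simp only [shift_add]

end PlaneSubshift

/-! ### Exclusion of d = 1. -/

/-- On two points every permutation multiplies the sign function by some ε = ±1, and its inverse by
the same ε. The sign function has mean zero and eigenvalue 2ε, which is a forbidden value. Since q =
1 gives no decay, this case has to be ruled out before mixing can be derived. -/
theorem LoopMultigraph.not_hasSpectralGap_one {S Ω : Type*} [Fintype S] [Fintype Ω] {i : S → S}
    {U : S → Equiv.Perm Ω} (hi : ∀ s, i s ≠ s) (hU : ∀ s, U (i s) = (U s)⁻¹)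
    (hS : Fintype.card S = 2) (hΩ : Fintype.card Ω = 2) : ¬ HasSpectralGap U 1 := by
  classical
  intro hgap
  have e : Ω ≃ Bool := Fintype.equivOfCardEq (by simp [hΩ])
  let f : Bool → ℝ := fun b => if b then 1 else -1
  let v : Ω → ℝ := fun w => f (e w)
  have hsign : ∀ σ : Equiv.Perm Ω, ∃ ε : ℝ, ε ^ 2 = 1 ∧ ∀ w, v (σ w) = ε * v w := by
    intro σ
    have h1 : ∀ τ : Equiv.Perm Bool, τ = 1 ∨ τ = Equiv.swap true false := by decide
    have h2 : ∀ w, v (σ w) = f (e.permCongr σ (e w)) := fun w => by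
      simp [v, Equiv.permCongr_apply]
    rcases h1 (e.permCongr σ) with h | h
    · exact ⟨1, by norm_num, fun w => by rw [h2, h]; simp [v]⟩
    · refine ⟨-1, by norm_num, fun w => ?_⟩
      rw [h2, h]
      cases hw : e w <;> simp [v, f, hw]
  obtain ⟨s⟩ : Nonempty S := Fintype.card_pos_iff.1 (by omega)
  have huniv : ({s, i s} : Finset S) = Finset.univ :=
    Finset.eq_univ_of_card _ (by rw [Finset.card_pair (hi s).symm, hS])
  obtain ⟨ε, hε, hv⟩ := hsign (U s)
  have hv' : ∀ w, v ((U s)⁻¹ w) = ε * v w := by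
    intro w
    have := hv ((U s)⁻¹ w)
    rw [show U s ((U s)⁻¹ w) = w from Equiv.apply_symm_apply (U s) w] at this
    rw [this, ← mul_assoc, ← sq, hε, one_mul]
  have hv0 : v ≠ 0 := fun h => by
    have := congrFun h (e.symm true)
    simp [v, f] at this
  have hsum : ∑ w, v w = 0 := by
    rw [Equiv.sum_comp e f]
    simp [f]
  refine (hgap v (2 * ε) hv0 hsum fun w => ?_).2 ?_
  · rw [← huniv, Finset.sum_pair (hi s).symm, hU, hv, hv']
    ring
  · have : |ε| = 1 :=
      (pow_eq_one_iff_of_nonneg (abs_nonneg ε) two_ne_zero).1 (by rw [sq_abs, hε])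
    rw [abs_mul, this]
    simp

/-! ### Interchanging the two directions -/

namespace VHDatum

open PlaneSubshift

variable {V H : Type*} {d : ℕ} {D : VHDatum V H d d}

/-- The reflected tile. -/
def Tile.transpose (t : D.Tile) : D.transpose.Tile :=
  ⟨(t.1.2.2.1, t.1.2.2.2, t.1.1, t.1.2.1), t.2⟩

variable (D) in
/-- The reflection of the subshift along the diagonal. -/
def transposeHomeomorph : D.subshift.carrier ≃ₜ D.transpose.subshift.carrier where
  toFun x := ⟨fun b : ℤ × ℤ => (x.1 b.swap).transpose, fun n m => ⟨(x.2 m n).2, (x.2 m n).1⟩⟩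
  invFun x := ⟨fun b : ℤ × ℤ => (x.1 b.swap).transpose, fun n m => ⟨(x.2 m n).2, (x.2 m n).1⟩⟩
  left_inv _ := rfl
  right_inv _ := rfl
  continuous_toFun := Continuous.subtype_mk (continuous_pi fun b : ℤ × ℤ =>
    (continuous_of_discreteTopology (f := Tile.transpose (D := D))).comp
      (continuous_eval b.swap)) _
  continuous_invFun := Continuous.subtype_mk (continuous_pi fun b : ℤ × ℤ =>
    (continuous_of_discreteTopology (f := Tile.transpose (D := D.transpose))).comp
      (continuous_eval b.swap)) _

theorem transposeHomeomorph_apply (x : D.subshift.carrier) (b : ℤ × ℤ) :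
    (D.transposeHomeomorph x).1 b = (x.1 b.swap).transpose := rfl

theorem transpose_injective : Function.Injective (Tile.transpose (D := D)) :=
  Function.LeftInverse.injective (g := Tile.transpose (D := D.transpose)) fun _ => rfl

theorem shift_transposeHomeomorph (a : ℤ × ℤ) (x : D.subshift.carrier) :
    D.transpose.subshift.shift a (D.transposeHomeomorph x) =
      D.transposeHomeomorph (D.subshift.shift a.swap x) := rfl

theorem symbolCount_transpose : D.transpose.subshift.symbolCount = D.subshift.symbolCount := by
  rw [symbolCount, symbolCount, ← Set.ncard_image_of_injective _ (transpose_injective (D := D))]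
  congr 1
  ext t
  constructor
  · rintro ⟨x, hx, rfl⟩
    exact ⟨_, ⟨(D.transposeHomeomorph.symm ⟨x, hx⟩).1, (D.transposeHomeomorph.symm ⟨x, hx⟩).2, rfl⟩,
      rfl⟩
  · rintro ⟨_, ⟨x, hx, rfl⟩, rfl⟩
    exact ⟨(D.transposeHomeomorph ⟨x, hx⟩).1, (D.transposeHomeomorph ⟨x, hx⟩).2, rfl⟩

section

variable [Finite V] [Finite H]

theorem isNaturalMeasure_transpose {q : ℕ} {μ : Measure D.subshift.carrier}
    (hμ : D.subshift.IsNaturalMeasure q μ) :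
    D.transpose.subshift.IsNaturalMeasure q (μ.map D.transposeHomeomorph) := by
  have := hμ.1
  have hm : Measurable D.transposeHomeomorph := D.transposeHomeomorph.continuous.measurable
  refine ⟨Measure.isProbabilityMeasure_map hm.aemeasurable, fun a m n x => ?_⟩
  obtain ⟨x, rfl⟩ := D.transposeHomeomorph.surjective x
  have hs : MeasurableSet {y : D.transpose.subshift.carrier |
      ∀ b ∈ Set.Icc a (a + ((m : ℤ), (n : ℤ))), y.1 b = (D.transposeHomeomorph x).1 b} := by
    have := (isClopen_cylinder (Finset.Icc a (a + ((m : ℤ), (n : ℤ))))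
      (D.transposeHomeomorph x)).isOpen.measurableSet
    rwa [Finset.coe_Icc] at this
  rw [Measure.map_apply hm hs, symbolCount_transpose, mul_right_comm, ← hμ.2 a.swap n m x]
  congr 1
  ext y
  simp only [Set.mem_preimage, Set.mem_ofPred_eq, transposeHomeomorph_apply,
    transpose_injective.eq_iff]
  constructor
  · intro h b hb
    have := h b.swap (by
      simp only [Set.mem_Icc, Prod.le_def, Prod.fst_add, Prod.snd_add, Prod.fst_swap,
        Prod.snd_swap] at hb ⊢
      tauto)
    simpa using this
  · intro h b hb
    exact h b.swap (by
      simp only [Set.mem_Icc, Prod.le_def, Prod.fst_add, Prod.snd_add, Prod.fst_swap,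
        Prod.snd_swap] at hb ⊢
      tauto)

theorem correlation_transpose (μ : Measure D.subshift.carrier)
    (f g : D.transpose.subshift.carrier → ℂ) (n : ℤ × ℤ) :
    D.transpose.subshift.correlation (μ.map D.transposeHomeomorph) f g n =
      D.subshift.correlation μ (f ∘ D.transposeHomeomorph) (g ∘ D.transposeHomeomorph) n.swap := by
  have h : ∀ f : D.transpose.subshift.carrier → ℂ,
      ∫ y, f y ∂(μ.map D.transposeHomeomorph) = ∫ x, f (D.transposeHomeomorph x) ∂μ := fun f =>
    integral_map_equiv D.transposeHomeomorph.toMeasurableEquiv f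
  simp only [correlation, h, shift_transposeHomeomorph, Function.comp_def]

end

/-! ### Decay of correlations in all directions -/

theorem supNorm_eq_left {n : ℤ × ℤ} (h : n.2.natAbs ≤ n.1.natAbs) : supNorm n = n.1.natAbs :=
  max_eq_left h

theorem supNorm_swap (n : ℤ × ℤ) : supNorm n.swap = supNorm n := max_comm _ _

theorem supNorm_neg (n : ℤ × ℤ) : supNorm (-n) = supNorm n := by simp [supNorm]

/-- A vertical shift by b moves the window inside a rectangle of the same width 2k + 1 and of height
2K + 1; only the height grows with b. -/
theorem factorsThrough_colWord_rowWord {f : D.subshift.carrier → ℂ} {k K : ℕ} {b : ℤ}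
    (hf : ∀ x y : D.subshift.carrier, (∀ c ∈ square k, x.1 c = y.1 c) → f x = f y)
    (hK : k + b.natAbs ≤ K) :
    Function.FactorsThrough (fun x => f (D.subshift.shift (0, b) x)) fun x =>
      (colWord (-(k : ℤ), -(K : ℤ)) (2 * K + 1) x, (rowWord (-(k : ℤ), -(K : ℤ)) (2 * k + 1) x).1) := by
  intro x y hxy
  rw [Prod.mk.injEq] at hxy
  have h := (eqOn_Icc_iff_colWord_rowWord (-(k : ℤ), -(K : ℤ)) (2 * k) (2 * K) y x).2
    ⟨hxy.1, Subtype.ext hxy.2⟩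
  refine hf _ _ fun c hc => ?_
  rw [shift_apply, shift_apply]
  refine h _ ?_
  rw [mem_square] at hc
  simp only [Set.mem_Icc, Prod.le_def, Prod.fst_add, Prod.snd_add]
  push_cast
  omega

variable [Fintype V] [Fintype H]

/-- In the cone |n₂| ≤ |n₁| the norm of n is |n₁|. The vertical part goes into f, at the price of a
rectangle whose height depends on n, and the horizontal estimate applies with a constant independent
of that height. -/
theorem exists_norm_correlation_le_of_le (hd : 1 ≤ d) (hgap : ∀ K, D.SpectralGap K)
    {μ : Measure D.subshift.carrier} (hμ : D.subshift.IsNaturalMeasure (2 * d - 1) μ)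
    {f g : D.subshift.carrier → ℂ} (hf : IsLocallyConstant f) (hg : IsLocallyConstant g) :
    ∃ C : ℝ, 0 < C ∧ ∀ n : ℤ × ℤ, n ≠ 0 → n.2.natAbs ≤ n.1.natAbs →
      ‖D.subshift.correlation μ f g n‖ ≤
        C * supNorm n ^ 3 * (1 / √((2 * d - 1 : ℕ) : ℝ)) ^ supNorm n := by
  obtain ⟨kf, hkf⟩ := exists_window hf
  obtain ⟨kg, hkg⟩ := exists_window hg
  set k := max kf kg with hk
  have hwin : ∀ {e : D.subshift.carrier → ℂ} {k' : ℕ}, k' ≤ k →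
      (∀ x y : D.subshift.carrier, (∀ c ∈ square k', x.1 c = y.1 c) → e x = e y) →
      ∀ x y : D.subshift.carrier, (∀ c ∈ square k, x.1 c = y.1 c) → e x = e y :=
    fun hk' he x y h => he x y fun c hc => h c (square_mono hk' hc)
  have hkf' := hwin (le_max_left _ _) hkf
  have hkg' := hwin (le_max_right _ _) hkg
  obtain ⟨Mf, hMf⟩ := isCompact_univ.exists_bound_of_continuousOn hf.continuous.continuousOn
  obtain ⟨Mg, hMg⟩ := isCompact_univ.exists_bound_of_continuousOn hg.continuous.continuousOn
  obtain ⟨C, hC, h⟩ := exists_norm_correlation_le hd hgap hμ (2 * k)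
  obtain ⟨x₀⟩ := nonempty_subshift (D := D) hd
  have hMf0 : 0 ≤ Mf := (norm_nonneg _).trans (hMf x₀ trivial)
  have hMg0 : 0 ≤ Mg := (norm_nonneg _).trans (hMg x₀ trivial)
  have key : ∀ {e e' : D.subshift.carrier → ℂ} {M M' : ℝ}, IsLocallyConstant e →
      (∀ x y : D.subshift.carrier, (∀ c ∈ square k, x.1 c = y.1 c) → e x = e y) →
      (∀ x y : D.subshift.carrier, (∀ c ∈ square k, x.1 c = y.1 c) → e' x = e' y) →
      (∀ x, ‖e x‖ ≤ M) → (∀ x, ‖e' x‖ ≤ M') → ∀ n : ℤ × ℤ, 0 < n.1 → n.2.natAbs ≤ n.1.natAbs →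
      ‖D.subshift.correlation μ e e' n‖ ≤
        C * M * M' * supNorm n ^ 3 * (1 / √((2 * d - 1 : ℕ) : ℝ)) ^ supNorm n := by
    intro e e' M M' hel he he' hM hM' n hn hn'
    have hn1 : (n.1.natAbs : ℤ) = n.1 := Int.natAbs_of_nonneg hn.le
    have e1 : n = ((n.1.natAbs : ℤ), 0) + (0, n.2) := by
      ext <;> simp [hn1]
    rw [supNorm_eq_left hn']
    conv_lhs => rw [e1]
    rw [hμ.correlation_add hel]
    refine h (-(k : ℤ), -((k + n.2.natAbs : ℕ) : ℤ)) (2 * (k + n.2.natAbs) + 1) (by omega) _ _ M M'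
      (fun x => hM _) hM' (factorsThrough_colWord_rowWord he le_rfl) ?_ n.1.natAbs (by omega)
    have := factorsThrough_colWord_rowWord (b := 0) (K := k + n.2.natAbs) he' (by simp)
    have e0 : ((0 : ℤ), (0 : ℤ)) = 0 := rfl
    simpa only [e0, shift_zero] using this
  -- The added 1 keeps the constant positive when a bound is 0.
  refine ⟨C * (Mf * Mg + 1), by positivity, fun n hn0 hn => ?_⟩
  have hle : C * Mf * Mg * supNorm n ^ 3 * (1 / √((2 * d - 1 : ℕ) : ℝ)) ^ supNorm n ≤
      C * (Mf * Mg + 1) * supNorm n ^ 3 * (1 / √((2 * d - 1 : ℕ) : ℝ)) ^ supNorm n := by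
    rw [mul_assoc C]
    gcongr
    linarith
  refine le_trans ?_ hle
  rcases lt_trichotomy n.1 0 with h1 | h1 | h1
  -- Invariance of μ turns a shift to the left into one to the right with f and g exchanged.
  · rw [← neg_neg n, hμ.correlation_neg hf hg, supNorm_neg (-n), mul_assoc C, mul_comm Mf,
      ← mul_assoc C]
    exact key hg hkg' hkf' (fun x => hMg x trivial) (fun x => hMf x trivial) (-n) (by simpa using h1)
      (by simpa using hn)
  · refine absurd (Prod.ext h1 ?_) hn0
    rw [h1] at hn
    simpa using hn
  · exact key hf hkf' hkg' (fun x => hMf x trivial) (fun x => hMg x trivial) n h1 hn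

/-- The cone |n₁| ≤ |n₂| is the previous one for the transposed datum, whose natural measure is the
reflected one. -/
theorem exists_norm_correlation_le_of_ne (hd : 1 ≤ d) (hgap : ∀ K, D.SpectralGap K)
    (hgap' : ∀ K, D.transpose.SpectralGap K) {μ : Measure D.subshift.carrier}
    (hμ : D.subshift.IsNaturalMeasure (2 * d - 1) μ) {f g : D.subshift.carrier → ℂ}
    (hf : IsLocallyConstant f) (hg : IsLocallyConstant g) :
    ∃ C : ℝ, 0 < C ∧ ∀ n : ℤ × ℤ, n ≠ 0 → ‖D.subshift.correlation μ f g n‖ ≤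
        C * supNorm n ^ 3 * (1 / √((2 * d - 1 : ℕ) : ℝ)) ^ supNorm n := by
  obtain ⟨C, hC, h⟩ := exists_norm_correlation_le_of_le hd hgap hμ hf hg
  obtain ⟨C', hC', h'⟩ := exists_norm_correlation_le_of_le hd hgap' (isNaturalMeasure_transpose hμ)
    (hf.comp_continuous D.transposeHomeomorph.symm.continuous)
    (hg.comp_continuous D.transposeHomeomorph.symm.continuous)
  refine ⟨max C C', lt_max_of_lt_left hC, fun n hn => ?_⟩
  rcases le_total n.2.natAbs n.1.natAbs with hle | hle
  · refine (h n hn hle).trans ?_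
    gcongr
    exact le_max_left _ _
  · have h1 := h' n.swap (fun h0 => hn (by simpa using congrArg Prod.swap h0)) hle
    rw [correlation_transpose, supNorm_swap, Prod.swap_swap] at h1
    refine (le_trans (le_of_eq ?_) h1).trans ?_
    · congr 2
    · gcongr
      exact le_max_right _ _

/-- A spectral gap forces `d ≥ 2`. -/
theorem two_le_of_spectralGap (hd : 1 ≤ d) (hgap : D.SpectralGap 1) : 2 ≤ d := by
  classical
  by_contra! hlt
  obtain rfl : d = 1 := by omega
  refine LoopMultigraph.not_hasSpectralGap_one D.invH_ne (D.colTransducer.actWord_j 1)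
    D.card_H_eq ?_ hgap
  have h := sum_reducedWord D.invV 0 fun _ => (1 : ℂ)
  have hV : Fintype.card V = 2 := by rw [← Nat.card_eq_fintype_card, D.card_V]
  simp only [followSum_zero, Finset.sum_const, Finset.card_univ, hV, nsmul_eq_mul, mul_one] at h
  exact_mod_cast h

/-- The exponent r = 3 is the power of n in the bound for T^n. The rate tends to zero because d ≥ 2
makes q > 1, and this gives mixing on locally constant functions. -/
theorem isRamanujan_of_spectralGap (hd : 1 ≤ d) (hgap : ∀ K, D.SpectralGap K)
    (hgap' : ∀ K, D.transpose.SpectralGap K) : D.subshift.IsRamanujan (2 * d - 1) := by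
  obtain ⟨μ, hμ⟩ := exists_isNaturalMeasure (D := D) hd
  have h := fun (f g : D.subshift.carrier → ℂ) (hf : IsLocallyConstant f)
    (hg : IsLocallyConstant g) => exists_norm_correlation_le_of_ne hd hgap hgap' hμ hf hg
  refine ⟨subshift_isRegular, μ, hμ, hμ.isStronglyMixing fun f g hf hg => ?_, 3, by norm_num,
    fun f g hf hg => ?_⟩
  · obtain ⟨C, hC, h⟩ := h f g hf hg
    have h2 := two_le_of_spectralGap hd (hgap 1)
    set ρ : ℝ := 1 / √((2 * d - 1 : ℕ) : ℝ) with hρ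
    have hρ0 : 0 ≤ ρ := by positivity
    have hρ1 : ρ < 1 := by
      have : 1 < √((2 * d - 1 : ℕ) : ℝ) := by
        rw [Real.lt_sqrt zero_le_one, one_pow]
        exact_mod_cast (by omega : 1 < 2 * d - 1)
      rw [hρ, div_lt_one (by linarith)]
      exact this
    have h3 : Tendsto supNorm cofinite atTop := by
      refine tendsto_atTop.2 fun N => ?_
      refine (Finset.finite_toSet (square N)).subset fun n hn => ?_
      simp only [Set.mem_compl_iff, Set.mem_ofPred_eq, not_le] at hn
      rw [Finset.mem_coe, mem_square]
      simp only [supNorm] at hn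
      omega
    have h4 : Tendsto (fun m : ℕ => C * (m : ℝ) ^ 3 * ρ ^ m) atTop (nhds 0) := by
      have := (tendsto_pow_const_mul_const_pow_of_lt_one 3 hρ0 hρ1).const_mul C
      simpa [mul_assoc] using this
    refine squeeze_zero_norm' ?_ (h4.comp h3)
    filter_upwards [(Set.finite_singleton (0 : ℤ × ℤ)).compl_mem_cofinite] with n hn
    exact h n hn
  · obtain ⟨C, hC, h⟩ := h f g hf hg
    refine ⟨C, hC, fun n hn => ?_⟩
    have := h n hn
    rwa [← Real.rpow_natCast] at this

/-- Restricting the shifts to the positive first axis gives the gaps for D, and restricting them to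
the second axis gives those for its transpose. -/
theorem spectralGap_of_isRamanujan (hd : 1 ≤ d) (h : D.subshift.IsRamanujan (2 * d - 1)) :
    (∀ K, D.SpectralGap K) ∧ ∀ K, D.transpose.SpectralGap K := by
  obtain ⟨-, μ, hμ, hmix, r, hr, hdecay⟩ := h
  have hmem : ∀ {f : D.subshift.carrier → ℂ}, IsLocallyConstant f → MemLp f 2 μ := fun hf =>
    have := hμ.1
    memLp_of_isLocallyConstant hf
  constructor
  · refine spectralGap_of_decay hd hμ (fun f hf => ?_) (r := r) fun f hf => ?_
    · refine (hmix f f (hmem hf) (hmem hf)).comp ?_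
      refine Nat.cofinite_eq_atTop ▸ Function.Injective.tendsto_cofinite fun m n hmn => ?_
      simpa using hmn
    · obtain ⟨C, -, hC⟩ := hdecay f f hf hf
      refine ⟨C, fun n => ?_⟩
      have h1 := hC (((n + 1 : ℕ) : ℤ), 0) (by simp [Prod.ext_iff]; omega)
      rwa [supNorm_eq_left (by simp), Int.natAbs_natCast] at h1
  · refine spectralGap_of_decay hd (isNaturalMeasure_transpose hμ) (fun f hf => ?_) (r := r)
      fun f hf => ?_
    · have hf' := hf.comp_continuous D.transposeHomeomorph.continuous
      simp only [correlation_transpose]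
      refine (hmix _ _ (hmem hf') (hmem hf')).comp ?_
      refine Nat.cofinite_eq_atTop ▸ Function.Injective.tendsto_cofinite fun m n hmn => ?_
      simpa using hmn
    · have hf' := hf.comp_continuous D.transposeHomeomorph.continuous
      obtain ⟨C, -, hC⟩ := hdecay _ _ hf' hf'
      refine ⟨C, fun n => ?_⟩
      rw [correlation_transpose]
      have h1 := hC (((n + 1 : ℕ) : ℤ), 0).swap (by simp [Prod.ext_iff]; omega)
      rwa [supNorm_swap, supNorm_eq_left (by simp), Int.natAbs_natCast] at h1

end VHDatum

/-! ### The equivalence for subshifts and graphs. -/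

theorem mainTheorem5 {V H : Type*} [Finite V] [Finite H] {d : ℕ} (hd : 1 ≤ d)
    (D : VHDatum V H d d) :
    D.subshift.IsRegular (2 * d - 1) ∧
      (D.subshift.IsRamanujan (2 * d - 1) ↔
        ∀ k : ℕ,
          ((D.graphA k).IsRamanujan (2 * d) ∧ ¬ (D.graphA k).IsBipartite) ∧
          ((D.graphB k).IsRamanujan (2 * d) ∧ ¬ (D.graphB k).IsBipartite)) := by
  have := Fintype.ofFinite V
  have := Fintype.ofFinite H
  refine ⟨VHDatum.subshift_isRegular, ?_⟩
  simp only [D.graphA_isRamanujan_iff hd, D.graphB_isRamanujan_iff hd]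
  constructor
  · intro h k
    have := VHDatum.spectralGap_of_isRamanujan hd h
    exact ⟨this.2 k, this.1 k⟩
  · intro h
    exact VHDatum.isRamanujan_of_spectralGap hd (fun K => (h K).2) fun K => (h K).1
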